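/- Let $k$ be a field, $L$ a Lie $k$-algebra and $U(L)$ its universal enveloping algebra. Write $U_n$ for the $k$-subspace of $U(L)$ spanned by the products of at most $n$ elements of $L$ (so $U_0=k$), and let $T=\bigoplus_{n\ge 0}U_nt^n\subseteq U(L)[t]$ be the Rees ring of this filtration, where $t$ is a central variable; $T/tT$ is the associated graded ring of $U(L)$, a commutative domain. For every $n$ the image of $T\setminus tT$ in $T/t^nT$ is an Ore set; let $T_n$ be the corresponding Ore localization of $T/t^nT$. Cohn's division ring $\mathfrak{D}_L$ (in Lichtman's construction) is the localization of the inverse limit $\varprojlim_n T_n$ at the powers of the central element $t$. It contains $U(L)$ through $x\mapsto t^{-1}(xt)$ for $x\in L$, and $\mathfrak{D}(L)$ denotes the division subring of $\mathfrak{D}_L$ generated by $U(L)$. **Theorem.** Let $k$ be a field of characteristic zero and let $L$ be a nonabelian Lie $k$-algebra (of arbitrary dimension). Suppose that at least one of the following conditions is satisfied: 1. $L$ is residually nilpotent, that is, the intersection of the terms of the lower central series of $L$ is zero; 2. $U(L)$ is an Ore domain, that is, a domain in which any two nonzero elements have a nonzero common left multiple and a nonzero common right multiple. Then $\mathfrak{D}(L)$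 contains a noncommutative free group $k$-algebra: there is an injective homomorphism of $k$-algebras $k[F_2]\to\mathfrak{D}(L)$, where $F_2$ is the free group of rank two. -/

import Mathlib

/-- An Ore domain: a domain in which any two nonzero elements have a
nonzero common left multiple and a nonzero common right multiple. -/
def IsOreDomain (R : Type*) [Ring R] : Prop :=
  IsDomain R ∧
    (∀ a b : R, a ≠ 0 → b ≠ 0 → ∃ c d : R, c * a = d * b ∧ c * a ≠ 0) ∧
    (∀ a b : R, a ≠ 0 → b ≠ 0 → ∃ c d : R, a * c = b * d ∧ a * c ≠ 0)

/-- A Lie algebra is residually nilpotent if the intersection of the terms of its lower central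
series is zero. -/
def IsResiduallyNilpotent (k L : Type*) [CommRing k] [LieRing L] [LieAlgebra k L] : Prop :=
  (⨅ n : ℕ, LieModule.lowerCentralSeries k L L n) = ⊥

/-- The smallest `k`-subalgebra of `D` that contains `X` and contains the inverse of each of its
elements that is invertible in `D`. If `D` is a division ring and `k` a field, this is the division
subring of `D` generated by `k` and `X`. -/
def divisionClosure (k : Type*) {D : Type*} [CommRing k] [Ring D] [Algebra k D] (X : Set D) :
    Subalgebra k D :=
  sInf {S : Subalgebra k D | X ⊆ S ∧ ∀ x ∈ S, ∀ y : D, x * y = 1 → y * x = 1 → y ∈ S}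

/-! Cohn's division ring of a Lie algebra `L` over a field `k`, in Lichtman's construction. The Rees
ring `T` of the standard filtration of the enveloping algebra has a central element `t` such that
`T / (t)` is the associated graded ring, a commutative domain by the theorem of Poincaré, Birkhoff
and Witt. The image in `T / (tⁿ)` of the multiplicative set of the elements outside `(t)` is an Ore
set; the localizations at these sets form an inverse system, whose limit is a local ring with
maximal ideal generated by `t` and residue field the field of fractions of `T / (t)`. Inverting `t`
in the limit gives the division ring `𝔇_L`, which contains the enveloping algebra, and `𝔇(L)` is the
division subring that the enveloping algebra generates. -/

namespace Cohn

open scoped OreLocalization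

noncomputable section

/-! ### Ore sets of central elements, and Ore sets modulo a central nilpotent element -/

section OreSets

variable {A : Type*} [Ring A]

theorem nonempty_oreSet_of_central (S : Submonoid A) (hS : ∀ s ∈ S, ∀ a : A, s * a = a * s) :
    Nonempty (OreLocalization.OreSet S) := by
  rw [OreLocalization.nonempty_oreSet_iff]
  refine ⟨fun r₁ r₂ s h => ⟨s, ?_⟩, fun r s => ⟨r, s, hS s s.2 r⟩⟩
  rw [hS s s.2, hS s s.2, h]

theorem nonempty_oreSet_of_nilpotent (S : Submonoid A) (t : A) (N : ℕ)
    (htc : ∀ a : A, t * a = a * t) (htN : t ^ N = 0)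
    (hcomm : ∀ a b : A, ∃ c : A, a * b - b * a = t * c) :
    Nonempty (OreLocalization.OreSet S) := by
  have htc' : ∀ (i : ℕ) (a : A), t ^ i * a = a * t ^ i := fun i a =>
    ((show Commute t a from htc a).pow_left i).eq
  have key : ∀ (s c : A) (i : ℕ), ∃ c' : A, s * (t ^ i * c) = t ^ (i + 1) * c' + t ^ i * c * s := by
    intro s c i
    obtain ⟨c', hc'⟩ := hcomm s c
    refine ⟨c', ?_⟩
    rw [pow_succ, mul_assoc (t ^ i) t c', ← hc', mul_sub, ← mul_assoc s, ← htc' i s]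
    noncomm_ring
  have ore : ∀ (s : A) (j i : ℕ), i + j = N → ∀ c : A, ∃ r' : A,
      s ^ j * (t ^ i * c) = r' * s := by
    intro s j
    induction j with
    | zero =>
      intro i hi c
      obtain rfl : i = N := by omega
      exact ⟨0, by simp [htN]⟩
    | succ j ih =>
      intro i hi c
      obtain ⟨c', hc'⟩ := key s c i
      obtain ⟨r', hr'⟩ := ih (i + 1) (by omega) c'
      refine ⟨r' + s ^ j * (t ^ i * c), ?_⟩
      rw [pow_succ, mul_assoc, hc', mul_add, hr', add_mul, mul_assoc (s ^ j)]
  have canc : ∀ (s : A) (j i : ℕ), i + j = N → ∀ c : A,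
      (t ^ i * c) * s = 0 → s ^ j * (t ^ i * c) = 0 := by
    intro s j
    induction j with
    | zero =>
      intro i hi c _
      obtain rfl : i = N := by omega
      simp [htN]
    | succ j ih =>
      intro i hi c h0
      obtain ⟨c', hc'⟩ := key s c i
      rw [h0, add_zero] at hc'
      have h1 : t ^ (i + 1) * c' * s = 0 := by rw [← hc', mul_assoc, h0, mul_zero]
      rw [pow_succ, mul_assoc, hc']
      exact ih (i + 1) (by omega) c' h1
  rw [OreLocalization.nonempty_oreSet_iff]
  refine ⟨fun r₁ r₂ s h => ⟨s ^ N, ?_⟩, fun r s => ?_⟩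
  · have h0 : (t ^ 0 * (r₁ - r₂)) * (s : A) = 0 := by simp [sub_mul, h]
    have := canc s N 0 (by omega) (r₁ - r₂) h0
    simpa [mul_sub, sub_eq_zero] using this
  · obtain ⟨r', hr'⟩ := ore s N 0 (by omega) r
    exact ⟨r', s ^ N, by simpa using hr'⟩

end OreSets

attribute [local instance] LieRing.ofAssociativeRing LieAlgebra.ofAssociativeAlgebra

variable (k : Type*) (L : Type*) [Field k] [LieRing L] [LieAlgebra k L]

local notation "U" => UniversalEnvelopingAlgebra k L

/-! ### The standard filtration of the enveloping algebra and its Rees ring -/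

/-- The subspace `k + L` of the enveloping algebra. -/
def filtrationOne : Submodule k (U) :=
  1 ⊔ LinearMap.range (UniversalEnvelopingAlgebra.ι k : L →ₗ⁅k⁆ U).toLinearMap

theorem ι_mem_filtrationOne (x : L) : UniversalEnvelopingAlgebra.ι k x ∈ filtrationOne k L :=
  Submodule.mem_sup_right ⟨x, rfl⟩

/-- The standard (ascending) filtration of the enveloping algebra: the `n`-th term is spanned by
the products of at most `n` elements of `L`. -/
def filtration (n : ℕ) : Submodule k (U) := filtrationOne k L ^ n

theorem filtration_mono : Monotone (filtration k L) :=
  pow_right_mono₀ (show 1 ≤ filtrationOne k L from le_sup_left : (1 : Submodule k (U)) ≤ filtrationOne k L)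

theorem mul_mem_filtration {m n : ℕ} {a b : U} (ha : a ∈ filtration k L m)
    (hb : b ∈ filtration k L n) : a * b ∈ filtration k L (m + n) := by
  rw [filtration, pow_add]; exact Submodule.mul_mem_mul ha hb

theorem one_mem_filtration (n : ℕ) : (1 : U) ∈ filtration k L n :=
  filtration_mono k L (Nat.zero_le n) (by simp [filtration, Submodule.one_le.symm])

/-- The Rees ring of the standard filtration: the polynomials `∑ aₙ tⁿ` in a central variable `t`
over the enveloping algebra for which `aₙ` lies in the `n`-th term of the filtration. -/
def rees : Subalgebra k (Polynomial (U)) where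
  carrier := {p | ∀ n, p.coeff n ∈ filtration k L n}
  mul_mem' := by
    intro p q hp hq n
    rw [Polynomial.coeff_mul]
    refine Submodule.sum_mem _ fun x hx => ?_
    rw [← Finset.HasAntidiagonal.mem_antidiagonal.1 hx]
    exact mul_mem_filtration k L (hp _) (hq _)
  add_mem' := by
    intro p q hp hq n
    rw [Polynomial.coeff_add]
    exact Submodule.add_mem _ (hp n) (hq n)
  algebraMap_mem' := by
    intro r n
    rw [Polynomial.algebraMap_apply, Polynomial.coeff_C]
    split_ifs
    · rw [Algebra.algebraMap_eq_smul_one]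
      exact Submodule.smul_mem _ _ (one_mem_filtration k L n)
    · exact Submodule.zero_mem _

/-- The central element `t` of the Rees ring. -/
def t : rees k L :=
  ⟨Polynomial.X, fun n => by
    rw [Polynomial.coeff_X]
    split_ifs
    · exact one_mem_filtration k L n
    · exact Submodule.zero_mem _⟩

theorem t_central (p : rees k L) : t k L * p = p * t k L :=
  Subtype.ext Polynomial.X_mul

theorem commute_of_mem_filtration_zero {a : U} (ha : a ∈ filtration k L 0) (b : U) :
    a * b = b * a := by
  rw [filtration, pow_zero, Submodule.mem_one] at ha
  obtain ⟨r, rfl⟩ := ha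
  exact Algebra.commutes r b

theorem commutator_mem_filtration_one {a b : U} (ha : a ∈ filtrationOne k L)
    (hb : b ∈ filtrationOne k L) : a * b - b * a ∈ filtrationOne k L := by
  obtain ⟨c, hc, _, ⟨x, rfl⟩, rfl⟩ := Submodule.mem_sup.1 ha
  obtain ⟨d, hd, _, ⟨y, rfl⟩, rfl⟩ := Submodule.mem_sup.1 hb
  obtain ⟨c, rfl⟩ := Submodule.mem_one.1 hc
  obtain ⟨d, rfl⟩ := Submodule.mem_one.1 hd
  have h := ι_mem_filtrationOne k L ⁅x, y⁆
  rw [LieHom.map_lie, LieRing.of_associative_ring_bracket] at h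
  have e : ∀ X Y : U, (algebraMap k (U) c + X) * (algebraMap k (U) d + Y) -
      (algebraMap k (U) d + Y) * (algebraMap k (U) c + X) = X * Y - Y * X := by
    intro X Y
    rw [add_mul, Algebra.commutes c, mul_add X, ← Algebra.commutes d X, mul_add _ _ X, add_mul _ Y X]
    abel
  rw [← e] at h
  exact h

theorem commutator_mem_filtration_aux {a : U} (ha : a ∈ filtrationOne k L) (n : ℕ) :
    ∀ b ∈ filtration k L n, a * b - b * a ∈ filtration k L n := by
  induction n with
  | zero =>
    intro b hb
    rw [commute_of_mem_filtration_zero k L hb, sub_self]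
    exact Submodule.zero_mem _
  | succ n ih =>
    intro b hb
    rw [filtration, pow_succ] at hb ⊢
    induction hb using Submodule.mul_induction_on' with
    | mem_mul_mem b₁ h₁ b₂ h₂ =>
      have e : a * (b₁ * b₂) - b₁ * b₂ * a = (a * b₁ - b₁ * a) * b₂ + b₁ * (a * b₂ - b₂ * a) := by
        noncomm_ring
      rw [e]
      exact Submodule.add_mem _ (Submodule.mul_mem_mul (ih _ h₁) h₂)
        (Submodule.mul_mem_mul h₁ (commutator_mem_filtration_one k L ha h₂))
    | add b₁ _ b₂ _ h₁ h₂ =>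
      have e : a * (b₁ + b₂) - (b₁ + b₂) * a = (a * b₁ - b₁ * a) + (a * b₂ - b₂ * a) := by
        noncomm_ring
      rw [e]
      exact Submodule.add_mem _ h₁ h₂

theorem commutator_mem_filtration (m n : ℕ) {b : U} (hb : b ∈ filtration k L (n + 1)) :
    ∀ a ∈ filtration k L m, a * b - b * a ∈ filtration k L (m + n) := by
  induction m with
  | zero =>
    intro a ha
    rw [commute_of_mem_filtration_zero k L ha, sub_self]
    exact Submodule.zero_mem _
  | succ m ih =>
    intro a ha
    rw [filtration, pow_succ] at ha
    induction ha using Submodule.mul_induction_on' with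
    | mem_mul_mem a₁ h₁ a₂ h₂ =>
      have e : a₁ * a₂ * b - b * (a₁ * a₂) = a₁ * (a₂ * b - b * a₂) + (a₁ * b - b * a₁) * a₂ := by
        noncomm_ring
      rw [e]
      refine Submodule.add_mem _ ?_ ?_
      · have := mul_mem_filtration k L h₁ (commutator_mem_filtration_aux k L h₂ (n + 1) b hb)
        rwa [show m + (n + 1) = m + 1 + n by omega] at this
      · have h₂' : a₂ ∈ filtration k L 1 := by rwa [filtration, pow_one]
        have := mul_mem_filtration k L (ih _ h₁) h₂'
        rwa [show m + n + 1 = m + 1 + n by omega] at this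
    | add a₁ _ a₂ _ h₁ h₂ =>
      have e : (a₁ + a₂) * b - b * (a₁ + a₂) = (a₁ * b - b * a₁) + (a₂ * b - b * a₂) := by
        noncomm_ring
      rw [e]
      exact Submodule.add_mem _ h₁ h₂

theorem rees_commutator (p q : rees k L) : ∃ r : rees k L, p * q - q * p = t k L * r := by
  obtain ⟨p, hp⟩ := p
  obtain ⟨q, hq⟩ := q
  refine ⟨⟨(p * q - q * p).divX, fun n => ?_⟩, Subtype.ext ?_⟩
  · rw [Polynomial.coeff_divX, Polynomial.coeff_sub, Polynomial.coeff_mul, Polynomial.coeff_mul,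
      ← Finset.Nat.sum_antidiagonal_swap (f := fun x => q.coeff x.1 * p.coeff x.2),
      ← Finset.sum_sub_distrib]
    refine Submodule.sum_mem _ fun x hx => ?_
    have hx' := Finset.HasAntidiagonal.mem_antidiagonal.1 hx
    obtain ⟨i, j⟩ := x
    dsimp only [Prod.swap] at hx' ⊢
    cases j with
    | zero =>
      rw [commute_of_mem_filtration_zero k L (hq 0), sub_self]
      exact Submodule.zero_mem _
    | succ j =>
      have := commutator_mem_filtration k L i j (hq (j + 1)) _ (hp i)
      rwa [show i + j = n by omega] at this
  · change p * q - q * p = Polynomial.X * (p * q - q * p).divX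
    have h := Polynomial.divX_mul_X_add (p * q - q * p)
    rw [Polynomial.coeff_sub, Polynomial.mul_coeff_zero, Polynomial.mul_coeff_zero,
      commute_of_mem_filtration_zero k L (hp 0), sub_self, Polynomial.C_0, add_zero] at h
    rw [Polynomial.X_mul, h]

/-! ### The inverse limit of the localizations of the truncated Rees rings -/

/-- The ideal of the Rees ring generated by `tⁿ`. -/
def tIdeal (n : ℕ) : Ideal (rees k L) := Ideal.span {t k L ^ n}

instance (n : ℕ) : (tIdeal k L n).IsTwoSided where
  mul_mem_of_left := by
    intro a b ha
    rw [tIdeal, Ideal.mem_span_singleton'] at ha ⊢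
    obtain ⟨c, rfl⟩ := ha
    refine ⟨c * b, ?_⟩
    rw [mul_assoc, mul_assoc, ((show Commute (t k L) b from t_central k L b).pow_left n).eq]

/-- The quotient of the Rees ring by `tⁿ`. For `n = 1` this is the associated graded ring. -/
def Trunc (n : ℕ) : Type _ := rees k L ⧸ tIdeal k L n

instance (n : ℕ) : Ring (Trunc k L n) := inferInstanceAs (Ring (rees k L ⧸ tIdeal k L n))

instance (n : ℕ) : Algebra k (Trunc k L n) :=
  inferInstanceAs (Algebra k (rees k L ⧸ tIdeal k L n))

/-- The quotient map. -/
def toTrunc (n : ℕ) : rees k L →ₐ[k] Trunc k L n := Ideal.Quotient.mkₐ k (tIdeal k L n)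

theorem toTrunc_surjective (n : ℕ) : Function.Surjective (toTrunc k L n) :=
  Ideal.Quotient.mk_surjective

theorem toTrunc_t_pow (n : ℕ) : toTrunc k L n (t k L) ^ n = 0 := by
  rw [← map_pow]
  exact Ideal.Quotient.eq_zero_iff_mem.2 (Ideal.mem_span_singleton_self _)

/-- The multiplicative set of the elements of the Rees ring outside of the ideal `(t)`, that is,
of those with nonzero image in the associated graded ring. (The associated graded ring is a
polynomial ring over `k`, hence a domain, so that the elements outside `(t)` are multiplicatively
closed already.) -/
def denominators : Submonoid (rees k L) :=
  Submonoid.closure {p | p ∉ tIdeal k L 1}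

/-- The image of the multiplicative set in the quotient by `tⁿ`. -/
def truncDenominators (n : ℕ) : Submonoid (Trunc k L n) :=
  (denominators k L).map (toTrunc k L n)

theorem nonempty_oreSet_truncDenominators (n : ℕ) :
    Nonempty (OreLocalization.OreSet (truncDenominators k L n)) := by
  refine nonempty_oreSet_of_nilpotent _ (toTrunc k L n (t k L)) n ?_ (toTrunc_t_pow k L n) ?_
  · intro a
    obtain ⟨a, rfl⟩ := toTrunc_surjective k L n a
    rw [← map_mul, ← map_mul, t_central]
  · intro a b
    obtain ⟨a, rfl⟩ := toTrunc_surjective k L n a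
    obtain ⟨b, rfl⟩ := toTrunc_surjective k L n b
    obtain ⟨r, hr⟩ := rees_commutator k L a b
    exact ⟨toTrunc k L n r, by rw [← map_mul, ← map_mul, ← map_mul, ← map_sub, hr]⟩

instance (n : ℕ) : OreLocalization.OreSet (truncDenominators k L n) :=
  (nonempty_oreSet_truncDenominators k L n).some

/-- The Ore localization of the quotient of the Rees ring by `tⁿ`. -/
def LocTrunc (n : ℕ) : Type _ := OreLocalization (truncDenominators k L n) (Trunc k L n)

instance (n : ℕ) : Ring (LocTrunc k L n) :=
  inferInstanceAs (Ring (OreLocalization (truncDenominators k L n) (Trunc k L n)))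

instance (n : ℕ) : Algebra k (LocTrunc k L n) :=
  inferInstanceAs (Algebra k (OreLocalization (truncDenominators k L n) (Trunc k L n)))

/-- The canonical map to the localization. -/
def toLoc (n : ℕ) : Trunc k L n →ₐ[k] LocTrunc k L n where
  __ := (OreLocalization.numeratorRingHom :
    Trunc k L n →+* OreLocalization (truncDenominators k L n) (Trunc k L n))
  commutes' _ := rfl

theorem tIdeal_succ_le (n : ℕ) : tIdeal k L (n + 1) ≤ tIdeal k L n := by
  rw [tIdeal, Ideal.span_singleton_le_iff_mem, pow_succ']
  exact Ideal.mul_mem_left _ _ (Ideal.mem_span_singleton_self _)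

/-- The canonical map from the quotient by `tⁿ⁺¹` to the quotient by `tⁿ`. -/
def truncMap (n : ℕ) : Trunc k L (n + 1) →ₐ[k] Trunc k L n :=
  Ideal.Quotient.factorₐ k (tIdeal_succ_le k L n)

theorem truncMap_toTrunc (n : ℕ) (p : rees k L) :
    truncMap k L n (toTrunc k L (n + 1) p) = toTrunc k L n p := rfl

theorem isUnit_toLoc (n : ℕ) (s : truncDenominators k L n) : IsUnit (toLoc k L n s) :=
  OreLocalization.numerator_isUnit s

theorem isUnit_toLoc_truncMap (n : ℕ) (s : truncDenominators k L (n + 1)) :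
    IsUnit (((toLoc k L n).comp (truncMap k L n) : Trunc k L (n + 1) →* LocTrunc k L n) s) := by
  obtain ⟨_, p, hp, rfl⟩ := s
  exact isUnit_toLoc k L n ⟨toTrunc k L n p, p, hp, rfl⟩

/-- The transition map between the localized quotients. -/
def transition (n : ℕ) : LocTrunc k L (n + 1) →+* LocTrunc k L n :=
  OreLocalization.universalHom ((toLoc k L n).comp (truncMap k L n)).toRingHom
    (IsUnit.liftRight (((toLoc k L n).comp (truncMap k L n) :
        Trunc k L (n + 1) →* LocTrunc k L n).comp (truncDenominators k L (n + 1)).subtype)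
      (isUnit_toLoc_truncMap k L n))
    (fun _ => rfl)

theorem transition_toLoc (n : ℕ) (a : Trunc k L (n + 1)) :
    transition k L n (toLoc k L (n + 1) a) = toLoc k L n (truncMap k L n a) :=
  OreLocalization.universalHom_commutes _ _ _

/-- The inverse limit of the localized quotients of the Rees ring, as a subalgebra of their
product. -/
def completion : Subalgebra k (∀ n, LocTrunc k L n) where
  carrier := {x | ∀ n, transition k L n (x (n + 1)) = x n}
  mul_mem' := by
    intro x y hx hy n
    rw [Pi.mul_apply, map_mul, hx n, hy n, Pi.mul_apply]
  add_mem' := by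
    intro x y hx hy n
    rw [Pi.add_apply, map_add, hx n, hy n, Pi.add_apply]
  algebraMap_mem' := by
    intro r n
    have h := transition_toLoc k L n (algebraMap k _ r)
    rw [AlgHom.commutes, AlgHom.commutes, AlgHom.commutes] at h
    exact h

/-- The canonical map from the Rees ring to the inverse limit. -/
def toCompletion : rees k L →ₐ[k] completion k L :=
  AlgHom.codRestrict (AlgHom.pi fun n => (toLoc k L n).comp (toTrunc k L n)) (completion k L)
    (fun p n => transition_toLoc k L n (toTrunc k L (n + 1) p))

theorem toLoc_t_central (n : ℕ) (x : LocTrunc k L n) :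
    toLoc k L n (toTrunc k L n (t k L)) * x = x * toLoc k L n (toTrunc k L n (t k L)) := by
  have hc : ∀ a : Trunc k L n, Commute (toLoc k L n (toTrunc k L n (t k L))) (toLoc k L n a) := by
    intro a
    obtain ⟨a, rfl⟩ := toTrunc_surjective k L n a
    change _ * _ = _ * _
    rw [← map_mul, ← map_mul, ← map_mul, ← map_mul, t_central]
  obtain ⟨r, s, hx⟩ : ∃ (r : Trunc k L n) (s : truncDenominators k L n),
      toLoc k L n s * x = toLoc k L n r := by
    induction x using OreLocalization.ind with
    | _ r s => exact ⟨r, s, OreLocalization.mul_cancel⟩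
  obtain ⟨u, hu⟩ := isUnit_toLoc k L n s
  rw [← hu] at hx
  have hx' : x = ↑u⁻¹ * toLoc k L n r := by rw [← hx, Units.inv_mul_cancel_left]
  have h1 : Commute (toLoc k L n (toTrunc k L n (t k L))) (↑u⁻¹ : LocTrunc k L n) :=
    Commute.units_inv_right (by rw [hu]; exact hc _)
  rw [hx']
  exact (h1.mul_right (hc r)).eq

theorem toCompletion_t_central (x : completion k L) :
    toCompletion k L (t k L) * x = x * toCompletion k L (t k L) :=
  Subtype.ext (funext fun n => toLoc_t_central k L n (x.1 n))

/-! ### Cohn's division ring and the division subring generated by the enveloping algebra -/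

/-- The powers of `t` in the inverse limit. -/
def tPowers : Submonoid (completion k L) := Submonoid.powers (toCompletion k L (t k L))

theorem nonempty_oreSet_tPowers : Nonempty (OreLocalization.OreSet (tPowers k L)) := by
  refine nonempty_oreSet_of_central _ ?_
  rintro _ ⟨n, rfl⟩ a
  exact ((show Commute _ a from toCompletion_t_central k L a).pow_left n).eq

instance : OreLocalization.OreSet (tPowers k L) := (nonempty_oreSet_tPowers k L).some

/-- Cohn's division ring `𝔇_L`: the localization at `t` of the inverse limit over `n` of the Ore
localizations of the quotients of the Rees ring by `tⁿ`, at the elements outside `(t)`. -/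
def DivRing : Type _ := OreLocalization (tPowers k L) (completion k L)

instance : Ring (DivRing k L) :=
  inferInstanceAs (Ring (OreLocalization (tPowers k L) (completion k L)))

instance : Algebra k (DivRing k L) :=
  inferInstanceAs (Algebra k (OreLocalization (tPowers k L) (completion k L)))

/-- The canonical map from the inverse limit to `DivRing`. -/
def completionToDivRing : completion k L →ₐ[k] DivRing k L where
  __ := (OreLocalization.numeratorRingHom :
    completion k L →+* OreLocalization (tPowers k L) (completion k L))
  commutes' _ := rfl

/-- The canonical map from the Rees ring to `DivRing`. -/
def reesToDivRing : rees k L →ₐ[k] DivRing k L :=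
  (completionToDivRing k L).comp (toCompletion k L)

/-- The inverse of `t` in `DivRing`. -/
def tInv : DivRing k L :=
  ((OreLocalization.numeratorUnit
    (⟨toCompletion k L (t k L), Submonoid.mem_powers _⟩ : tPowers k L))⁻¹ :
      (OreLocalization (tPowers k L) (completion k L))ˣ).val

theorem tInv_mul : tInv k L * reesToDivRing k L (t k L) = 1 :=
  Units.inv_mul (OreLocalization.numeratorUnit
    (⟨toCompletion k L (t k L), Submonoid.mem_powers _⟩ : tPowers k L))

theorem mul_tInv : reesToDivRing k L (t k L) * tInv k L = 1 :=
  Units.mul_inv (OreLocalization.numeratorUnit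
    (⟨toCompletion k L (t k L), Submonoid.mem_powers _⟩ : tPowers k L))

/-- The element `x t` of the Rees ring, for `x` in the Lie algebra. -/
def symbol : L →ₗ[k] rees k L where
  toFun x := ⟨Polynomial.monomial 1 (UniversalEnvelopingAlgebra.ι k x), fun n => by
    rw [Polynomial.coeff_monomial]
    split_ifs with h
    · subst h
      rw [filtration, pow_one]
      exact ι_mem_filtrationOne k L x
    · exact Submodule.zero_mem _⟩
  map_add' x y := Subtype.ext (by
    change Polynomial.monomial 1 _ = Polynomial.monomial 1 _ + Polynomial.monomial 1 _
    rw [map_add, map_add])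
  map_smul' r x := Subtype.ext (by
    change Polynomial.monomial 1 _ = r • Polynomial.monomial 1 _
    rw [map_smul, Polynomial.smul_monomial])

theorem symbol_lie (x y : L) :
    symbol k L x * symbol k L y - symbol k L y * symbol k L x = t k L * symbol k L ⁅x, y⁆ := by
  refine Subtype.ext ?_
  change Polynomial.monomial 1 _ * Polynomial.monomial 1 _ -
    Polynomial.monomial 1 _ * Polynomial.monomial 1 _ = Polynomial.X * Polynomial.monomial 1 _
  rw [Polynomial.X_mul, Polynomial.monomial_mul_X, Polynomial.monomial_mul_monomial,
    Polynomial.monomial_mul_monomial, ← map_sub, LieHom.map_lie,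
    LieRing.of_associative_ring_bracket]

/-- The map from the Lie algebra to `DivRing` that sends `x` to the fraction `t⁻¹ (x t)`. -/
def lieMap : L →ₗ⁅k⁆ DivRing k L where
  toLinearMap := (LinearMap.mulLeft k (tInv k L)).comp
    ((reesToDivRing k L).toLinearMap.comp (symbol k L))
  map_lie' := by
    intro x y
    change tInv k L * reesToDivRing k L (symbol k L ⁅x, y⁆) =
      tInv k L * reesToDivRing k L (symbol k L x) * (tInv k L * reesToDivRing k L (symbol k L y)) -
      tInv k L * reesToDivRing k L (symbol k L y) * (tInv k L * reesToDivRing k L (symbol k L x))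
    have h := congrArg (reesToDivRing k L) (symbol_lie k L x y)
    rw [map_sub, map_mul, map_mul, map_mul] at h
    have hc : ∀ p : rees k L,
        reesToDivRing k L p * tInv k L = tInv k L * reesToDivRing k L p := by
      intro p
      have hp := congrArg (reesToDivRing k L) (t_central k L p)
      rw [map_mul, map_mul] at hp
      calc reesToDivRing k L p * tInv k L
          = tInv k L * (reesToDivRing k L (t k L) * reesToDivRing k L p) * tInv k L := by
            rw [← mul_assoc, tInv_mul, one_mul]
        _ = tInv k L * reesToDivRing k L p * (reesToDivRing k L (t k L) * tInv k L) := by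
            rw [hp]; simp only [mul_assoc]
        _ = _ := by rw [mul_tInv, mul_one]
    have e : ∀ p q : rees k L,
        tInv k L * reesToDivRing k L p * (tInv k L * reesToDivRing k L q) =
          tInv k L * (tInv k L * (reesToDivRing k L p * reesToDivRing k L q)) := by
      intro p q
      rw [mul_assoc (tInv k L), ← mul_assoc (reesToDivRing k L p), hc, mul_assoc (tInv k L)]
    rw [e, e, ← mul_sub, ← mul_sub, h, ← mul_assoc (tInv k L) (reesToDivRing k L (t k L)),
      tInv_mul, one_mul]

/-- The embedding of the enveloping algebra in Cohn's division ring. It extends the map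
`x ↦ t⁻¹ (x t)` on the Lie algebra. -/
def embedding : UniversalEnvelopingAlgebra k L →ₐ[k] DivRing k L :=
  UniversalEnvelopingAlgebra.lift k (lieMap k L)

/-- The division ring `𝔇(L)`: the division subring of Cohn's division ring `𝔇_L` that is generated
by the enveloping algebra. -/
def divSubring : Subalgebra k (DivRing k L) :=
  divisionClosure k (Set.range (embedding k L))

end

end Cohn

/-!
The algebra `U(L)` acts on the polynomial ring in a basis of `L`, as in the proof of the
Poincaré–Birkhoff–Witt theorem. Weights of the basis elements which the bracket does not increase
therefore give a filtration of `U(L)` by the integers, which extends to Cohn's division ring. If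
`⁅x, y⁆ = y`, give all weights the value zero and put `a = x`, `p = y`, `z = 1`; if `x`, `y` and
`z = ⁅y, x⁆` are linearly independent, give `x` and `y` the weight one, all other basis elements
the weight two, and put `a = yx / 2`, `p = x²`. One of the two cases occurs in every nonabelian Lie
algebra. In both, the images `s` and `P` of `a z⁻¹` and `p z⁻¹` in the ring of elements of weight at
most zero modulo those of negative weight satisfy `s P - P s = P`, and the nonzero polynomials in
`s` and in `P` are invertible. It is therefore enough to find a free group algebra in this quotient.

Put `u = s / (s - 1/2)` and `κ = (1 + P) / (1 - P)`; then `u` and `κ u κ⁻¹` generate a free group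
algebra. Left multiplication by `P` is semilinear over `k(s)` for the shift `σ` of `s`, and it maps
a word in `u` and `κ` that begins with `κ^{±1}` to its negative or to itself, modulo shorter words
for the powers of `u`. A shortest linear relation between such eigenvectors has constant
coefficients, and leads to an equation `g + σ(g) = ∑ cᵢ (s / (s - 1/2))ⁱ` with a rational function
`g`, which is impossible by comparing the poles of both sides along the orbits of the shift.
-/

noncomputable section

namespace PBW

open MvPolynomial

section WeightFiltration

variable {ι k M : Type*} [CommRing k] [AddCommMonoid M] [PartialOrder M]

/-- The polynomials all of whose monomials have weight at most `p`, where the variable `X i` has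
weight `w i`. -/
def weightLE (k : Type*) [CommRing k] (w : ι → M) (p : M) : Submodule k (MvPolynomial ι k) :=
  restrictSupport k {m | Finsupp.weight w m ≤ p}

/-- The polynomials of total degree at most `d`. -/
abbrev degreeLE (ι k : Type*) [CommRing k] (d : ℕ) : Submodule k (MvPolynomial ι k) :=
  weightLE k (fun _ : ι => 1) d

theorem mem_weightLE {w : ι → M} {p : M} {f : MvPolynomial ι k} :
    f ∈ weightLE k w p ↔ ∀ m ∈ f.support, Finsupp.weight w m ≤ p :=
  mem_restrictSupport_iff k

theorem mem_degreeLE {d : ℕ} {f : MvPolynomial ι k} :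
    f ∈ degreeLE ι k d ↔ ∀ m ∈ f.support, m.degree ≤ d := by
  rw [mem_weightLE, ← Finsupp.degree_eq_weight_one]

theorem weightLE_mono (w : ι → M) {p q : M} (h : p ≤ q) : weightLE k w p ≤ weightLE k w q :=
  restrictSupport_mono k fun _ hm => le_trans hm h

theorem monomial_mem_weightLE (w : ι → M) (m : ι →₀ ℕ) (r : k) :
    monomial m r ∈ weightLE k w (Finsupp.weight w m) :=
  (monomial_mem_restrictSupport k).2 (Or.inl le_rfl)

theorem monomial_mem_degreeLE (m : ι →₀ ℕ) (r : k) : monomial m r ∈ degreeLE ι k m.degree := by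
  rw [Finsupp.degree_eq_weight_one]
  exact monomial_mem_weightLE _ m r

theorem one_mem_weightLE (w : ι → M) : (1 : MvPolynomial ι k) ∈ weightLE k w 0 := by
  simpa only [map_zero, monomial_zero', C_1] using monomial_mem_weightLE w 0 (1 : k)

theorem X_mem_weightLE (w : ι → M) (i : ι) : (X i : MvPolynomial ι k) ∈ weightLE k w (w i) := by
  simpa only [Finsupp.weight_single, one_smul, X] using
    monomial_mem_weightLE w (Finsupp.single i 1) (1 : k)

theorem weightLE_le_of_monomial_mem {w : ι → M} {p : M} {N : Submodule k (MvPolynomial ι k)}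
    (h : ∀ m : ι →₀ ℕ, Finsupp.weight w m ≤ p → monomial m 1 ∈ N) : weightLE k w p ≤ N := by
  rw [weightLE, restrictSupport_eq_span, Submodule.span_le]
  rintro _ ⟨m, hm, rfl⟩
  exact h m hm

theorem degreeLE_le_of_monomial_mem {d : ℕ} {N : Submodule k (MvPolynomial ι k)}
    (h : ∀ m : ι →₀ ℕ, m.degree ≤ d → monomial m 1 ∈ N) : degreeLE ι k d ≤ N :=
  weightLE_le_of_monomial_mem fun m hm => h m (by rwa [Finsupp.degree_eq_weight_one])

theorem mul_mem_weightLE [IsOrderedAddMonoid M] {w : ι → M} {p q : M} {f g : MvPolynomial ι k}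
    (hf : f ∈ weightLE k w p) (hg : g ∈ weightLE k w q) : f * g ∈ weightLE k w (p + q) := by
  have h := Submodule.mul_mem_mul hf hg
  rw [weightLE, weightLE, ← restrictSupport_add] at h
  refine restrictSupport_mono k ?_ h
  rintro _ ⟨m, hm, n, hn, rfl⟩
  exact (map_add (Finsupp.weight w) m n).trans_le (add_le_add hm hn)

theorem X_mul_mem_weightLE [IsOrderedAddMonoid M] {w : ι → M} (i : ι) {p : M}
    {f : MvPolynomial ι k} (hf : f ∈ weightLE k w p) : X i * f ∈ weightLE k w (p + w i) :=
  add_comm (w i) p ▸ mul_mem_weightLE (X_mem_weightLE w i) hf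

theorem X_mul_monomial (i : ι) (m : ι →₀ ℕ) :
    X i * monomial m (1 : k) = monomial (m + Finsupp.single i 1) 1 := by
  rw [X, monomial_mul, one_mul, add_comm]

theorem homogeneousComponent_mem_weightLE {w : ι → M} {p : M} {f : MvPolynomial ι k}
    (hf : f ∈ weightLE k w p) (n : ℕ) : homogeneousComponent n f ∈ weightLE k w p := by
  classical
  rw [mem_weightLE] at hf ⊢
  intro m hm
  rw [mem_support_iff, coeff_homogeneousComponent, ne_eq, ite_eq_right_iff, Classical.not_imp]
    at hm
  exact hf m (mem_support_iff.2 hm.2)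

theorem homogeneousComponent_eq_zero_of_mem_degreeLE {d n : ℕ} {f : MvPolynomial ι k}
    (hf : f ∈ degreeLE ι k d) (h : d < n) : homogeneousComponent n f = 0 :=
  homogeneousComponent_eq_zero' n f fun m hm => ((mem_degreeLE.1 hf m hm).trans_lt h).ne

theorem homogeneousComponent_succ_X_mul (i : ι) (n : ℕ) (f : MvPolynomial ι k) :
    homogeneousComponent (n + 1) (X i * f) = X i * homogeneousComponent n f := by
  induction f using MvPolynomial.induction_on' with
  | add f g hf hg => rw [mul_add, map_add, hf, hg, map_add, mul_add]
  | monomial m r =>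
    have hm := isHomogeneous_monomial (σ := ι) r (rfl : m.degree = m.degree)
    rw [homogeneousComponent_of_mem (add_comm 1 m.degree ▸ (isHomogeneous_X k i).mul hm),
      homogeneousComponent_of_mem hm, mul_ite, mul_zero]
    simp only [Nat.add_right_cancel_iff]

end WeightFiltration

section LowerBounds

variable {ι : Type*} [LinearOrder ι] {i j : ι} {m : ι →₀ ℕ}

theorem mem_lowerBounds_support_add_single (hj : j ∈ lowerBounds (m.support : Set ι))
    (hji : j ≤ i) : j ∈ lowerBounds ((m + Finsupp.single i 1).support : Set ι) := by
  intro l hl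
  rcases Finset.mem_union.1 (Finsupp.support_add hl) with hl | hl
  · exact hj hl
  · rwa [Finset.mem_singleton.1 (Finsupp.support_single_subset hl)]

theorem exists_eq_add_single (h : i ∉ lowerBounds (m.support : Set ι)) :
    ∃ j < i, ∃ T : ι →₀ ℕ, m = T + Finsupp.single j 1 ∧ j ∈ lowerBounds (T.support : Set ι) := by
  obtain ⟨l, hl, hli⟩ : ∃ l ∈ m.support, l < i := by
    simpa only [mem_lowerBounds, Finset.mem_coe, not_forall, not_le, exists_prop] using h
  have hmin := m.support.min'_mem ⟨l, hl⟩
  refine ⟨m.support.min' ⟨l, hl⟩, (Finset.min'_le _ _ hl).trans_lt hli,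
    m - Finsupp.single (m.support.min' ⟨l, hl⟩) 1, ?_, fun l' hl' =>
      Finset.min'_le _ _ (Finsupp.support_tsub hl')⟩
  rw [tsub_add_cancel_of_le]
  exact Finsupp.single_le_iff.2 (Nat.one_le_iff_ne_zero.2 (Finsupp.mem_support_iff.1 hmin))

end LowerBounds

section Extension

variable {ι k L : Type*} [CommRing k] [LieRing L] [LieAlgebra k L] (b : Module.Basis ι k L)

/-- The bilinear map `L × k[ι] → k[ι]` with prescribed values on basis elements and monomials. -/
def extend (F : ι → (ι →₀ ℕ) → MvPolynomial ι k) : L →ₗ[k] Module.End k (MvPolynomial ι k) :=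
  b.constr k fun i => (basisMonomials ι k).constr k (F i)

theorem extend_apply (F : ι → (ι →₀ ℕ) → MvPolynomial ι k) (i : ι) (m : ι →₀ ℕ) :
    extend b F (b i) (monomial m 1) = F i m := by
  rw [extend, Module.Basis.constr_basis]
  exact (basisMonomials ι k).constr_basis k (F i) m

variable {b} {A A' : L →ₗ[k] Module.End k (MvPolynomial ι k)} {d : ℕ}

theorem apply_sub_X_mul_mem_degreeLE
    (h : ∀ (m : ι →₀ ℕ) (i : ι), m.degree ≤ d →
      A (b i) (monomial m 1) - X i * monomial m 1 ∈ degreeLE ι k m.degree)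
    (i : ι) {f : MvPolynomial ι k} (hf : f ∈ degreeLE ι k d) :
    A (b i) f - X i * f ∈ degreeLE ι k d := by
  have : degreeLE ι k d ≤ (degreeLE ι k d).comap (A (b i) - LinearMap.mulLeft k (X i)) :=
    degreeLE_le_of_monomial_mem fun m hm => weightLE_mono _ hm (h m i hm)
  exact this hf

theorem apply_mem_degreeLE_succ
    (h : ∀ (m : ι →₀ ℕ) (i : ι), m.degree ≤ d →
      A (b i) (monomial m 1) - X i * monomial m 1 ∈ degreeLE ι k m.degree)
    (x : L) {f : MvPolynomial ι k} (hf : f ∈ degreeLE ι k d) : A x f ∈ degreeLE ι k (d + 1) := by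
  suffices ⊤ ≤ (degreeLE ι k (d + 1)).comap (A.flip f) from this (x := x) trivial
  rw [← b.span_eq, Submodule.span_le]
  rintro _ ⟨i, rfl⟩
  have hi := weightLE_mono _ (Nat.le_succ d) (apply_sub_X_mul_mem_degreeLE h i hf)
  exact (Submodule.sub_mem_iff_left _ (X_mul_mem_weightLE i hf)).1 hi

theorem apply_eq_of_monomial_eq
    (h : ∀ (m : ι →₀ ℕ) (i : ι), m.degree ≤ d → A (b i) (monomial m 1) = A' (b i) (monomial m 1))
    (x : L) {f : MvPolynomial ι k} (hf : f ∈ degreeLE ι k d) : A x f = A' x f := by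
  suffices A.flip f = A'.flip f from DFunLike.congr_fun this x
  exact b.ext fun i => degreeLE_le_of_monomial_mem (N := LinearMap.eqLocus (A (b i)) (A' (b i)))
    (fun m hm => h m i hm) hf

end Extension

section Action

variable {ι k L : Type*} [LinearOrder ι] [CommRing k] [LieRing L] [LieAlgebra k L]
  (b : Module.Basis ι k L)

open Classical in
/-- The value that a representation `A` extending multiplication of `b i` into ordered monomials
must have at `b i` and `m`, expressed by the values of `A` in smaller degree: if `j < i` is the
least index in `m`, then `b i` has to be commuted past `b j`. -/
def value (A : L →ₗ[k] Module.End k (MvPolynomial ι k)) (i : ι) (m : ι →₀ ℕ) :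
    MvPolynomial ι k :=
  if h : i ∈ lowerBounds (m.support : Set ι) then X i * monomial m 1
  else
    let j := (exists_eq_add_single h).choose
    let T := monomial (m - Finsupp.single j 1) (1 : k)
    X i * monomial m 1 + A (b j) (A (b i) T - X i * T) + A ⁅b i, b j⁆ T

variable {i j : ι} {m : ι →₀ ℕ}

theorem value_of_mem_lowerBounds (A : L →ₗ[k] Module.End k (MvPolynomial ι k))
    (h : i ∈ lowerBounds (m.support : Set ι)) : value b A i m = X i * monomial m 1 :=
  dif_pos h

theorem value_add_single (A : L →ₗ[k] Module.End k (MvPolynomial ι k)) (hji : j < i)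
    (h : j ∈ lowerBounds (m.support : Set ι)) :
    value b A i (m + Finsupp.single j 1) = X i * monomial (m + Finsupp.single j 1) 1 +
      A (b j) (A (b i) (monomial m 1) - X i * monomial m 1) + A ⁅b i, b j⁆ (monomial m 1) := by
  have mem_support (T : ι →₀ ℕ) (l : ι) : l ∈ (T + Finsupp.single l 1).support := by simp
  have hi : i ∉ lowerBounds ((m + Finsupp.single j 1).support : Set ι) :=
    fun hi => (hi (mem_support m j)).not_gt hji
  obtain ⟨-, T, hT, hlT⟩ := (exists_eq_add_single hi).choose_spec
  have hmin := mem_lowerBounds_support_add_single hlT le_rfl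
  have hmem := mem_support T (exists_eq_add_single hi).choose
  rw [← hT] at hmin hmem
  have hj : (exists_eq_add_single hi).choose = j :=
    le_antisymm (hmin (mem_support m j)) (mem_lowerBounds_support_add_single h le_rfl hmem)
  rw [value, dif_neg hi]
  simp only [hj, add_tsub_cancel_right]

/-- The iterates of `value`, starting from zero; the `n`-th one is the action in degrees less than
`n`. -/
def iter : ℕ → L →ₗ[k] Module.End k (MvPolynomial ι k)
  | 0 => 0
  | n + 1 => extend b (value b (iter n))

theorem iter_succ_apply (n : ℕ) (i : ι) (m : ι →₀ ℕ) :
    iter b (n + 1) (b i) (monomial m 1) = value b (iter b n) i m :=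
  extend_apply b _ i m

theorem iter_spec (n : ℕ) : ∀ (m : ι →₀ ℕ) (i : ι), m.degree < n →
    iter b n (b i) (monomial m 1) - X i * monomial m 1 ∈ degreeLE ι k m.degree ∧
      iter b (n + 1) (b i) (monomial m 1) = iter b n (b i) (monomial m 1) := by
  induction n with
  | zero => exact fun m i h => absurd h (Nat.not_lt_zero _)
  | succ n ih =>
    intro m i hm
    rw [iter_succ_apply, iter_succ_apply]
    by_cases h : i ∈ lowerBounds (m.support : Set ι)
    · rw [value_of_mem_lowerBounds b _ h, value_of_mem_lowerBounds b _ h, sub_self]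
      exact ⟨Submodule.zero_mem _, rfl⟩
    · obtain ⟨j, hji, T, rfl, hT⟩ := exists_eq_add_single h
      have hdeg : (T + Finsupp.single j 1).degree = T.degree + 1 := by simp
      have ih_mem (m : ι →₀ ℕ) (i : ι) (h : m.degree ≤ T.degree) :=
        (ih m i (by omega)).1
      have ih_eq (m : ι →₀ ℕ) (i : ι) (h : m.degree ≤ T.degree) :=
        (ih m i (by omega)).2
      have hTdeg := monomial_mem_degreeLE T (1 : k)
      have hsub := apply_sub_X_mul_mem_degreeLE ih_mem i hTdeg
      rw [value_add_single b _ hji hT, value_add_single b _ hji hT, hdeg]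
      constructor
      · rw [add_assoc, add_sub_cancel_left]
        exact Submodule.add_mem _ (apply_mem_degreeLE_succ ih_mem _ hsub)
          (apply_mem_degreeLE_succ ih_mem _ hTdeg)
      · rw [apply_eq_of_monomial_eq ih_eq (b i) hTdeg, apply_eq_of_monomial_eq ih_eq _ hTdeg,
          apply_eq_of_monomial_eq ih_eq (b j) hsub]

theorem iter_eq_of_le {n n' : ℕ} (h : n ≤ n') (i : ι) (hm : m.degree < n) :
    iter b n' (b i) (monomial m 1) = iter b n (b i) (monomial m 1) := by
  induction n', h using Nat.le_induction with
  | base => rfl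
  | succ n' h ih => rw [(iter_spec b n' m i (by omega)).2, ih]

/-- The action of `L` on the polynomial ring in a basis of `L` that underlies the
Poincaré–Birkhoff–Witt theorem. -/
def act : L →ₗ[k] Module.End k (MvPolynomial ι k) :=
  extend b fun i m => iter b (m.degree + 1) (b i) (monomial m 1)

theorem act_apply (i : ι) (m : ι →₀ ℕ) :
    act b (b i) (monomial m 1) = iter b (m.degree + 1) (b i) (monomial m 1) :=
  extend_apply b _ i m

theorem act_monomial_sub_mem (m : ι →₀ ℕ) (i : ι) :
    act b (b i) (monomial m 1) - X i * monomial m 1 ∈ degreeLE ι k m.degree := by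
  rw [act_apply]
  exact (iter_spec b _ m i (Nat.lt_succ_self _)).1

theorem act_sub_X_mul_mem (i : ι) {d : ℕ} {f : MvPolynomial ι k} (hf : f ∈ degreeLE ι k d) :
    act b (b i) f - X i * f ∈ degreeLE ι k d :=
  apply_sub_X_mul_mem_degreeLE (fun m i _ => act_monomial_sub_mem b m i) i hf

theorem act_mem_degreeLE (x : L) {d : ℕ} {f : MvPolynomial ι k} (hf : f ∈ degreeLE ι k d) :
    act b x f ∈ degreeLE ι k (d + 1) :=
  apply_mem_degreeLE_succ (fun m i _ => act_monomial_sub_mem b m i) x hf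

theorem act_of_mem_lowerBounds (h : i ∈ lowerBounds (m.support : Set ι)) :
    act b (b i) (monomial m 1) = X i * monomial m 1 := by
  rw [act_apply, iter_succ_apply, value_of_mem_lowerBounds b _ h]

theorem act_add_single (hji : j < i) (h : j ∈ lowerBounds (m.support : Set ι)) :
    act b (b i) (monomial (m + Finsupp.single j 1) 1) =
      X i * monomial (m + Finsupp.single j 1) 1 +
      act b (b j) (act b (b i) (monomial m 1) - X i * monomial m 1) +
      act b ⁅b i, b j⁆ (monomial m 1) := by
  have hdeg : (m + Finsupp.single j 1).degree = m.degree + 1 := by simp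
  have iter_eq_act (x : L) {f : MvPolynomial ι k} (hf : f ∈ degreeLE ι k m.degree) :
      iter b (m.degree + 1) x f = act b x f :=
    apply_eq_of_monomial_eq (b := b) (fun m' i' h' => by
      rw [act_apply, iter_eq_of_le b (by omega) i' (Nat.lt_succ_self _)]) x hf
  have hm := monomial_mem_degreeLE m (1 : k)
  rw [act_apply, iter_succ_apply, value_add_single b _ hji h, hdeg, iter_eq_act _ hm,
    iter_eq_act _ hm, iter_eq_act _ (act_sub_X_mul_mem b i hm)]

end Action

section Representation

variable {ι k L : Type*} [LinearOrder ι] [CommRing k] [LieRing L] [LieAlgebra k L]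
  (b : Module.Basis ι k L)

attribute [local instance] LieRing.ofAssociativeRing LieAlgebra.ofAssociativeAlgebra

/-- The failure of `act` to respect brackets, as a bilinear map on `L`. -/
def defect : L →ₗ[k] L →ₗ[k] Module.End k (MvPolynomial ι k) :=
  LinearMap.mk₂ k (fun x y => act b x * act b y - act b y * act b x - act b ⁅x, y⁆)
    (fun x x' y => by simp only [map_add, add_lie, add_mul, mul_add]; abel)
    (fun c x y => by simp only [map_smul, smul_lie, smul_mul_assoc, mul_smul_comm, smul_sub])
    (fun x y y' => by simp only [map_add, lie_add, add_mul, mul_add]; abel)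
    (fun c x y => by simp only [map_smul, lie_smul, smul_mul_assoc, mul_smul_comm, smul_sub])

theorem defect_apply (x y : L) (f : MvPolynomial ι k) :
    defect b x y f = act b x (act b y f) - act b y (act b x f) - act b ⁅x, y⁆ f := rfl

theorem defect_eq_zero_iff {x y : L} {f : MvPolynomial ι k} :
    defect b x y f = 0 ↔ act b x (act b y f) = act b y (act b x f) + act b ⁅x, y⁆ f := by
  rw [defect_apply, sub_sub, sub_eq_zero]

theorem defect_skew (x y : L) (f : MvPolynomial ι k) : defect b y x f = -defect b x y f := by
  rw [defect_apply, defect_apply, ← lie_skew x y, map_neg, LinearMap.neg_apply]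
  abel

theorem defect_self (x : L) (f : MvPolynomial ι k) : defect b x x f = 0 := by
  rw [defect_apply, lie_self, map_zero, LinearMap.zero_apply, sub_self, sub_zero]

variable {b}

theorem defect_eq_zero_of_basis {f : MvPolynomial ι k}
    (h : ∀ i j, j ≤ i → defect b (b i) (b j) f = 0) (x y : L) : defect b x y f = 0 := by
  suffices (defect b).compr₂ (LinearMap.applyₗ f) = 0 from LinearMap.congr_fun₂ this x y
  refine b.ext fun i => b.ext fun j => ?_
  rcases le_total j i with hji | hij
  · exact h i j hji
  · exact (defect_skew b (b j) (b i) f).trans (by rw [h j i hij, neg_zero]; rfl)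

theorem defect_monomial_of_mem_lowerBounds {i j : ι} {m : ι →₀ ℕ} (hji : j ≤ i)
    (h : j ∈ lowerBounds (m.support : Set ι)) : defect b (b i) (b j) (monomial m 1) = 0 := by
  rcases hji.eq_or_lt with rfl | hji
  · exact defect_self b _ _
  have hXj : act b (b j) (X i * monomial m 1) = X j * (X i * monomial m 1) := by
    rw [X_mul_monomial,
      act_of_mem_lowerBounds b (mem_lowerBounds_support_add_single h hji.le)]
  rw [defect_apply, act_of_mem_lowerBounds b h, X_mul_monomial, act_add_single b hji h, map_sub,
    hXj, ← X_mul_monomial]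
  ring

/-- The Jacobi identity lets the defect of `x` and `y` be moved past the action of `z`. -/
theorem defect_act {x y z : L} {f : MvPolynomial ι k} (h : ∀ x y, defect b x y f = 0)
    (hx : defect b x z (act b y f) = 0) (hy : defect b y z (act b x f) = 0) :
    defect b x y (act b z f) = 0 := by
  simp only [defect_eq_zero_iff] at *
  rw [h y z, h x z, map_add, map_add, hx, hy, h x ⁅y, z⁆, h y ⁅x, z⁆, h ⁅x, y⁆ z, h x y,
    lie_lie x y z, map_add]
  simp only [map_sub, LinearMap.sub_apply]
  abel

theorem defect_act_monomial {i j p : ι} {m : ι →₀ ℕ} (hpi : p < i) (hpj : p < j)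
    (hp : p ∈ lowerBounds (m.support : Set ι))
    (h : ∀ f ∈ degreeLE ι k m.degree, ∀ x y, defect b x y f = 0) :
    defect b (b i) (b p) (act b (b j) (monomial m 1)) = 0 := by
  have hlead : defect b (b i) (b p) (X j * monomial m 1) = 0 := by
    rw [X_mul_monomial]
    exact defect_monomial_of_mem_lowerBounds hpi.le (mem_lowerBounds_support_add_single hp hpj.le)
  rw [← sub_add_cancel (act b (b j) (monomial m 1)) (X j * monomial m 1), map_add, hlead,
    h _ (act_monomial_sub_mem b m j), zero_add]

theorem defect_eq_zero_of_mem_degreeLE (d : ℕ) :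
    ∀ f ∈ degreeLE ι k d, ∀ x y, defect b x y f = 0 := by
  induction d using Nat.strong_induction_on with
  | _ d ih =>
    intro f hf x y
    have key : degreeLE ι k d ≤ LinearMap.ker (defect b x y) := by
      refine degreeLE_le_of_monomial_mem fun m hm =>
        defect_eq_zero_of_basis (fun i j hji => ?_) x y
      by_cases hj : j ∈ lowerBounds (m.support : Set ι)
      · exact defect_monomial_of_mem_lowerBounds hji hj
      obtain ⟨p, hpj, T, rfl, hT⟩ := exists_eq_add_single hj
      have ihT := ih T.degree (Nat.lt_of_succ_le (by simpa using hm))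
      rw [← X_mul_monomial, ← act_of_mem_lowerBounds b hT]
      exact defect_act (ihT _ (monomial_mem_degreeLE T 1))
        (defect_act_monomial (hpj.trans_le hji) hpj hT ihT)
        (defect_act_monomial hpj (hpj.trans_le hji) hT ihT)
    exact key hf

theorem defect_eq_zero (x y : L) : defect b x y = 0 :=
  (basisMonomials ι k).ext fun m => by
    rw [coe_basisMonomials]
    exact defect_eq_zero_of_mem_degreeLE _ _ (monomial_mem_degreeLE m 1) x y

variable (b)

/-- The representation of the enveloping algebra of `L` on the polynomial ring in a basis of `L`
that underlies the Poincaré–Birkhoff–Witt theorem. -/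
def rep : UniversalEnvelopingAlgebra k L →ₐ[k] Module.End k (MvPolynomial ι k) :=
  UniversalEnvelopingAlgebra.lift k
    { act b with map_lie' := fun {x y} => (sub_eq_zero.1 (defect_eq_zero x y)).symm }

theorem rep_ι (x : L) : rep b (UniversalEnvelopingAlgebra.ι k x) = act b x :=
  UniversalEnvelopingAlgebra.lift_ι_apply k _ x

end Representation

section Weights

variable {ι k L M : Type*} [LinearOrder ι] [CommRing k] [LieRing L] [LieAlgebra k L]
  [AddCommMonoid M] [PartialOrder M] {b : Module.Basis ι k L} {w : ι → M}

/-- Giving the basis vector `b i` the weight `w i`, the bracket does not increase weights. -/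
def IsLieWeight (b : Module.Basis ι k L) (w : ι → M) : Prop :=
  ∀ i j l, b.repr ⁅b i, b j⁆ l ≠ 0 → w l ≤ w i + w j

variable [IsOrderedAddMonoid M]

theorem act_mem_weightLE_of_monomial {i : ι} {d : ℕ} {p : M} {f : MvPolynomial ι k}
    (h : ∀ m : ι →₀ ℕ, m.degree ≤ d →
      act b (b i) (monomial m 1) ∈ weightLE k w (Finsupp.weight w m + w i))
    (hfp : f ∈ weightLE k w p) (hfd : f ∈ degreeLE ι k d) :
    act b (b i) f ∈ weightLE k w (p + w i) := by
  rw [f.as_sum, map_sum]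
  refine Submodule.sum_mem _ fun m hm => ?_
  rw [← mul_one (coeff m f), ← smul_eq_mul, ← smul_monomial, map_smul]
  exact Submodule.smul_mem _ _ (weightLE_mono w (add_le_add_left (mem_weightLE.1 hfp m hm) _)
    (h m (mem_degreeLE.1 hfd m hm)))

theorem IsLieWeight.act_monomial_mem (hw : IsLieWeight b w) (i : ι) (m : ι →₀ ℕ) :
    act b (b i) (monomial m 1) ∈ weightLE k w (Finsupp.weight w m + w i) := by
  induction hd : m.degree using Nat.strong_induction_on generalizing m i with
  | _ d ih =>
  subst hd
  by_cases hi : i ∈ lowerBounds (m.support : Set ι)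
  · rw [act_of_mem_lowerBounds b hi]
    exact X_mul_mem_weightLE i (monomial_mem_weightLE w m 1)
  obtain ⟨j, hji, T, rfl, hT⟩ := exists_eq_add_single hi
  have ihT (i : ι) (m : ι →₀ ℕ) (hm : m.degree ≤ T.degree) :=
    ih m.degree (by simpa using Nat.lt_succ_of_le hm) i m rfl
  have hweight : Finsupp.weight w (T + Finsupp.single j 1) = Finsupp.weight w T + w j := by
    rw [map_add, Finsupp.weight_single, one_smul]
  rw [act_add_single b hji hT]
  refine add_mem (add_mem (X_mul_mem_weightLE i (monomial_mem_weightLE w _ 1)) ?_) ?_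
  · rw [hweight, add_right_comm]
    exact act_mem_weightLE_of_monomial (ihT j)
      (sub_mem (ihT i T le_rfl) (X_mul_mem_weightLE i (monomial_mem_weightLE w T 1)))
      (act_monomial_sub_mem b T i)
  · rw [← b.linearCombination_repr ⁅b i, b j⁆, Finsupp.linearCombination_apply, Finsupp.sum,
      map_sum, LinearMap.sum_apply, hweight]
    refine sum_mem fun l hl => ?_
    rw [map_smul, LinearMap.smul_apply]
    refine Submodule.smul_mem _ _ (weightLE_mono w ?_ (ihT l T le_rfl))
    rw [add_assoc, add_comm (w j)]
    exact add_le_add_right (hw i j l (Finsupp.mem_support_iff.1 hl)) _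

theorem IsLieWeight.act_mem (hw : IsLieWeight b w) (i : ι) {p : M} {f : MvPolynomial ι k}
    (hf : f ∈ weightLE k w p) : act b (b i) f ∈ weightLE k w (p + w i) := by
  have : weightLE k w p ≤ (weightLE k w (p + w i)).comap (act b (b i)) :=
    weightLE_le_of_monomial_mem fun m hm =>
      weightLE_mono w (add_le_add_left hm _) (hw.act_monomial_mem i m)
  exact this hf

end Weights

section LeadingForms

variable {ι k : Type*} [CommRing k]

/-- The operator `T` raises degrees by at most `n`, and it acts on leading forms as multiplication
by `g`. -/
def HasSymbol (n : ℕ) (T : Module.End k (MvPolynomial ι k)) (g : MvPolynomial ι k) : Prop :=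
  ∀ (d : ℕ), ∀ f ∈ degreeLE ι k d, T f ∈ degreeLE ι k (d + n) ∧
    homogeneousComponent (d + n) (T f) = g * homogeneousComponent d f

variable {m n : ℕ} {S T : Module.End k (MvPolynomial ι k)} {f g : MvPolynomial ι k}

theorem hasSymbol_zero (n : ℕ) : HasSymbol n (0 : Module.End k (MvPolynomial ι k)) 0 :=
  fun d f _ => by simp

theorem hasSymbol_one : HasSymbol 0 (1 : Module.End k (MvPolynomial ι k)) 1 :=
  fun d f hf => by simpa using hf

theorem HasSymbol.add (hS : HasSymbol n S f) (hT : HasSymbol n T g) :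
    HasSymbol n (S + T) (f + g) := fun d p hp =>
  ⟨add_mem (hS d p hp).1 (hT d p hp).1, by
    rw [LinearMap.add_apply, map_add, (hS d p hp).2, (hT d p hp).2, add_mul]⟩

theorem HasSymbol.smul (c : k) (hT : HasSymbol n T g) : HasSymbol n (c • T) (c • g) :=
  fun d p hp => ⟨Submodule.smul_mem _ c (hT d p hp).1, by
    rw [LinearMap.smul_apply, map_smul, (hT d p hp).2, smul_mul_assoc]⟩

theorem HasSymbol.mul (hS : HasSymbol m S f) (hT : HasSymbol n T g) :
    HasSymbol (m + n) (S * T) (f * g) := fun d p hp => by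
  obtain ⟨hTp, hTp'⟩ := hT d p hp
  obtain ⟨hSp, hSp'⟩ := hS _ _ hTp
  rw [add_comm m, ← add_assoc, Module.End.mul_apply, hSp', hTp', mul_assoc]
  exact ⟨hSp, rfl⟩

theorem HasSymbol.succ (hT : HasSymbol n T g) : HasSymbol (n + 1) T 0 := fun d p hp =>
  ⟨weightLE_mono _ (Nat.le_succ _) (hT d p hp).1, by
    rw [zero_mul, ← add_assoc,
      homogeneousComponent_eq_zero_of_mem_degreeLE (hT d p hp).1 (Nat.lt_add_one _)]⟩

theorem HasSymbol.homogeneousComponent_apply_one (hT : HasSymbol n T g) :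
    homogeneousComponent n (T 1) = g := by
  simpa [homogeneousComponent_zero] using (hT 0 1 (one_mem_weightLE _)).2

variable {L : Type*} [LinearOrder ι] [LieRing L] [LieAlgebra k L] (b : Module.Basis ι k L)

theorem hasSymbol_act_basis (i : ι) : HasSymbol 1 (act b (b i)) (X i) := fun d f hf => by
  have hsub := act_sub_X_mul_mem b i hf
  refine ⟨act_mem_degreeLE b (b i) hf, ?_⟩
  rw [← sub_add_cancel (act b (b i) f) (X i * f), map_add, homogeneousComponent_succ_X_mul,
    homogeneousComponent_eq_zero_of_mem_degreeLE hsub (Nat.lt_succ_self d), zero_add]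

theorem exists_hasSymbol_act (x : L) : ∃ g, HasSymbol 1 (act b x) g := by
  induction b.mem_span x using Submodule.span_induction with
  | zero => exact ⟨0, by simpa using hasSymbol_zero 1⟩
  | add x y _ _ hx hy => exact ⟨_, by simpa using hx.choose_spec.add hy.choose_spec⟩
  | smul c x _ hx => exact ⟨_, by simpa using hx.choose_spec.smul c⟩
  | mem x hx => obtain ⟨i, rfl⟩ := hx; exact ⟨_, hasSymbol_act_basis b i⟩

end LeadingForms

end PBW

namespace Cohn

open MvPolynomial PBW

section Symbols

attribute [local instance] LieRing.ofAssociativeRing LieAlgebra.ofAssociativeAlgebra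

variable {ι k L : Type*} [LinearOrder ι] [Field k] [LieRing L] [LieAlgebra k L]
  (b : Module.Basis ι k L)

local notation "U" => UniversalEnvelopingAlgebra k L

theorem exists_hasSymbol_rep {n : ℕ} {a : U} (ha : a ∈ filtration k L n) :
    ∃ g, HasSymbol n (rep b a) g := by
  have scalar (c : k) : HasSymbol 0 (rep b (algebraMap k _ c)) (c • 1) := by
    rw [AlgHom.commutes, Algebra.algebraMap_eq_smul_one]
    exact hasSymbol_one.smul c
  induction ha using Submodule.pow_induction_on_left' with
  | algebraMap c => exact ⟨_, scalar c⟩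
  | add x y n _ _ hx hy => exact ⟨_, by simpa using hx.choose_spec.add hy.choose_spec⟩
  | mem_mul a ha n x _ hx =>
    obtain ⟨c, hc, _, ⟨y, rfl⟩, rfl⟩ := Submodule.mem_sup.1 ha
    obtain ⟨c, rfl⟩ := Submodule.mem_one.1 hc
    obtain ⟨g, hg⟩ := exists_hasSymbol_act b y
    rw [← rep_ι] at hg
    exact ⟨_, by simpa [add_comm] using ((scalar c).succ.add hg).mul hx.choose_spec⟩

/-- The principal symbol of an element of the `n`-th term of the standard filtration, in the
symmetric algebra of `L`, viewed as the polynomial ring in a basis of `L`. -/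
def principalSymbol (n : ℕ) : U →ₗ[k] MvPolynomial ι k :=
  (homogeneousComponent n).comp ((LinearMap.applyₗ 1).comp (rep b).toLinearMap)

theorem principalSymbol_eq_of_hasSymbol {n : ℕ} {a : U} {g : MvPolynomial ι k}
    (h : HasSymbol n (rep b a) g) : principalSymbol b n a = g :=
  h.homogeneousComponent_apply_one

theorem hasSymbol_principalSymbol {n : ℕ} {a : U} (ha : a ∈ filtration k L n) :
    HasSymbol n (rep b a) (principalSymbol b n a) := by
  obtain ⟨g, hg⟩ := exists_hasSymbol_rep b ha
  rwa [principalSymbol_eq_of_hasSymbol b hg]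

theorem principalSymbol_mul {m n : ℕ} {a c : U} (ha : a ∈ filtration k L m)
    (hc : c ∈ filtration k L n) :
    principalSymbol b (m + n) (a * c) = principalSymbol b m a * principalSymbol b n c :=
  principalSymbol_eq_of_hasSymbol b
    (map_mul (rep b) a c ▸ (hasSymbol_principalSymbol b ha).mul (hasSymbol_principalSymbol b hc))

theorem principalSymbol_succ {n : ℕ} {a : U} (ha : a ∈ filtration k L n) :
    principalSymbol b (n + 1) a = 0 :=
  principalSymbol_eq_of_hasSymbol b (hasSymbol_principalSymbol b ha).succ

theorem principalSymbol_one : principalSymbol b 0 1 = 1 :=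
  principalSymbol_eq_of_hasSymbol b (map_one (rep b) ▸ hasSymbol_one)

theorem principalSymbol_ι_basis (i : ι) :
    principalSymbol b 1 (UniversalEnvelopingAlgebra.ι k (b i)) = X i :=
  principalSymbol_eq_of_hasSymbol b (rep_ι b (b i) ▸ hasSymbol_act_basis b i)

theorem principalSymbol_ι_ne_zero {x : L} (hx : x ≠ 0) :
    principalSymbol b 1 (UniversalEnvelopingAlgebra.ι k x) ≠ 0 := by
  have hmap : (principalSymbol b 1).comp (UniversalEnvelopingAlgebra.ι k : L →ₗ⁅k⁆ U).toLinearMap =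
      (Finsupp.linearCombination k X).comp b.repr.toLinearMap :=
    b.ext fun i => by simpa using principalSymbol_ι_basis b i
  have happly := LinearMap.congr_fun hmap x
  simp only [LinearMap.comp_apply, LieHom.coe_toLinearMap, LinearEquiv.coe_coe] at happly
  rw [happly]
  exact fun h => hx (b.repr.map_eq_zero_iff.1
    (linearIndependent_iff.1 (linearIndependent_X ι k) _ h))

end Symbols

section AssociatedGraded

attribute [local instance] LieRing.ofAssociativeRing LieAlgebra.ofAssociativeAlgebra

variable {ι k L : Type*} [Field k] [LieRing L] [LieAlgebra k L]

local notation "U" => UniversalEnvelopingAlgebra k L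

variable (k L) in
/-- The homogeneous component `Uₙ tⁿ` of the Rees ring. -/
def reesMonomial (n : ℕ) : filtration k L n →ₗ[k] rees k L where
  toFun a := ⟨Polynomial.monomial n (a : U), fun m => by
    rw [Polynomial.coeff_monomial]
    split_ifs with h
    · exact h ▸ a.2
    · exact zero_mem _⟩
  map_add' a b := Subtype.ext (map_add (Polynomial.monomial n) (a : U) (b : U))
  map_smul' c a := Subtype.ext (Polynomial.smul_monomial c n (a : U)).symm

theorem reesMonomial_mul {m n : ℕ} (a : filtration k L m) (b : filtration k L n) :
    reesMonomial k L (m + n) ⟨a * b, mul_mem_filtration k L a.2 b.2⟩ =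
      reesMonomial k L m a * reesMonomial k L n b :=
  Subtype.ext (Polynomial.monomial_mul_monomial m n (a : U) (b : U)).symm

theorem reesMonomial_one_one : reesMonomial k L 1 ⟨1, one_mem_filtration k L 1⟩ = t k L := rfl

theorem eq_sum_reesMonomial (p : rees k L) :
    p = ∑ n ∈ p.1.support, reesMonomial k L n ⟨p.1.coeff n, p.2 n⟩ := by
  refine Subtype.ext ?_
  rw [AddSubmonoidClass.coe_finsetSum]
  exact p.1.as_sum_support

theorem exists_reesMonomial_one_eq {a : U} (ha : a ∈ filtration k L 1) :
    ∃ (c : k) (x : L), reesMonomial k L 1 ⟨a, ha⟩ = c • t k L + symbol k L x := by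
  obtain ⟨_, hc, _, ⟨x, rfl⟩, rfl⟩ := Submodule.mem_sup.1 ((pow_one (filtrationOne k L)).le ha)
  obtain ⟨c, rfl⟩ := Submodule.mem_one.1 hc
  refine ⟨c, x, Subtype.ext ?_⟩
  change Polynomial.monomial 1 _ = c • Polynomial.X + Polynomial.monomial 1 _
  rw [map_add, Algebra.algebraMap_eq_smul_one, ← Polynomial.smul_monomial,
    Polynomial.monomial_one_one_eq_X]
  rfl

theorem adjoin_t_symbol : Algebra.adjoin k (insert (t k L) (Set.range (symbol k L))) = ⊤ := by
  set S := Algebra.adjoin k (insert (t k L) (Set.range (symbol k L)))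
  have ht : t k L ∈ S := Algebra.subset_adjoin (Set.mem_insert _ _)
  have hsymbol (x : L) : symbol k L x ∈ S :=
    Algebra.subset_adjoin (Set.mem_insert_of_mem _ ⟨x, rfl⟩)
  have hmonomial (n : ℕ) : ∀ a : filtration k L n, reesMonomial k L n a ∈ S := by
    induction n with
    | zero =>
      rintro ⟨_, ha⟩
      obtain ⟨c, rfl⟩ := Submodule.mem_one.1 ha
      exact S.algebraMap_mem c
    | succ n ih =>
      suffices ∀ a ∈ filtration k L n * filtrationOne k L,
          ∃ ha : a ∈ filtration k L (n + 1), reesMonomial k L (n + 1) ⟨a, ha⟩ ∈ S from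
        fun a => (this a a.2).2
      intro a ha
      induction ha using Submodule.mul_induction_on' with
      | mem_mul_mem a ha b hb =>
        have hb' : b ∈ filtration k L 1 := (pow_one (filtrationOne k L)).ge hb
        refine ⟨mul_mem_filtration k L ha hb', ?_⟩
        obtain ⟨c, x, hcx⟩ := exists_reesMonomial_one_eq hb'
        rw [reesMonomial_mul ⟨a, ha⟩ ⟨b, hb'⟩, hcx]
        exact mul_mem (ih _) (add_mem (S.smul_mem ht c) (hsymbol x))
      | add a _ b _ ha hb =>
        obtain ⟨ha, ha'⟩ := ha
        obtain ⟨hb, hb'⟩ := hb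
        refine ⟨add_mem ha hb, ?_⟩
        exact (map_add (reesMonomial k L (n + 1)) ⟨a, ha⟩ ⟨b, hb⟩) ▸ add_mem ha' hb'
  refine Algebra.eq_top_iff.2 fun p => ?_
  rw [eq_sum_reesMonomial p]
  exact sum_mem fun n _ => hmonomial n _

variable (k L) in
theorem toTrunc_one_t : toTrunc k L 1 (t k L) = 0 := by
  simpa only [pow_one] using toTrunc_t_pow k L 1

instance : CommRing (Trunc k L 1) where
  __ := (inferInstance : Ring (Trunc k L 1))
  mul_comm x y := by
    obtain ⟨p, rfl⟩ := toTrunc_surjective k L 1 x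
    obtain ⟨q, rfl⟩ := toTrunc_surjective k L 1 y
    obtain ⟨r, hr⟩ := rees_commutator k L p q
    rw [← sub_eq_zero, ← map_mul, ← map_mul, ← map_sub, hr, map_mul, toTrunc_one_t, zero_mul]

theorem mem_tIdeal_iff {n : ℕ} {p : rees k L} : p ∈ tIdeal k L n ↔ ∃ q, p = t k L ^ n * q := by
  have hcomm (q : rees k L) : Commute (t k L ^ n) q :=
    (show Commute (t k L) q from t_central k L q).pow_left n
  refine Ideal.mem_span_singleton'.trans (exists_congr fun q => ?_)
  rw [← (hcomm q).eq, eq_comm]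

theorem toTrunc_eq_zero_iff {n : ℕ} {p : rees k L} :
    toTrunc k L n p = 0 ↔ ∃ q, p = t k L ^ n * q :=
  Ideal.Quotient.eq_zero_iff_mem.trans mem_tIdeal_iff

/-- The map from the symmetric algebra of `L` to the associated graded ring. -/
def toGr (b : Module.Basis ι k L) : MvPolynomial ι k →ₐ[k] Trunc k L 1 :=
  aeval fun i => toTrunc k L 1 (symbol k L (b i))

theorem toGr_surjective (b : Module.Basis ι k L) : Function.Surjective (toGr b) := by
  have hsymbol (x : L) : toTrunc k L 1 (symbol k L x) ∈ (toGr b).range := by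
    suffices ⊤ ≤ (Subalgebra.toSubmodule (toGr b).range).comap
      ((toTrunc k L 1).toLinearMap.comp (symbol k L)) from this (x := x) trivial
    rw [← b.span_eq, Submodule.span_le]
    rintro _ ⟨i, rfl⟩
    exact ⟨X i, aeval_X _ i⟩
  have htop : (⊤ : Subalgebra k (rees k L)) ≤ (toGr b).range.comap (toTrunc k L 1) := by
    rw [← adjoin_t_symbol, Algebra.adjoin_le_iff]
    rintro _ (rfl | ⟨x, rfl⟩)
    · change toTrunc k L 1 (t k L) ∈ (toGr b).range
      exact (toTrunc_one_t k L).symm ▸ zero_mem (toGr b).range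
    · exact hsymbol x
  intro x
  obtain ⟨p, rfl⟩ := toTrunc_surjective k L 1 x
  exact htop (x := p) trivial

variable [LinearOrder ι] (b : Module.Basis ι k L)

/-- The map from the Rees ring to the symmetric algebra of `L` given by principal symbols. -/
def reesSymbol : rees k L →ₐ[k] MvPolynomial ι k :=
  have hmonomial (n : ℕ) (a : U) :
      Polynomial.lsum (fun n => principalSymbol b n) (Polynomial.monomial n a) =
        principalSymbol b n a :=
    (Polynomial.lsum_apply ..).trans (Polynomial.sum_monomial_index a _ (map_zero _))
  AlgHom.ofLinearMap
    ((Polynomial.lsum fun n => principalSymbol b n).comp (rees k L).val.toLinearMap)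
    (by
      change Polynomial.lsum (fun n => principalSymbol b n) 1 = 1
      rw [← Polynomial.monomial_zero_one, hmonomial, principalSymbol_one])
    fun p q => by
      change Polynomial.lsum (fun n => principalSymbol b n) (p.1 * q.1) =
        Polynomial.lsum (fun n => principalSymbol b n) p.1 *
          Polynomial.lsum (fun n => principalSymbol b n) q.1
      rw [p.1.as_sum_support, q.1.as_sum_support, Finset.sum_mul_sum]
      simp only [map_sum, Polynomial.monomial_mul_monomial, hmonomial, Finset.sum_mul_sum]
      exact Finset.sum_congr rfl fun i _ => Finset.sum_congr rfl fun j _ =>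
        principalSymbol_mul b (p.2 i) (q.2 j)

theorem reesSymbol_reesMonomial {n : ℕ} (a : filtration k L n) :
    reesSymbol b (reesMonomial k L n a) = principalSymbol b n (a : U) :=
  (Polynomial.lsum_apply ..).trans (Polynomial.sum_monomial_index (a : U) _ (map_zero _))

theorem reesSymbol_t : reesSymbol b (t k L) = 0 := by
  rw [← reesMonomial_one_one, reesSymbol_reesMonomial]
  exact principalSymbol_succ b (one_mem_filtration k L 0)

theorem reesSymbol_symbol (i : ι) : reesSymbol b (symbol k L (b i)) = X i :=
  (reesSymbol_reesMonomial b
    ⟨_, (pow_one (filtrationOne k L)).ge (ι_mem_filtrationOne k L (b i))⟩).trans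
    (principalSymbol_ι_basis b i)

/-- The map from the associated graded ring to the symmetric algebra of `L`, inverse to `toGr`. -/
def fromGr : Trunc k L 1 →ₐ[k] MvPolynomial ι k :=
  Ideal.Quotient.liftₐ (tIdeal k L 1) (reesSymbol b) fun p hp => by
    obtain ⟨q, rfl⟩ := mem_tIdeal_iff.1 hp
    rw [map_mul, pow_one, reesSymbol_t, zero_mul]

theorem fromGr_toTrunc (p : rees k L) : fromGr b (toTrunc k L 1 p) = reesSymbol b p := rfl

theorem fromGr_toGr (f : MvPolynomial ι k) : fromGr b (toGr b f) = f := by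
  suffices (fromGr b).comp (toGr b) = AlgHom.id k _ from DFunLike.congr_fun this f
  refine MvPolynomial.algHom_ext fun i => ?_
  rw [AlgHom.comp_apply, toGr, aeval_X, fromGr_toTrunc, reesSymbol_symbol, AlgHom.id_apply]

theorem reesSymbol_eq_zero_iff {p : rees k L} : reesSymbol b p = 0 ↔ ∃ q, p = t k L * q := by
  have hinj : Function.Injective (fromGr b) := by
    have hleft : Function.LeftInverse (fromGr b) (toGr b) := fromGr_toGr b
    exact (hleft.rightInverse_of_surjective (toGr_surjective b)).injective
  rw [← fromGr_toTrunc, map_eq_zero_iff _ hinj, toTrunc_eq_zero_iff, pow_one]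

theorem t_mul_cancel {p q : rees k L} (h : t k L * p = t k L * q) : p = q :=
  Subtype.ext (Polynomial.isRegular_X.left (congrArg Subtype.val h))

theorem dvd_of_mul_eq_t_pow_mul {s a c : rees k L} (hs : reesSymbol b s ≠ 0) (n : ℕ)
    (h : s * a = t k L ^ n * c) : ∃ d, a = t k L ^ n * d := by
  induction n generalizing a c with
  | zero => exact ⟨a, by rw [pow_zero, one_mul]⟩
  | succ n ih =>
    rw [pow_succ', mul_assoc] at h
    have h0 : reesSymbol b s * reesSymbol b a = 0 := by
      rw [← map_mul, h, map_mul, reesSymbol_t, zero_mul]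
    obtain ⟨a', rfl⟩ := (reesSymbol_eq_zero_iff b).1 ((mul_eq_zero.1 h0).resolve_left hs)
    rw [← mul_assoc, ← t_central, mul_assoc] at h
    obtain ⟨d, rfl⟩ := ih (t_mul_cancel h)
    exact ⟨d, by rw [pow_succ', mul_assoc]⟩

theorem mem_denominators_iff {p : rees k L} : p ∈ denominators k L ↔ reesSymbol b p ≠ 0 := by
  have hmem {p : rees k L} : p ∈ tIdeal k L 1 ↔ reesSymbol b p = 0 := by
    rw [mem_tIdeal_iff, reesSymbol_eq_zero_iff, pow_one]
  refine ⟨fun hp => ?_, fun hp => Submonoid.subset_closure fun h => hp (hmem.1 h)⟩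
  induction hp using Submonoid.closure_induction with
  | mem x hx => exact fun h => hx (hmem.2 h)
  | one => rw [map_one]; exact one_ne_zero
  | mul x y _ _ hx hy => rw [map_mul]; exact mul_ne_zero hx hy

end AssociatedGraded

section Localization

attribute [local instance] LieRing.ofAssociativeRing LieAlgebra.ofAssociativeAlgebra

variable {ι k L : Type*} [Field k] [LieRing L] [LieAlgebra k L]

local notation "U" => UniversalEnvelopingAlgebra k L

/-- The map from the Rees ring to the localized quotient by `tⁿ`. -/
def loc (n : ℕ) : rees k L →ₐ[k] LocTrunc k L n := (toLoc k L n).comp (toTrunc k L n)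

theorem loc_t_pow_mul (n : ℕ) (c : rees k L) : loc n (t k L ^ n * c) = 0 := by
  rw [loc, AlgHom.comp_apply, map_mul, map_pow, toTrunc_t_pow, zero_mul, map_zero]

theorem transition_loc (n : ℕ) (p : rees k L) : transition k L n (loc (n + 1) p) = loc n p :=
  transition_toLoc k L n _

theorem exists_t_pow_mul_eq_completionToDivRing (y : DivRing k L) :
    ∃ (m : ℕ) (x : completion k L),
      reesToDivRing k L (t k L) ^ m * y = completionToDivRing k L x := by
  induction y using OreLocalization.ind with
  | _ r s =>
    obtain ⟨_, m, rfl⟩ := s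
    refine ⟨m, r, ?_⟩
    have hpow : reesToDivRing k L (t k L) ^ m =
        completionToDivRing k L (toCompletion k L (t k L) ^ m) :=
      (map_pow (completionToDivRing k L) _ m).symm
    rw [hpow]
    exact OreLocalization.mul_cancel (S := tPowers k L) (s := ⟨_, m, rfl⟩)

theorem isUnit_reesToDivRing_t : IsUnit (reesToDivRing k L (t k L)) :=
  ⟨⟨_, tInv k L, mul_tInv k L, tInv_mul k L⟩, rfl⟩

theorem reesToDivRing_t_commute (y : DivRing k L) : Commute (reesToDivRing k L (t k L)) y := by
  obtain ⟨m, x, hx⟩ := exists_t_pow_mul_eq_completionToDivRing y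
  have hcomm : Commute (reesToDivRing k L (t k L)) (completionToDivRing k L x) :=
    Commute.map (show Commute _ x from toCompletion_t_central k L x) (completionToDivRing k L)
  rw [← hx] at hcomm
  refine (isUnit_reesToDivRing_t.pow m).mul_left_cancel ?_
  rw [← mul_assoc, ← mul_assoc, ← pow_succ, pow_succ', mul_assoc, hcomm.eq, mul_assoc]

theorem t_mul_embedding_ι (x : L) :
    reesToDivRing k L (t k L) * embedding k L (UniversalEnvelopingAlgebra.ι k x) =
      reesToDivRing k L (symbol k L x) := by
  have hembedding : embedding k L (UniversalEnvelopingAlgebra.ι k x) =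
      tInv k L * reesToDivRing k L (symbol k L x) :=
    UniversalEnvelopingAlgebra.lift_ι_apply k (lieMap k L) x
  rw [hembedding, ← mul_assoc, mul_tInv, one_mul]

theorem reesToDivRing_eq_eval₂ :
    reesToDivRing k L =
      (Polynomial.eval₂AlgHom (embedding k L) (reesToDivRing k L (t k L))
        fun a => (reesToDivRing_t_commute (embedding k L a)).symm).comp (rees k L).val := by
  refine AlgHom.ext_of_adjoin_eq_top adjoin_t_symbol ?_
  rintro _ (rfl | ⟨x, rfl⟩)
  · exact (Polynomial.eval₂_X _ _).symm
  · refine Eq.trans ?_ (Polynomial.eval₂_monomial (embedding k L : U →+* DivRing k L) _).symm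
    rw [pow_one]
    exact ((reesToDivRing_t_commute _).symm.eq.trans (t_mul_embedding_ι x)).symm

theorem reesToDivRing_reesMonomial {n : ℕ} (a : filtration k L n) :
    reesToDivRing k L (reesMonomial k L n a) =
      embedding k L (a : U) * reesToDivRing k L (t k L) ^ n :=
  (DFunLike.congr_fun reesToDivRing_eq_eval₂ _).trans
    (Polynomial.eval₂_monomial (embedding k L : U →+* DivRing k L) _)

theorem embedding_mem_divSubring (a : U) : embedding k L a ∈ divSubring k L := by
  rw [divSubring, divisionClosure, Algebra.mem_sInf]
  exact fun S hS => hS.1 ⟨a, rfl⟩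

theorem inv_mem_divSubring (u : (DivRing k L)ˣ) (hu : (u : DivRing k L) ∈ divSubring k L) :
    (↑u⁻¹ : DivRing k L) ∈ divSubring k L := by
  rw [divSubring, divisionClosure, Algebra.mem_sInf] at hu ⊢
  exact fun S hS => hS.2 _ (hu S hS) _ (Units.mul_inv u) (Units.inv_mul u)

variable [LinearOrder ι] (b : Module.Basis ι k L)
include b

theorem isUnit_loc {p : rees k L} (hp : reesSymbol b p ≠ 0) (n : ℕ) : IsUnit (loc n p) :=
  isUnit_toLoc k L n ⟨_, p, (mem_denominators_iff b).2 hp, rfl⟩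

theorem toLoc_injective (n : ℕ) : Function.Injective (toLoc k L n) := by
  refine OreLocalization.numeratorHom_inj ?_
  rintro _ ⟨p, hp, rfl⟩ a h
  obtain ⟨q, rfl⟩ := toTrunc_surjective k L n a
  obtain ⟨c, hc⟩ := toTrunc_eq_zero_iff.1 ((map_mul (toTrunc k L n) p q).trans h)
  exact toTrunc_eq_zero_iff.2 (dvd_of_mul_eq_t_pow_mul b ((mem_denominators_iff b).1 hp) n hc)

theorem loc_eq_zero_iff {n : ℕ} {p : rees k L} : loc n p = 0 ↔ ∃ c, p = t k L ^ n * c := by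
  rw [loc, AlgHom.comp_apply, map_eq_zero_iff _ (toLoc_injective b n), toTrunc_eq_zero_iff]

theorem exists_loc_mul_eq_loc (n : ℕ) (x : LocTrunc k L n) :
    ∃ s a : rees k L, reesSymbol b s ≠ 0 ∧ loc n s * x = loc n a := by
  induction x using OreLocalization.ind with
  | _ r s =>
    obtain ⟨_, p, hp, rfl⟩ := s
    obtain ⟨a, rfl⟩ := toTrunc_surjective k L n r
    exact ⟨p, a, (mem_denominators_iff b).1 hp,
      OreLocalization.mul_cancel (S := truncDenominators k L n) (s := ⟨_, p, hp, rfl⟩)⟩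

theorem eq_zero_of_toCompletion_t_mul_eq_zero {x : completion k L}
    (h : toCompletion k L (t k L) * x = 0) : x = 0 := by
  refine Subtype.ext (funext fun n => (x.2 n).symm.trans ?_)
  obtain ⟨s, a, hs, hsa⟩ := exists_loc_mul_eq_loc b (n + 1) (x.1 (n + 1))
  have htx : loc (n + 1) (t k L) * x.1 (n + 1) = 0 := congrFun (congrArg Subtype.val h) (n + 1)
  have hta : loc (n + 1) (t k L * a) = 0 := by
    rw [map_mul, ← hsa, ← mul_assoc, ← map_mul, t_central, map_mul, mul_assoc, htx, mul_zero]
  obtain ⟨c, hc⟩ := (loc_eq_zero_iff b).1 hta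
  rw [pow_succ', mul_assoc] at hc
  have hsa' := congrArg (transition k L n) hsa
  rw [map_mul, transition_loc, transition_loc, t_mul_cancel hc, loc_t_pow_mul] at hsa'
  exact (isUnit_loc b hs n).mul_right_eq_zero.1 hsa'

theorem completionToDivRing_injective : Function.Injective (completionToDivRing k L) := by
  refine OreLocalization.numeratorHom_inj ?_
  rintro _ ⟨m, rfl⟩ x h
  change toCompletion k L (t k L) ^ m * x = 0 at h
  induction m with
  | zero => rwa [pow_zero, one_mul] at h
  | succ m ih =>
    rw [pow_succ', mul_assoc] at h
    exact ih (eq_zero_of_toCompletion_t_mul_eq_zero b h)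

theorem isUnit_toCompletion {p : rees k L} (hp : reesSymbol b p ≠ 0) :
    IsUnit (toCompletion k L p) := by
  choose u hu using isUnit_loc b hp
  have hmem : (fun n => (↑(u n)⁻¹ : LocTrunc k L n)) ∈ completion k L := fun n => by
    refine Units.eq_inv_of_mul_eq_one_left ?_
    rw [hu, ← transition_loc, ← map_mul, ← hu, Units.mul_inv, map_one]
  refine ⟨⟨toCompletion k L p, ⟨_, hmem⟩, Subtype.ext (funext fun n => ?_),
    Subtype.ext (funext fun n => ?_)⟩, rfl⟩
  · exact (congrArg (· * _) (hu n).symm).trans (u n).mul_inv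
  · exact (congrArg (_ * ·) (hu n).symm).trans (u n).inv_mul

theorem isUnit_embedding {n : ℕ} {a : U} (ha : a ∈ filtration k L n)
    (h : principalSymbol b n a ≠ 0) : IsUnit (embedding k L a) := by
  have hsymbol : reesSymbol b (reesMonomial k L n ⟨a, ha⟩) ≠ 0 := by
    rwa [reesSymbol_reesMonomial]
  have hmonomial : IsUnit (reesToDivRing k L (reesMonomial k L n ⟨a, ha⟩)) :=
    (isUnit_toCompletion b hsymbol).map (completionToDivRing k L)
  rw [reesToDivRing_reesMonomial] at hmonomial
  obtain ⟨u, hu⟩ := isUnit_reesToDivRing_t (k := k) (L := L) |>.pow n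
  rwa [← hu, Units.isUnit_mul_units] at hmonomial

end Localization

end Cohn

namespace PBW

open MvPolynomial

section LeadingForms

variable {ι k : Type*} [CommRing k] {w : ι → ℤ} {i j : ℤ} {f g : MvPolynomial ι k}

theorem sub_weightedHomogeneousComponent_mem (hf : f ∈ weightLE k w i) :
    f - weightedHomogeneousComponent w i f ∈ weightLE k w (i - 1) := by
  rw [mem_weightLE] at hf ⊢
  intro m hm
  rw [mem_support_iff, coeff_sub, coeff_weightedHomogeneousComponent] at hm
  split_ifs at hm with h
  · exact absurd (sub_self _) hm
  · rw [sub_zero] at hm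
    have := hf m (mem_support_iff.2 hm)
    omega

theorem mem_weightLE_sub_one_iff (hf : f ∈ weightLE k w i) :
    f ∈ weightLE k w (i - 1) ↔ weightedHomogeneousComponent w i f = 0 := by
  refine ⟨fun h => weightedHomogeneousComponent_eq_zero' i f fun m hm => ?_, fun h => ?_⟩
  · have := mem_weightLE.1 h m hm
    omega
  · simpa only [h, sub_zero] using sub_weightedHomogeneousComponent_mem hf

theorem weightedHomogeneousComponent_mem_weightLE :
    weightedHomogeneousComponent w i f ∈ weightLE k w i :=
  mem_weightLE.2 fun _ hm =>
    (weightedHomogeneousComponent_isWeightedHomogeneous i f (mem_support_iff.1 hm)).le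

theorem weightedHomogeneousComponent_mul (hf : f ∈ weightLE k w i) (hg : g ∈ weightLE k w j) :
    weightedHomogeneousComponent w (i + j) (f * g) =
      weightedHomogeneousComponent w i f * weightedHomogeneousComponent w j g := by
  set f₀ := weightedHomogeneousComponent w i f
  set g₀ := weightedHomogeneousComponent w j g
  have hhom : IsWeightedHomogeneous w (f₀ * g₀) (i + j) :=
    (weightedHomogeneousComponent_isWeightedHomogeneous i f).mul
      (weightedHomogeneousComponent_isWeightedHomogeneous j g)
  have herror : f * g - f₀ * g₀ ∈ weightLE k w (i + j - 1) := by
    rw [show f * g - f₀ * g₀ = (f - f₀) * g + f₀ * (g - g₀) by ring]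
    refine add_mem (weightLE_mono w (by omega)
      (mul_mem_weightLE (sub_weightedHomogeneousComponent_mem hf) hg)) ?_
    exact weightLE_mono w (by omega)
      (mul_mem_weightLE weightedHomogeneousComponent_mem_weightLE
        (sub_weightedHomogeneousComponent_mem hg))
  rw [mem_weightLE_sub_one_iff (weightLE_mono w (by omega) herror), map_sub,
    hhom.weightedHomogeneousComponent_same, sub_eq_zero] at herror
  exact herror

theorem mul_notMem_weightLE [NoZeroDivisors k] (hf : f ∈ weightLE k w i) (hg : g ∈ weightLE k w j)
    (hf' : f ∉ weightLE k w (i - 1)) (hg' : g ∉ weightLE k w (j - 1)) :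
    f * g ∉ weightLE k w (i + j - 1) := by
  rw [mem_weightLE_sub_one_iff hf] at hf'
  rw [mem_weightLE_sub_one_iff hg] at hg'
  rw [mem_weightLE_sub_one_iff (mul_mem_weightLE hf hg), weightedHomogeneousComponent_mul hf hg]
  exact mul_ne_zero hf' hg'

theorem X_notMem_weightLE [Nontrivial k] (w : ι → ℤ) (i : ι) :
    (X i : MvPolynomial ι k) ∉ weightLE k w (w i - 1) := fun h => by
  rw [mem_weightLE_sub_one_iff (X_mem_weightLE w i),
    (isWeightedHomogeneous_X k w i).weightedHomogeneousComponent_same] at h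
  exact X_ne_zero i h

theorem weightLE_zero_neg_one :
    weightLE k (0 : ι → ℤ) (-1) = ⊥ := by
  refine (Submodule.eq_bot_iff _).2 fun f hf => ?_
  by_contra hne
  obtain ⟨m, hm⟩ := support_nonempty.2 hne
  simpa [Finsupp.weight_apply] using mem_weightLE.1 hf m hm

theorem one_notMem_weightLE [Nontrivial k] (w : ι → ℤ) :
    (1 : MvPolynomial ι k) ∉ weightLE k w (-1) := fun h => by
  simpa using mem_weightLE.1 h 0 (by simp)

end LeadingForms

end PBW

namespace Cohn

open MvPolynomial PBW

section Weights

attribute [local instance] LieRing.ofAssociativeRing LieAlgebra.ofAssociativeAlgebra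

variable {ι k L : Type*} [LinearOrder ι] [Field k] [LieRing L] [LieAlgebra k L]

local notation "U" => UniversalEnvelopingAlgebra k L

/-- The elements of weight at most `j` of the enveloping algebra, where the basis element `b i` has
weight `w i`: those whose action on polynomials raises weights by at most `j`. -/
def weightU (b : Module.Basis ι k L) (w : ι → ℤ) (j : ℤ) : Submodule k U where
  carrier := {a | ∀ p : ℤ, ∀ f ∈ weightLE k w p, rep b a f ∈ weightLE k w (p + j)}
  add_mem' ha hc p f hf := by
    rw [map_add, LinearMap.add_apply]
    exact add_mem (ha p f hf) (hc p f hf)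
  zero_mem' p f _ := by
    rw [map_zero, LinearMap.zero_apply]
    exact zero_mem _
  smul_mem' c a ha p f hf := by
    rw [map_smul, LinearMap.smul_apply]
    exact Submodule.smul_mem _ _ (ha p f hf)

/-- The elements of weight at most `j` of the Rees ring. -/
def weightRees (b : Module.Basis ι k L) (w : ι → ℤ) (j : ℤ) : Submodule k (rees k L) where
  carrier := {p | ∀ n, p.1.coeff n ∈ weightU b w j}
  add_mem' {p q} hp hq n := (Polynomial.coeff_add p.1 q.1 n).symm ▸ add_mem (hp n) (hq n)
  zero_mem' n := (Polynomial.coeff_zero (R := U) n).symm ▸ zero_mem _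
  smul_mem' c p hp n :=
    (Polynomial.coeff_smul c p.1 n).symm ▸ Submodule.smul_mem _ _ (hp n)

variable {b : Module.Basis ι k L} {w : ι → ℤ}

theorem weightU_mono : Monotone (weightU b w) :=
  fun _ _ h _ ha p f hf => weightLE_mono w (by omega) (ha p f hf)

instance : SetLike.GradedMonoid (weightU b w) where
  one_mem p f hf := by
    rw [map_one, Module.End.one_apply, add_zero]
    exact hf
  mul_mem i j a c ha hc p f hf := by
    rw [map_mul, Module.End.mul_apply]
    exact weightLE_mono w (by omega) (ha _ _ (hc p f hf))

theorem ι_mem_weightU (hw : IsLieWeight b w) (i : ι) :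
    UniversalEnvelopingAlgebra.ι k (b i) ∈ weightU b w (w i) := fun p f hf => by
  rw [rep_ι]
  exact hw.act_mem i hf

theorem weightRees_mono : Monotone (weightRees b w) :=
  fun _ _ h _ hp n => weightU_mono h (hp n)

theorem reesMonomial_mem_weightRees {n : ℕ} {a : filtration k L n} {j : ℤ}
    (h : (a : U) ∈ weightU b w j) : reesMonomial k L n a ∈ weightRees b w j := fun m => by
  change (Polynomial.monomial n (a : U)).coeff m ∈ _
  rw [Polynomial.coeff_monomial]
  split_ifs
  exacts [h, zero_mem _]

instance : SetLike.GradedMonoid (weightRees b w) where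
  one_mem := by
    have hone : (1 : rees k L) = reesMonomial k L 0 ⟨1, one_mem_filtration k L 0⟩ :=
      Subtype.ext Polynomial.monomial_zero_one.symm
    exact hone ▸ reesMonomial_mem_weightRees (SetLike.one_mem_graded (weightU b w))
  mul_mem i j p q hp hq n := by
    change (p.1 * q.1).coeff n ∈ _
    rw [Polynomial.coeff_mul]
    exact sum_mem fun _ _ => SetLike.mul_mem_graded (hp _) (hq _)

theorem t_pow_mem_weightRees (n : ℕ) : t k L ^ n ∈ weightRees b w 0 := by
  have ht : t k L ∈ weightRees b w 0 := by
    rw [← reesMonomial_one_one]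
    exact reesMonomial_mem_weightRees (SetLike.one_mem_graded (weightU b w))
  simpa only [smul_zero] using SetLike.pow_mem_graded n ht

theorem mem_weightRees_of_t_mul {j : ℤ} {p : rees k L} (h : t k L * p ∈ weightRees b w j) :
    p ∈ weightRees b w j := fun n => by
  have hcoeff : (Polynomial.X * p.1).coeff (n + 1) ∈ weightU b w j := h (n + 1)
  rwa [Polynomial.coeff_X_mul] at hcoeff

theorem mem_weightRees_of_t_pow_mul {j : ℤ} {n : ℕ} {p : rees k L}
    (h : t k L ^ n * p ∈ weightRees b w j) : p ∈ weightRees b w j := by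
  induction n with
  | zero => rwa [pow_zero, one_mul] at h
  | succ n ih =>
    rw [pow_succ', mul_assoc] at h
    exact ih (mem_weightRees_of_t_mul h)

theorem reesSymbol_mem_weightLE {j : ℤ} {p : rees k L} (hp : p ∈ weightRees b w j) :
    reesSymbol b p ∈ weightLE k w j := by
  rw [eq_sum_reesMonomial p, map_sum]
  refine sum_mem fun n _ => ?_
  rw [reesSymbol_reesMonomial]
  refine homogeneousComponent_mem_weightLE ?_ n
  exact zero_add j ▸ hp n 0 1 (one_mem_weightLE w)

variable (b w) in
/-- The elements of the Rees ring of weight exactly `i` modulo `t`. -/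
def IsExact (i : ℤ) (s : rees k L) : Prop :=
  s ∈ weightRees b w i ∧ reesSymbol b s ∉ weightLE k w (i - 1)

theorem IsExact.mul {i j : ℤ} {s s' : rees k L} (h : IsExact b w i s) (h' : IsExact b w j s') :
    IsExact b w (i + j) (s * s') := by
  refine ⟨SetLike.mul_mem_graded h.1 h'.1, ?_⟩
  rw [map_mul]
  exact mul_notMem_weightLE (reesSymbol_mem_weightLE h.1) (reesSymbol_mem_weightLE h'.1) h.2 h'.2

theorem isExact_one : IsExact b w 0 (1 : rees k L) := by
  refine ⟨SetLike.one_mem_graded _, ?_⟩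
  rw [map_one]
  exact one_notMem_weightLE w

theorem IsExact.pow {i : ℤ} {s : rees k L} (h : IsExact b w i s) (n : ℕ) :
    IsExact b w (n • i) (s ^ n) := by
  induction n with
  | zero => simpa only [zero_smul, pow_zero] using isExact_one
  | succ n ih => simpa only [succ_nsmul, pow_succ] using ih.mul h

theorem IsExact.reesSymbol_ne_zero {i : ℤ} {s : rees k L} (h : IsExact b w i s) :
    reesSymbol b s ≠ 0 := fun h0 => h.2 (h0 ▸ zero_mem _)

variable (b w) in
/-- The elements of the `n`-th term of the standard filtration that have weight exactly `j` modulo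
the previous term. -/
structure HasExactWeight (n : ℕ) (j : ℤ) (a : U) : Prop where
  mem_filtration : a ∈ filtration k L n
  mem_weightU : a ∈ weightU b w j
  principalSymbol_notMem : principalSymbol b n a ∉ weightLE k w (j - 1)

theorem HasExactWeight.isExact {n : ℕ} {j : ℤ} {a : U} (h : HasExactWeight b w n j a) :
    IsExact b w j (reesMonomial k L n ⟨a, h.mem_filtration⟩) :=
  ⟨reesMonomial_mem_weightRees h.mem_weightU,
    (reesSymbol_reesMonomial b _).symm ▸ h.principalSymbol_notMem⟩

theorem exists_pow_mul_eq_mul_add {p : ℤ} {s : rees k L} (hs : s ∈ weightRees b w p) (n : ℕ)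
    {q : ℤ} {c : rees k L} (hc : c ∈ weightRees b w q) :
    ∃ r ∈ weightRees b w ((n - 1) * p + q), ∃ d, s ^ n * c = r * s + t k L ^ n * d := by
  induction n generalizing q c with
  | zero => exact ⟨0, zero_mem _, c, by rw [pow_zero, pow_zero, zero_mul, zero_add]⟩
  | succ n ih =>
    obtain ⟨c', hc'⟩ := rees_commutator k L s c
    have hc'_mem : c' ∈ weightRees b w (p + q) := by
      refine mem_weightRees_of_t_mul ?_
      rw [← hc']
      exact sub_mem (SetLike.mul_mem_graded hs hc) (add_comm q p ▸ SetLike.mul_mem_graded hc hs)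
    obtain ⟨r, hr, d, hd⟩ := ih hc'_mem
    refine ⟨s ^ n * c + t k L * r, add_mem ?_ ?_, d, ?_⟩
    · refine weightRees_mono ?_ (SetLike.mul_mem_graded (SetLike.pow_mem_graded n hs) hc)
      rw [nsmul_eq_mul]
      push_cast
      linarith
    · have ht : t k L ∈ weightRees b w 0 := pow_one (t k L) ▸ t_pow_mem_weightRees 1
      refine weightRees_mono ?_ (SetLike.mul_mem_graded ht hr)
      push_cast
      linarith
    · calc s ^ (n + 1) * c = s ^ n * (c * s + t k L * c') := by
            rw [pow_succ, mul_assoc, ← hc', add_sub_cancel]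
        _ = s ^ n * c * s + t k L * (s ^ n * c') := by
            rw [mul_add, mul_assoc, ← mul_assoc (s ^ n) (t k L), ← t_central, mul_assoc (t k L)]
        _ = (s ^ n * c + t k L * r) * s + t k L ^ (n + 1) * d := by
            rw [hd, add_mul, mul_add, pow_succ' (t k L)]
            simp only [mul_assoc, add_assoc]

end Weights

section DivRingWeights

attribute [local instance] LieRing.ofAssociativeRing LieAlgebra.ofAssociativeAlgebra

variable {ι k L : Type*} [LinearOrder ι] [Field k] [LieRing L] [LieAlgebra k L]

local notation "U" => UniversalEnvelopingAlgebra k L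

variable {b : Module.Basis ι k L} {w : ι → ℤ}

variable (b w) in
/-- The condition that an element of the localized quotient by `tⁿ` be a fraction of weight at most
`j` with a denominator of exact weight. -/
def HasWeightLE (j : ℤ) {n : ℕ} (x : LocTrunc k L n) : Prop :=
  ∃ (i : ℤ) (s a : rees k L), IsExact b w i s ∧ a ∈ weightRees b w (i + j) ∧ loc n s * x = loc n a

theorem hasWeightLE_loc {j : ℤ} {p : rees k L} (hp : p ∈ weightRees b w j) (n : ℕ) :
    HasWeightLE b w j (loc n p) :=
  ⟨0, 1, p, isExact_one, by rwa [zero_add], by rw [map_one, one_mul]⟩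

theorem HasWeightLE.smul {j : ℤ} {n : ℕ} {x : LocTrunc k L n} (hx : HasWeightLE b w j x) (c : k) :
    HasWeightLE b w j (c • x) := by
  obtain ⟨i, s, a, hs, ha, h⟩ := hx
  refine ⟨i, s, c • a, hs, Submodule.smul_mem _ c ha, ?_⟩
  rw [map_smul, ← h]
  exact mul_smul_comm c _ _

theorem exists_loc_pow_mul_eq {p : ℤ} {s : rees k L} (hs : s ∈ weightRees b w p) (n : ℕ) {q : ℤ}
    {c : rees k L} (hc : c ∈ weightRees b w q) :
    ∃ r ∈ weightRees b w ((n - 1) * p + q), loc n (s ^ n * c) = loc n (r * s) := by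
  obtain ⟨r, hr, d, hd⟩ := exists_pow_mul_eq_mul_add hs n hc
  exact ⟨r, hr, by rw [hd, map_add, loc_t_pow_mul, add_zero]⟩

theorem HasWeightLE.mul {i j : ℤ} {n : ℕ} {x y : LocTrunc k L n} (hx : HasWeightLE b w i x)
    (hy : HasWeightLE b w j y) : HasWeightLE b w (i + j) (x * y) := by
  obtain ⟨p, s, a, hs, ha, hx⟩ := hx
  obtain ⟨q, s', a', hs', ha', hy⟩ := hy
  obtain ⟨r, hr, hrs⟩ := exists_loc_pow_mul_eq hs'.1 n ha
  refine ⟨n • q + p, s' ^ n * s, r * a', (hs'.pow n).mul hs,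
    weightRees_mono ?_ (SetLike.mul_mem_graded hr ha'), ?_⟩
  · rw [nsmul_eq_mul]
    linarith
  · calc loc n (s' ^ n * s) * (x * y) = loc n (s' ^ n) * (loc n s * x) * y := by
          rw [map_mul]; simp only [mul_assoc]
      _ = loc n r * (loc n s' * y) := by rw [hx, ← map_mul, hrs, map_mul, mul_assoc]
      _ = loc n (r * a') := by rw [hy, map_mul]

theorem HasWeightLE.add {j : ℤ} {n : ℕ} {x y : LocTrunc k L n} (hx : HasWeightLE b w j x)
    (hy : HasWeightLE b w j y) : HasWeightLE b w j (x + y) := by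
  obtain ⟨p, s, a, hs, ha, hx⟩ := hx
  obtain ⟨q, s', a', hs', ha', hy⟩ := hy
  obtain ⟨r, hr, hrs⟩ := exists_loc_pow_mul_eq hs'.1 n hs.1
  refine ⟨n • q + p, s' ^ n * s, s' ^ n * a + r * a', (hs'.pow n).mul hs, add_mem
    (weightRees_mono ?_ (SetLike.mul_mem_graded (SetLike.pow_mem_graded n hs'.1) ha))
    (weightRees_mono ?_ (SetLike.mul_mem_graded hr ha')), ?_⟩
  · exact (add_assoc _ _ _).ge
  · rw [nsmul_eq_mul]
    linarith
  · calc loc n (s' ^ n * s) * (x + y) = loc n (s' ^ n * s) * x + loc n (r * s') * y := by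
          rw [mul_add, ← hrs]
      _ = loc n (s' ^ n) * (loc n s * x) + loc n r * (loc n s' * y) := by
          simp only [map_mul, mul_assoc]
      _ = loc n (s' ^ n * a + r * a') := by rw [hx, hy, map_add, map_mul, map_mul]

variable (b w) in
/-- The elements of weight at most `j` of the inverse limit: those that are, modulo each `tⁿ`,
fractions of weight at most `j` with a denominator of exact weight. -/
def weightCompletion (j : ℤ) : Submodule k (completion k L) where
  carrier := {x | ∀ n, HasWeightLE b w j (x.1 n)}
  add_mem' hx hy n := (hx n).add (hy n)
  zero_mem' n := by
    have h := hasWeightLE_loc (zero_mem (weightRees b w j)) n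
    rwa [map_zero] at h
  smul_mem' c _ hx n := (hx n).smul c

theorem toCompletion_mem_weightCompletion {j : ℤ} {p : rees k L} (hp : p ∈ weightRees b w j) :
    toCompletion k L p ∈ weightCompletion b w j := fun n => hasWeightLE_loc hp n

theorem mul_mem_weightCompletion {i j : ℤ} {x y : completion k L}
    (hx : x ∈ weightCompletion b w i) (hy : y ∈ weightCompletion b w j) :
    x * y ∈ weightCompletion b w (i + j) := fun n => (hx n).mul (hy n)

theorem t_pow_mul_mem_weightCompletion (m : ℕ) {j : ℤ} {x : completion k L}
    (hx : x ∈ weightCompletion b w j) :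
    toCompletion k L (t k L ^ m) * x ∈ weightCompletion b w j := by
  simpa only [zero_add] using
    mul_mem_weightCompletion (toCompletion_mem_weightCompletion (t_pow_mem_weightRees m)) hx

theorem completionToDivRing_t_pow_mul (m : ℕ) (x : completion k L) :
    completionToDivRing k L (toCompletion k L (t k L ^ m) * x) =
      reesToDivRing k L (t k L) ^ m * completionToDivRing k L x := by
  rw [map_mul, map_pow, map_pow]
  rfl

variable (b w) in
/-- The elements of weight at most `j` of Cohn's division ring, which are the fractions `t⁻ᵐ x`
with `x` of weight at most `j` in the inverse limit. -/
def weightDiv (j : ℤ) : Submodule k (DivRing k L) where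
  carrier := {y | ∃ m : ℕ, ∃ x ∈ weightCompletion b w j,
    reesToDivRing k L (t k L) ^ m * y = completionToDivRing k L x}
  add_mem' := by
    rintro y y' ⟨m, x, hx, h⟩ ⟨m', x', hx', h'⟩
    refine ⟨m' + m, toCompletion k L (t k L ^ m') * x + toCompletion k L (t k L ^ m) * x',
      add_mem (t_pow_mul_mem_weightCompletion m' hx) (t_pow_mul_mem_weightCompletion m hx'), ?_⟩
    rw [map_add, completionToDivRing_t_pow_mul, completionToDivRing_t_pow_mul, ← h, ← h', mul_add,
      ← mul_assoc, ← mul_assoc, ← pow_add, ← pow_add, add_comm m m']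
  zero_mem' := ⟨0, 0, zero_mem _, by rw [mul_zero, map_zero]⟩
  smul_mem' := by
    rintro c y ⟨m, x, hx, h⟩
    exact ⟨m, c • x, Submodule.smul_mem _ c hx, by rw [map_smul, ← h, mul_smul_comm]⟩

theorem completionToDivRing_reesMonomial {n : ℕ} (a : filtration k L n) :
    completionToDivRing k L (toCompletion k L (reesMonomial k L n a)) =
      reesToDivRing k L (t k L) ^ n * embedding k L (a : U) :=
  (reesToDivRing_reesMonomial a).trans ((reesToDivRing_t_commute _).pow_left n).eq.symm

theorem embedding_mem_weightDiv {n : ℕ} {a : U} (ha : a ∈ filtration k L n) {j : ℤ}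
    (h : a ∈ weightU b w j) : embedding k L a ∈ weightDiv b w j :=
  ⟨n, toCompletion k L (reesMonomial k L n ⟨a, ha⟩),
    toCompletion_mem_weightCompletion (reesMonomial_mem_weightRees h),
    (completionToDivRing_reesMonomial ⟨a, ha⟩).symm⟩

instance : SetLike.GradedMonoid (weightDiv b w) where
  one_mem := map_one (embedding k L) ▸
    embedding_mem_weightDiv (one_mem_filtration k L 0) (SetLike.one_mem_graded _)
  mul_mem := by
    rintro i j y y' ⟨m, x, hx, h⟩ ⟨m', x', hx', h'⟩
    refine ⟨m + m', x * x', mul_mem_weightCompletion hx hx', ?_⟩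
    rw [map_mul, ← h, ← h', pow_add, mul_assoc, mul_assoc, ← mul_assoc _ y,
      ((reesToDivRing_t_commute y).pow_left m').eq, mul_assoc]

theorem HasExactWeight.inv_mem_weightDiv {n : ℕ} {j : ℤ} {a : U} (h : HasExactWeight b w n j a)
    {y : DivRing k L} (hy : embedding k L a * y = 1) : y ∈ weightDiv b w (-j) := by
  obtain ⟨v, hv⟩ := isUnit_toCompletion b h.isExact.reesSymbol_ne_zero
  set x := (↑v⁻¹ : completion k L) * toCompletion k L (t k L ^ n) with hx
  have hvx : toCompletion k L (reesMonomial k L n ⟨a, h.mem_filtration⟩) * x =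
      toCompletion k L (t k L ^ n) := by
    rw [hx, ← hv, Units.mul_inv_cancel_left]
  refine ⟨0, x,
    fun m => ⟨j, _, t k L ^ n, h.isExact, ?_, congrFun (congrArg Subtype.val hvx) m⟩, ?_⟩
  · rw [add_neg_cancel]
    exact t_pow_mem_weightRees n
  · have hty : completionToDivRing k L (toCompletion k L (t k L ^ n)) =
        completionToDivRing k L v * y := by
      rw [hv, completionToDivRing_reesMonomial, mul_assoc, hy, ← map_one (completionToDivRing k L),
        ← completionToDivRing_t_pow_mul, mul_one]
    rw [pow_zero, one_mul, hx, map_mul, hty, ← mul_assoc, ← map_mul, Units.inv_mul, map_one,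
      one_mul]

theorem one_notMem_weightDiv : (1 : DivRing k L) ∉ weightDiv b w (-1) := by
  rintro ⟨m, x, hx, h⟩
  have hx_eq : toCompletion k L (t k L ^ m) = x := by
    refine completionToDivRing_injective b ?_
    rw [← h, ← map_one (completionToDivRing k L), ← completionToDivRing_t_pow_mul, mul_one]
  obtain ⟨i, s, a, hs, ha, hsa⟩ := hx (m + 1)
  have hloc : loc (m + 1) (s * t k L ^ m - a) = 0 := by
    rw [map_sub, map_mul, ← hsa, ← hx_eq]
    exact sub_self _
  obtain ⟨c, hc⟩ := (loc_eq_zero_iff b).1 hloc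
  have hcomm : s * t k L ^ m = t k L ^ m * s :=
    ((show Commute (t k L) s from t_central k L s).pow_left m).eq.symm
  have hdiff : s - t k L * c ∈ weightRees b w (i - 1) := by
    refine mem_weightRees_of_t_pow_mul (n := m) ?_
    rwa [mul_sub, ← mul_assoc, ← pow_succ, ← hc, hcomm, sub_sub_cancel]
  have hsymbol := reesSymbol_mem_weightLE hdiff
  rw [map_sub, map_mul, reesSymbol_t, zero_mul, sub_zero] at hsymbol
  exact hs.2 hsymbol

end DivRingWeights

end Cohn

namespace SkewFree

open Polynomial

section RationalFunctions

variable {k : Type*} [Field k]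

local notation "K" => FractionRing k[X]

variable (k) in
/-- The automorphism `X ↦ X - 1` of the field of rational functions. -/
def shift : K →ₐ[k] K :=
  IsFractionRing.liftAlgHom (g := (IsScalarTower.toAlgHom k k[X] K).comp (taylorAlgHom (-1)))
    ((IsFractionRing.injective k[X] K).comp (taylor_injective (-1)))

theorem shift_algebraMap (p : k[X]) :
    shift k (algebraMap k[X] K p) = algebraMap k[X] K (taylor (-1) p) :=
  IsLocalization.lift_eq _ p

theorem shift_X : shift k (algebraMap k[X] K X) = algebraMap k[X] K X - 1 := by
  rw [shift_algebraMap, taylor_X, map_add, C_neg, map_neg, C_1, map_one, sub_eq_add_neg]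

theorem exists_mul_algebraMap_eq (f : K) :
    ∃ p q : k[X], q ≠ 0 ∧ f * algebraMap k[X] K q = algebraMap k[X] K p := by
  obtain ⟨p, q, hq, rfl⟩ := IsFractionRing.div_surjective (A := k[X]) f
  have hq0 : q ≠ 0 := nonZeroDivisors.ne_zero hq
  exact ⟨p, q, hq0, div_mul_cancel₀ _ (by rwa [Ne, IsFractionRing.to_map_eq_zero_iff])⟩

/-- The graph of evaluation at `a`: the pairs `(f, c)` where `f` is a rational function without a
pole at `a` whose value there is `c`. -/
def valueGraph (a : k) : Subalgebra k (K × k) where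
  carrier := {x | ∃ p q : k[X], q.eval a ≠ 0 ∧
    x.1 * algebraMap k[X] K q = algebraMap k[X] K p ∧ p.eval a = x.2 * q.eval a}
  mul_mem' := by
    rintro ⟨f, c⟩ ⟨g, d⟩ ⟨p, q, hq, hf, hc⟩ ⟨p', q', hq', hg, hd⟩
    refine ⟨p * p', q * q', by rw [eval_mul]; exact mul_ne_zero hq hq', ?_, ?_⟩
    · rw [map_mul, map_mul, ← hf, ← hg, Prod.fst_mul]; ring
    · rw [eval_mul, eval_mul, hc, hd, Prod.snd_mul]; ring
  add_mem' := by
    rintro ⟨f, c⟩ ⟨g, d⟩ ⟨p, q, hq, hf, hc⟩ ⟨p', q', hq', hg, hd⟩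
    refine ⟨p * q' + p' * q, q * q', by rw [eval_mul]; exact mul_ne_zero hq hq', ?_, ?_⟩
    · rw [map_add, map_mul, map_mul, map_mul, ← hf, ← hg, Prod.fst_add]; ring
    · rw [eval_add, eval_mul, eval_mul, eval_mul, hc, hd, Prod.snd_add]; ring
  algebraMap_mem' c := ⟨C c, 1, by simp, by simp [IsScalarTower.algebraMap_apply k k[X] K],
    by simp⟩

theorem eval_eq_of_mem_valueGraph {a c : k} {f : K} (h : (f, c) ∈ valueGraph a) {p q : k[X]}
    (hf : f * algebraMap k[X] K q = algebraMap k[X] K p) : p.eval a = c * q.eval a := by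
  obtain ⟨p', q', hq', hf', hc⟩ := h
  have hcross : p * q' = p' * q := IsFractionRing.injective k[X] K <| by
    rw [map_mul, map_mul, ← hf, ← hf']; ring
  refine mul_right_cancel₀ hq' ?_
  rw [← eval_mul, hcross, eval_mul, hc]
  ring

theorem eq_of_mem_valueGraph {a c d : k} {f : K} (hc : (f, c) ∈ valueGraph a)
    (hd : (f, d) ∈ valueGraph a) : c = d := by
  obtain ⟨p, q, hq, hf, hp⟩ := hd
  exact mul_right_cancel₀ hq ((eval_eq_of_mem_valueGraph hc hf).symm.trans hp)

theorem mem_valueGraph_of_mul_eq {a : k} {f : K} {p q : k[X]} (hq : q.eval a ≠ 0)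
    (hf : f * algebraMap k[X] K q = algebraMap k[X] K p) :
    (f, p.eval a / q.eval a) ∈ valueGraph a :=
  ⟨p, q, hq, hf, (div_mul_cancel₀ _ hq).symm⟩

theorem div_mem_valueGraph {a : k} (p : k[X]) {q : k[X]} (hq : q.eval a ≠ 0) :
    (algebraMap k[X] K p / algebraMap k[X] K q, p.eval a / q.eval a) ∈ valueGraph a := by
  refine mem_valueGraph_of_mul_eq hq (div_mul_cancel₀ _ ?_)
  rw [Ne, IsFractionRing.to_map_eq_zero_iff]
  rintro rfl
  exact hq eval_zero

theorem shift_mem_valueGraph_iff {a c : k} {f : K} :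
    (shift k f, c) ∈ valueGraph (a + 1) ↔ (f, c) ∈ valueGraph a := by
  have hcancel (p : k[X]) : taylor (-1) (taylor 1 p) = p := by rw [taylor_taylor]; simp
  have heval (p : k[X]) : (taylor (-1) p).eval (a + 1) = p.eval a := by
    rw [taylor_eval, add_neg_cancel_right]
  constructor
  · rintro ⟨p, q, hq, hf, hc⟩
    refine ⟨taylor 1 p, taylor 1 q, by rwa [taylor_eval], (shift k : K →+* K).injective ?_,
      by rwa [taylor_eval, taylor_eval]⟩
    simpa [shift_algebraMap, hcancel] using hf
  · rintro ⟨p, q, hq, hf, hc⟩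
    refine ⟨taylor (-1) p, taylor (-1) q, by rwa [heval], ?_, by rwa [heval, heval]⟩
    rw [← shift_algebraMap, ← shift_algebraMap, ← hf, map_mul]

theorem eq_algebraMap_of_infinite {f : K} {c : k} (h : {a | (f, c) ∈ valueGraph a}.Infinite) :
    f = algebraMap k K c := by
  obtain ⟨p, q, hq, hf⟩ := exists_mul_algebraMap_eq f
  have hp : p - C c * q = 0 := eq_zero_of_infinite_isRoot _ <| h.mono fun a ha => by
    simp only [Set.mem_ofPred_eq, IsRoot, eval_sub, eval_mul, eval_C]
    rw [eval_eq_of_mem_valueGraph ha hf, sub_self]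
  refine mul_right_cancel₀ (b := algebraMap k[X] K q)
    (by rwa [Ne, IsFractionRing.to_map_eq_zero_iff]) ?_
  rw [hf, sub_eq_zero.1 hp, map_mul, IsScalarTower.algebraMap_apply k k[X] K,
    Polynomial.algebraMap_eq]

/-- The algebra of rational functions without a pole at `a`. -/
def regularAt (a : k) : Subalgebra k K :=
  (valueGraph a).map (AlgHom.fst k K k)

theorem mem_regularAt {a : k} {f : K} : f ∈ regularAt a ↔ ∃ c, (f, c) ∈ valueGraph a := by
  simp [regularAt, Subalgebra.mem_map]

theorem shift_mem_regularAt_iff {a : k} {f : K} :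
    shift k f ∈ regularAt (a + 1) ↔ f ∈ regularAt a := by
  simp only [mem_regularAt, shift_mem_valueGraph_iff]

theorem finite_poles (f : K) : {a | f ∉ regularAt a}.Finite := by
  classical
  obtain ⟨p, q, hq, hf⟩ := exists_mul_algebraMap_eq f
  refine q.roots.toFinset.finite_toSet.subset fun a ha => ?_
  rw [Finset.mem_coe, Multiset.mem_toFinset, mem_roots hq]
  by_contra hroot
  exact ha (mem_regularAt.2 ⟨_, mem_valueGraph_of_mul_eq hroot hf⟩)

section CharZero

variable [CharZero k]

theorem mem_range_algebraMap_of_shift_shift {f : K} (h : shift k (shift k f) = f) :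
    f ∈ (algebraMap k K).range := by
  obtain ⟨a, ha⟩ := (finite_poles f).exists_notMem
  obtain ⟨c, hc⟩ := mem_regularAt.1 (not_not.1 ha)
  have horbit (j : ℕ) : (f, c) ∈ valueGraph (a + 2 * j) := by
    induction j with
    | zero => simpa using hc
    | succ j ih =>
      have := shift_mem_valueGraph_iff.2 (shift_mem_valueGraph_iff.2 ih)
      rw [h] at this
      convert this using 2
      push_cast
      ring
  refine ⟨c, (eq_algebraMap_of_infinite (Set.infinite_of_injective_forall_mem
    (f := fun j : ℕ => a + 2 * (j : k)) (fun i j hij => ?_) horbit)).symm⟩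
  simpa using hij

theorem mem_range_algebraMap_of_shift_eq {f : K} (h : shift k f = f) :
    f ∈ (algebraMap k K).range :=
  mem_range_algebraMap_of_shift_shift (by rw [h, h])

theorem eq_zero_of_shift_eq_neg {f : K} (h : shift k f = -f) : f = 0 := by
  obtain ⟨c, rfl⟩ := mem_range_algebraMap_of_shift_shift (f := f) (by rw [h, map_neg, h, neg_neg])
  exact self_eq_neg.1 (((shift k).commutes c).symm.trans h)

theorem eq_empty_of_forall_mem_iff_sub_one_mem {S : Set ℤ} (hS : S.Finite)
    (h : ∀ j ≠ 0, j ∈ S ↔ j - 1 ∈ S) : S = ∅ := by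
  refine Set.eq_empty_of_forall_notMem fun j hj => ?_
  rcases le_or_gt 0 j with hj0 | hj0
  · refine Set.infinite_of_injective_forall_mem (f := fun n : ℕ => j + n)
      (fun m n hmn => by simpa using hmn) (fun n => ?_) hS
    induction n with
    | zero => simpa using hj
    | succ n ih => exact (h _ (by omega)).2 (by simpa [add_sub_assoc] using ih)
  · refine Set.infinite_of_injective_forall_mem (f := fun n : ℕ => j - n)
      (fun m n hmn => by simpa using hmn) (fun n => ?_) hS
    induction n with
    | zero => simpa using hj
    | succ n ih => simpa [sub_sub] using (h _ (by omega)).1 ih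

/-- The poles of `g` in the orbit of `a` under translation form a finite set, so if they cancel
in `g + shift g` away from `a` there are none. -/
theorem add_shift_mem_regularAt {g : K} {a : k}
    (h : ∀ j : ℤ, j ≠ 0 → g + shift k g ∈ regularAt (a + j)) : g + shift k g ∈ regularAt a := by
  have hshift (j : ℤ) : shift k g ∈ regularAt (a + j) ↔ g ∈ regularAt (a + (j - 1 : ℤ)) := by
    rw [← shift_mem_regularAt_iff (f := g)]
    push_cast
    rw [add_assoc, sub_add_cancel]
  have hpoles : {j : ℤ | g ∉ regularAt (a + j)} = ∅ := by
    refine eq_empty_of_forall_mem_iff_sub_one_mem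
      ((finite_poles g).preimage fun i _ j _ hij => by simpa using hij) fun j hj => ?_
    refine not_congr (Iff.trans ?_ (hshift j))
    exact ⟨fun hg => by simpa using sub_mem (h j hj) hg,
      fun hg => by simpa using sub_mem (h j hj) hg⟩
  have hg (j : ℤ) : g ∈ regularAt (a + j) := by
    by_contra hj
    exact Set.eq_empty_iff_forall_notMem.1 hpoles j hj
  simpa using add_mem (hg 0) ((hshift 0).2 (hg _))

end CharZero

theorem coeff_eq_zero_of_linearCombination_zpow_mem {a : k} {v : K} (hv : (v, 0) ∈ valueGraph a)
    (hv0 : v ≠ 0) {c : ℤ →₀ k}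
    (h : Finsupp.linearCombination k (fun n => v ^ n) c ∈ regularAt a) {n : ℤ} (hn : n < 0) :
    c n = 0 := by
  by_contra hcn
  have hne : c.support.Nonempty := ⟨n, Finsupp.mem_support_iff.2 hcn⟩
  set N := c.support.min' hne
  have hle {m : ℤ} (hm : m ∈ c.support) : N ≤ m := Finset.min'_le _ _ hm
  have hN : N < 0 := (hle (Finsupp.mem_support_iff.2 hcn)).trans_lt hn
  have hpow (i : ℤ) (hi : 0 ≤ i) : (v ^ i, if i = 0 then 1 else 0) ∈ valueGraph a := by
    lift i to ℕ using hi
    simpa [Prod.pow_def, zero_pow_eq] using pow_mem hv i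
  have hsum : (v ^ (-N) * Finsupp.linearCombination k (fun n => v ^ n) c, c N) ∈ valueGraph a := by
    have hterm := sum_mem (t := c.support) fun m hm =>
      (valueGraph a).smul_mem (hpow (m - N) (sub_nonneg.2 (hle hm))) (c m)
    convert hterm using 1
    simp only [Prod.smul_mk, sub_eq_zero]
    refine Prod.ext ?_ ?_
    · rw [Prod.fst_sum, Finsupp.linearCombination_apply, Finsupp.sum, Finset.mul_sum]
      refine Finset.sum_congr rfl fun m _ => ?_
      rw [mul_smul_comm, ← zpow_add₀ hv0, neg_add_eq_sub]
    · simp [Prod.snd_sum, N, c.support.min'_mem hne]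
  obtain ⟨d, hd⟩ := mem_regularAt.1 h
  have hzero := mul_mem (hpow (-N) (by omega)) hd
  rw [Prod.mk_mul_mk, if_neg (by omega), zero_mul] at hzero
  exact Finsupp.mem_support_iff.1 (Finset.min'_mem _ hne) (eq_of_mem_valueGraph hsum hzero)

variable (k) in
/-- The rational function `X / (X - 1/2)`, whose zero and pole lie in different orbits of the
shift. -/
def ratio : K := algebraMap k[X] K X / algebraMap k[X] K (X - C (1 / 2 : k))

theorem ratio_ne_zero : ratio k ≠ 0 := by
  refine div_ne_zero ?_ ?_ <;> rw [Ne, IsFractionRing.to_map_eq_zero_iff]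
  exacts [X_ne_zero, X_sub_C_ne_zero _]

theorem ratio_mem_valueGraph {a : k} (ha : a ≠ 1 / 2) :
    (ratio k, a / (a - 1 / 2)) ∈ valueGraph a := by
  have h := div_mem_valueGraph (X : k[X]) (q := X - C (1 / 2 : k)) (a := a)
    (by simpa [sub_eq_zero] using ha)
  rwa [eval_sub, eval_X, eval_C] at h

theorem ratio_inv_mem_valueGraph {a : k} (ha : a ≠ 0) :
    ((ratio k)⁻¹, (a - 1 / 2) / a) ∈ valueGraph a := by
  rw [ratio, inv_div]
  have h := div_mem_valueGraph (X - C (1 / 2 : k)) (q := X) (a := a) (by simpa using ha)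
  rwa [eval_sub, eval_X, eval_C] at h

theorem ratio_zpow_mem_regularAt {a : k} (h0 : a ≠ 0) (h1 : a ≠ 1 / 2) (n : ℤ) :
    ratio k ^ n ∈ regularAt a := by
  cases n with
  | ofNat n =>
    simpa using pow_mem (mem_regularAt.2 ⟨_, ratio_mem_valueGraph h1⟩) n
  | negSucc n =>
    rw [zpow_negSucc, ← inv_pow]
    exact pow_mem (mem_regularAt.2 ⟨_, ratio_inv_mem_valueGraph h0⟩) _

theorem linearCombination_ratio_mem_regularAt {a : k} (h0 : a ≠ 0) (h1 : a ≠ 1 / 2)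
    (c : ℤ →₀ k) : Finsupp.linearCombination k (fun n => ratio k ^ n) c ∈ regularAt a :=
  sum_mem fun n _ => (regularAt a).smul_mem (ratio_zpow_mem_regularAt h0 h1 n) _

variable [CharZero k]

theorem intCast_ne_half (j : ℤ) : (j : k) ≠ 1 / 2 := by
  intro h
  have h2 : ((2 * j : ℤ) : k) = (1 : ℤ) := by push_cast; rw [h]; norm_num
  have := Int.cast_injective h2
  omega

theorem coeff_eq_zero_of_add_shift_eq {c : ℤ →₀ k} {g : K}
    (hg : g + shift k g = Finsupp.linearCombination k (fun n => ratio k ^ n) c) {n : ℤ}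
    (hn : n ≠ 0) : c n = 0 := by
  have hzero : g + shift k g ∈ regularAt (0 : k) := add_shift_mem_regularAt fun j hj => by
    rw [hg, zero_add]
    exact linearCombination_ratio_mem_regularAt (by exact_mod_cast hj) (intCast_ne_half j) c
  have hhalf : g + shift k g ∈ regularAt (1 / 2 : k) := add_shift_mem_regularAt fun j hj => by
    rw [hg]
    refine linearCombination_ratio_mem_regularAt (fun h => intCast_ne_half (k := k) (-j) ?_)
      (by simpa using hj) c
    push_cast
    linear_combination -h
  rcases lt_or_gt_of_ne hn with hneg | hpos
  · refine coeff_eq_zero_of_linearCombination_zpow_mem ?_ ratio_ne_zero (hg ▸ hzero) hneg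
    simpa using ratio_mem_valueGraph (a := (0 : k)) (by norm_num)
  · have hinv : Finsupp.linearCombination k (fun n => (ratio k)⁻¹ ^ n) (c.mapDomain Neg.neg) =
        g + shift k g := by
      rw [hg, Finsupp.linearCombination_mapDomain]
      simp only [Function.comp_def, inv_zpow', neg_neg]
    have := coeff_eq_zero_of_linearCombination_zpow_mem (a := (1 / 2 : k))
      (by simpa using ratio_inv_mem_valueGraph (a := (1 / 2 : k)) (by norm_num))
      (inv_ne_zero ratio_ne_zero) (hinv ▸ hhalf) (neg_lt_zero.2 hpos)
    rwa [Finsupp.mapDomain_apply neg_injective] at this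

theorem linearIndependent_ratio_zpow : LinearIndependent k fun n : ℤ => ratio k ^ n := by
  refine linearIndependent_iff.2 fun c hc => ?_
  have hc0 {n : ℤ} (hn : n ≠ 0) : c n = 0 :=
    coeff_eq_zero_of_add_shift_eq (g := 0) (by rw [map_zero, add_zero, hc]) hn
  have hsingle : c = Finsupp.single 0 (c 0) := by
    ext n
    by_cases hn : n = 0
    · rw [hn, Finsupp.single_eq_same]
    · rw [hc0 hn, Finsupp.single_eq_of_ne hn]
  rw [hsingle, Finsupp.linearCombination_single, zpow_zero, smul_eq_zero,
    or_iff_left one_ne_zero] at hc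
  rw [hsingle, hc, Finsupp.single_zero]

end RationalFunctions

section Eigenvectors

variable {k K M ι : Type*} [Field k] [Field K] [Algebra k K] [AddCommGroup M] [Module k M]
  [Module K M] [IsScalarTower k K M] {σ : K →+* K} {T : M →ₛₗ[σ] M} {ε : ι → ℤˣ} {e : ι → M}

/-- The coordinates of `T x` in a family of eigenvectors `e i`, with eigenvalues `ε i`, of a
`σ`-semilinear map `T`, where `f` are coordinates of `x`. -/
def twist (σ : K →+* K) (ε : ι → ℤˣ) (f : ι →₀ K) : ι →₀ K :=
  Finsupp.onFinset f.support (fun i => ε i • σ (f i)) fun i h => by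
    rw [Finsupp.mem_support_iff]
    rintro h0
    exact h (by rw [h0, map_zero, smul_zero])

theorem twist_apply (f : ι →₀ K) (i : ι) : twist σ ε f i = ε i • σ (f i) := rfl

theorem map_linearCombination_eigenvectors (hT : ∀ i, T (e i) = ε i • e i) (f : ι →₀ K) :
    T (Finsupp.linearCombination K e f) = Finsupp.linearCombination K e (twist σ ε f) := by
  rw [Finsupp.linearCombination_apply, Finsupp.linearCombination_apply, twist,
    Finsupp.onFinset_sum (g := fun i a => a • e i) _ fun _ => zero_smul _ _, Finsupp.sum, map_sum]
  refine Finset.sum_congr rfl fun i _ => ?_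
  rw [map_smulₛₗ, hT, smul_comm, smul_assoc]

theorem eq_zero_of_linearCombination_eq_zero {f : ι →₀ K} (he : LinearIndepOn k e f.support)
    (hf : ∀ i, f i ∈ (algebraMap k K).range) (h : Finsupp.linearCombination K e f = 0) :
    f = 0 := by
  choose c hc using hf
  let g : ι →₀ k := Finsupp.onFinset f.support c fun i hi => by
    rw [Finsupp.mem_support_iff, ← hc]
    exact (_root_.map_ne_zero _).2 hi
  have hg : g = 0 := by
    refine linearIndepOn_iff.1 he g ?_ ?_
    · exact (Finsupp.mem_supported k g).2 (by exact_mod_cast Finsupp.support_onFinset_subset)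
    · rw [← h, Finsupp.linearCombination_apply, Finsupp.linearCombination_apply]
      refine (Finsupp.onFinset_sum (g := fun i a => a • e i) _ fun _ => zero_smul _ _).trans
        (Finset.sum_congr rfl fun i _ => ?_)
      rw [← hc]
      exact (algebraMap_smul K (c i) (e i)).symm
  ext i
  rw [← hc, show c i = 0 from DFunLike.congr_fun hg i, map_zero, Finsupp.zero_apply]

/-- In a shortest relation, normalized to have a coefficient `1`, the other coefficients are fixed
or negated by `σ`, according to their eigenvalues, because `T` maps it to a multiple of itself. -/
theorem linearIndependent_of_eigenvectors (hfix : ∀ f, σ f = f → f ∈ (algebraMap k K).range)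
    (hneg : ∀ f, σ f = -f → f = 0) (hT : ∀ i, T (e i) = ε i • e i)
    (he : ∀ δ, LinearIndepOn k e {i | ε i = δ}) : LinearIndependent K e := by
  refine linearIndependent_iff.2 fun f hf => ?_
  induction hn : f.support.card using Nat.strong_induction_on generalizing f with
  | _ n ih =>
  subst hn
  by_contra hne
  obtain ⟨i₀, hi₀⟩ := Finsupp.ne_iff.1 hne
  set g : ι →₀ K := (f i₀)⁻¹ • f with hg_def
  have hg : Finsupp.linearCombination K e g = 0 := by rw [map_smul, hf, smul_zero]
  have hg₀ : g i₀ = 1 := inv_mul_cancel₀ hi₀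
  have htwist : ε i₀ • twist σ ε g - g = 0 := by
    refine ih _ (Finset.card_lt_card ?_) _ ?_ rfl
    · refine Finset.ssubset_iff_subset_ne.2 ⟨fun i hi => ?_, fun heq => ?_⟩
      · contrapose! hi
        simp [twist_apply, hg_def, Finsupp.notMem_support_iff.1 hi]
      · have := heq ▸ Finsupp.mem_support_iff.2 hi₀
        simp [twist_apply, hg₀, smul_smul] at this
    · rw [map_sub, hg, sub_zero, Units.smul_def, map_zsmul, ← map_linearCombination_eigenvectors hT,
        hg, map_zero, smul_zero]
  have hσ (i : ι) : ε i₀ • ε i • σ (g i) = g i := sub_eq_zero.1 (DFunLike.congr_fun htwist i)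
  have hsupport {i : ι} (hi : i ∈ g.support) : ε i = ε i₀ := by
    by_contra hεi
    have hσi := hσ i
    rw [Int.units_ne_iff_eq_neg.1 hεi, smul_smul, mul_neg, Int.units_mul_self, Units.neg_smul,
      one_smul] at hσi
    exact Finsupp.mem_support_iff.1 hi (hneg _ (neg_eq_iff_eq_neg.1 hσi))
  have hg_range (i : ι) : g i ∈ (algebraMap k K).range := by
    by_cases hi : i ∈ g.support
    · refine hfix _ ?_
      conv_rhs => rw [← hσ i, hsupport hi, smul_smul, Int.units_mul_self, one_smul]
    · rw [Finsupp.notMem_support_iff.1 hi]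
      exact zero_mem _
  have hg_zero := eq_zero_of_linearCombination_eq_zero ((he (ε i₀)).mono fun i hi => hsupport hi)
    hg_range hg
  rw [hg_zero] at hg₀
  exact zero_ne_one hg₀

theorem exists_add_map_eq (hT : ∀ i, T (e i) = ε i • e i) (he : LinearIndependent K e) {y : M}
    (hy : y ∈ Submodule.span K (Set.range e)) {δ : ℤˣ} {F : ι →₀ K}
    (h : y - δ • T y = Finsupp.linearCombination K e F) {i : ι} (hi : ε i = -δ) :
    ∃ g, g + σ g = F i := by
  obtain ⟨f, rfl⟩ := Finsupp.mem_span_range_iff_exists_finsupp.1 hy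
  rw [← Finsupp.linearCombination_apply, map_linearCombination_eigenvectors hT, Units.smul_def,
    ← map_zsmul, ← map_sub] at h
  have hfi := DFunLike.congr_fun (he h) i
  rw [Finsupp.sub_apply, Finsupp.smul_apply, ← Units.smul_def, twist_apply, hi, smul_smul, mul_neg,
    Int.units_mul_self, Units.neg_smul, one_smul, sub_neg_eq_add] at hfi
  exact ⟨f i, hfi⟩

end Eigenvectors

/-- The coordinates of `y` satisfy a recursion which shows that they all vanish or all do not. -/
theorem eq_zero_of_sub_smul_map_eq {K M : Type*} [Field K] [AddCommGroup M] [Module K M]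
    {σ : K →+* K} {T : M →ₛₗ[σ] M} {e : ℕ → M} (he : LinearIndependent K e)
    (hT : ∀ i, T (e i) = e (i + 1)) {y : M} (hy : y ∈ Submodule.span K (Set.range e)) {δ : ℤˣ}
    {G : K} (h : y - δ • T y = G • e 0) : G = 0 := by
  obtain ⟨c, rfl⟩ := Finsupp.mem_span_range_iff_exists_finsupp.1 hy
  rw [← Finsupp.linearCombination_apply] at h
  have hmap : T (Finsupp.linearCombination K e c) = Finsupp.linearCombination K e
      ((c.mapRange σ (map_zero _)).mapDomain Nat.succ) := by
    rw [Finsupp.linearCombination_mapDomain, Finsupp.linearCombination_apply,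
      Finsupp.linearCombination_apply, Finsupp.sum_mapRange_index, map_finsuppSum]
    · simp only [map_smulₛₗ, hT, Function.comp_apply]
    · exact fun _ => zero_smul _ _
  have hcoeff : c - δ • (c.mapRange σ (map_zero _)).mapDomain Nat.succ = Finsupp.single 0 G := by
    refine he ?_
    rw [map_sub, Units.smul_def, map_zsmul, ← hmap, ← Units.smul_def, h,
      Finsupp.linearCombination_single]
  by_contra hne
  have hc (i : ℕ) : c i ≠ 0 := by
    induction i with
    | zero =>
      have := DFunLike.congr_fun hcoeff 0
      rw [Finsupp.sub_apply, Finsupp.smul_apply, Finsupp.mapDomain_of_notMem_range _ _ (by simp),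
        smul_zero, sub_zero, Finsupp.single_eq_same] at this
      rwa [this]
    | succ i ih =>
      have := DFunLike.congr_fun hcoeff i.succ
      rw [Finsupp.sub_apply, Finsupp.smul_apply, Finsupp.mapDomain_apply Nat.succ_injective,
        Finsupp.mapRange_apply, Finsupp.single_eq_of_ne i.succ_ne_zero, sub_eq_zero] at this
      rw [← Nat.succ_eq_add_one, this, Ne, smul_eq_zero_iff_eq]
      exact (_root_.map_ne_zero _).2 ih
  obtain ⟨i, hi⟩ := Infinite.exists_notMem_finset c.support
  exact hi (Finsupp.mem_support_iff.2 (hc i))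

theorem linearIndependent_mkQ_sigma {K M : Type*} {ι : ℕ → Type*} [Ring K] [AddCommGroup M]
    [Module K M] {W : ℕ → Submodule K M} (hW : Monotone W) {v : (Σ m, ι m) → M}
    (hv : ∀ s, v s ∈ W (s.1 + 1))
    (hindep : ∀ m, LinearIndependent K fun i : ι m => (W m).mkQ (v ⟨m, i⟩)) :
    LinearIndependent K fun s => (W 0).mkQ (v s) := by
  refine linearIndependent_iff.2 fun l hl => ?_
  by_contra hne
  have hsplit : l.splitSupport.Nonempty := by
    obtain ⟨s, hs⟩ := Finsupp.ne_iff.1 hne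
    exact ⟨s.1, (Finsupp.mem_splitSupport_iff_nonzero l s.1).2 fun h => hs <| by
      rw [← Finsupp.split_apply l, h]; rfl⟩
  set n := l.splitSupport.max' hsplit
  have hl0 : Finsupp.linearCombination K v l ∈ W 0 := by
    rw [← Submodule.Quotient.mk_eq_zero, ← hl]
    exact Finsupp.apply_linearCombination K (W 0).mkQ v l
  have hln : (W n).mkQ (Finsupp.linearCombination K v l) =
      Finsupp.linearCombination K (fun i => (W n).mkQ (v ⟨n, i⟩)) (l.split n) := by
    rw [Finsupp.apply_linearCombination, Finsupp.linearCombination_apply, Finsupp.sigma_sum,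
      Finset.sum_eq_single_of_mem n (Finset.max'_mem _ hsplit)]
    · rfl
    · intro m hm hmn
      have hlt : m < n := lt_of_le_of_ne (Finset.le_max' _ _ hm) hmn
      refine Finset.sum_eq_zero fun i _ => ?_
      simp only [Function.comp_apply, Submodule.mkQ_apply]
      rw [(Submodule.Quotient.mk_eq_zero _).2 (hW (Nat.succ_le_of_lt hlt) (hv ⟨m, i⟩)), smul_zero]
  rw [Submodule.mkQ_apply, (Submodule.Quotient.mk_eq_zero _).2 (hW (Nat.zero_le n) hl0)] at hln
  exact (Finsupp.mem_splitSupport_iff_nonzero l n).1 (Finset.max'_mem _ hsplit)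
    (linearIndependent_iff.1 (hindep n) _ hln.symm)

/-- Sequences of `m + 1` integers, all but the first of which are nonzero. -/
def Exponents : ℕ → Type
  | 0 => ℤ
  | m + 1 => Exponents m × {n : ℤ // n ≠ 0}

section Words

variable {k E : Type*} [Field k] [Ring E] [Module (FractionRing k[X]) E]

local notation "K" => FractionRing k[X]

/-- `P` acts on the vector space `E` as a `shift`-semilinear map, and `η δ` is its Cayley transform
`(1 + δP)/(1 - δP)`, for both signs `δ`. -/
structure IsCayley (P : E) (η : ℤˣ → E) : Prop where
  mul_smul (f : K) (x : E) : P * f • x = shift k f • (P * x)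
  cayley (δ : ℤˣ) : (1 - δ • P) * (η δ + 1) = 2

/-- The product `η δ * u ^ nₘ * η (-δ) * u ^ nₘ₋₁ * ⋯ * u ^ n₀` for the exponents `n₀, …, nₘ`, where
`u` is the rational function `X / (X - 1/2)`. -/
def wordVal (η : ℤˣ → E) : ∀ m, ℤˣ → Exponents m → E
  | 0, δ, n => η δ * (ratio k ^ (show ℤ from n) • 1)
  | m + 1, δ, v => η δ * (ratio k ^ v.2.1 • wordVal η m (-δ) v.1)

variable (k) in
/-- The span of the powers of `P` and of the words with at most `m` exponents. -/
def wordSpan (P : E) (η : ℤˣ → E) : ℕ → Submodule K E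
  | 0 => Submodule.span K (Set.range fun i : ℕ => P ^ i)
  | m + 1 => wordSpan P η m ⊔
      Submodule.span K (Set.range fun i : ℤˣ × Exponents m => wordVal (k := k) η m i.1 i.2)

theorem wordVal_mem_wordSpan {P : E} {η : ℤˣ → E} {m : ℕ} (δ : ℤˣ) (v : Exponents m) :
    wordVal (k := k) η m δ v ∈ wordSpan k P η (m + 1) :=
  Submodule.mem_sup_right (Submodule.subset_span ⟨(δ, v), rfl⟩)

variable (k) in
theorem exists_wordVal_eq_mul (P : E) (η : ℤˣ → E) {m : ℕ} (δ : ℤˣ) (v : Exponents m) :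
    ∃ y ∈ wordSpan k P η m, wordVal (k := k) η m δ v = η δ * y := by
  cases m with
  | zero => exact ⟨_, Submodule.smul_mem _ _ (Submodule.subset_span ⟨0, pow_zero P⟩), rfl⟩
  | succ m => exact ⟨_, Submodule.smul_mem _ _ (wordVal_mem_wordSpan _ _), rfl⟩

theorem linearCombination_mul_smul_wordVal [Algebra k E] [IsScalarTower k K E] (η : ℤˣ → E)
    {m : ℕ} (δ : ℤˣ) (c : Exponents m × {n : ℤ // n ≠ 0} →₀ k) :
    Finsupp.linearCombination k
        (fun v => η δ * (ratio k ^ v.2.1 • wordVal (k := k) η m (-δ) v.1)) c =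
      η δ * Finsupp.linearCombination K (wordVal (k := k) η m (-δ)) (c.curry.mapRange
        (Finsupp.linearCombination k fun n : {n : ℤ // n ≠ 0} => ratio k ^ n.1) (map_zero _)) := by
  induction c using Finsupp.induction_linear with
  | zero =>
    rw [map_zero, show Finsupp.curry (0 : Exponents m × {n : ℤ // n ≠ 0} →₀ k) = 0 from rfl,
      Finsupp.mapRange_zero, map_zero, mul_zero]
  | add c d hc hd =>
    rw [map_add, hc, hd, ← mul_add, ← map_add, ← Finsupp.mapRange_add (map_add _),
      show (c + d).curry = c.curry + d.curry from Finsupp.ext fun _ => Finsupp.ext fun _ => rfl]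
  | single v r =>
    rw [Finsupp.curry_single, Finsupp.mapRange_single, Finsupp.linearCombination_single,
      Finsupp.linearCombination_single, Finsupp.linearCombination_single, smul_assoc]
    exact (mul_smul_comm r _ _).symm

theorem wordSpan_mono (P : E) (η : ℤˣ → E) : Monotone (wordSpan k P η) :=
  monotone_nat_of_le_succ fun _ => le_sup_left

theorem one_mem_wordSpan (P : E) (η : ℤˣ → E) (m : ℕ) : (1 : E) ∈ wordSpan k P η m :=
  wordSpan_mono P η (Nat.zero_le m) (Submodule.subset_span ⟨0, pow_zero P⟩)

namespace IsCayley

variable {P : E} {η : ℤˣ → E} (h : IsCayley (k := k) P η)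

/-- Multiplication by `P` as a `shift`-semilinear map. -/
def mulLeft : E →ₛₗ[(shift k).toRingHom] E where
  toFun x := P * x
  map_add' := mul_add P
  map_smul' := h.mul_smul

include h

theorem add_sub_smul_mul (δ : ℤˣ) (y : E) :
    η δ * y + y - δ • (P * (η δ * y + y)) = (2 : K) • y := by
  have := congrArg (· * y) (h.cayley δ)
  simp only [sub_mul, add_mul, one_mul, smul_mul_assoc, mul_assoc, mul_add, two_mul] at this
  rw [two_smul, ← this, mul_add, smul_add]
  abel

theorem mul_mul_sub_smul_mem {N : Submodule K E} (hN : N ≤ N.comap h.mulLeft) (δ : ℤˣ) {y : E}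
    (hy : y ∈ N) : P * (η δ * y) - δ • (η δ * y) ∈ N := by
  have hsub : P * (η δ * y) - δ • (η δ * y) = -(δ • y) - P * y := by
    have := congrArg (δ • ·) (h.add_sub_smul_mul δ y)
    simp only [smul_sub, smul_smul, Int.units_mul_self, one_smul, mul_add, smul_add, two_smul]
      at this
    rw [← sub_eq_zero] at this ⊢
    rw [← neg_eq_zero, ← this]
    abel
  rw [hsub, Units.smul_def]
  exact sub_mem (neg_mem (zsmul_mem hy _)) (hN hy)

theorem wordSpan_le_comap (m : ℕ) : wordSpan k P η m ≤ (wordSpan k P η m).comap h.mulLeft := by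
  induction m with
  | zero =>
    refine Submodule.span_le.2 ?_
    rintro _ ⟨i, rfl⟩
    exact Submodule.subset_span ⟨i + 1, pow_succ' P i⟩
  | succ m ih =>
    refine sup_le (ih.trans (Submodule.comap_mono le_sup_left)) (Submodule.span_le.2 ?_)
    rintro _ ⟨⟨δ, v⟩, rfl⟩
    change P * wordVal (k := k) η m δ v ∈ wordSpan k P η (m + 1)
    obtain ⟨y, hy, hv⟩ := exists_wordVal_eq_mul k P η δ v
    have hmul : P * (η δ * y) - δ • (η δ * y) ∈ wordSpan k P η (m + 1) :=
      Submodule.mem_sup_left (h.mul_mul_sub_smul_mem ih δ hy)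
    have hword : δ • wordVal (k := k) η m δ v ∈ wordSpan k P η (m + 1) := by
      rw [Units.smul_def]
      exact zsmul_mem (wordVal_mem_wordSpan δ v) _
    rw [← hv] at hmul
    rw [← sub_add_cancel (P * _) (δ • _)]
    exact add_mem hmul hword

/-- The map induced by multiplication by `P` modulo `wordSpan k P η m`. -/
def quotientMul (m : ℕ) :
    E ⧸ wordSpan k P η m →ₛₗ[(shift k).toRingHom] E ⧸ wordSpan k P η m :=
  Submodule.mapQ _ _ h.mulLeft (h.wordSpan_le_comap m)

theorem quotientMul_wordVal {m : ℕ} (δ : ℤˣ) (v : Exponents m) :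
    h.quotientMul m ((wordSpan k P η m).mkQ (wordVal (k := k) η m δ v)) =
      δ • (wordSpan k P η m).mkQ (wordVal (k := k) η m δ v) := by
  obtain ⟨y, hy, hv⟩ := exists_wordVal_eq_mul k P η δ v
  rw [hv, Units.smul_def, ← map_zsmul, ← Units.smul_def]
  exact (Submodule.Quotient.eq _).2 (h.mul_mul_sub_smul_mem (h.wordSpan_le_comap m) δ hy)

theorem pow_mul_smul_one (i : ℕ) :
    P ^ i * (algebraMap k[X] K X • (1 : E)) = (algebraMap k[X] K X - i) • P ^ i := by
  induction i with
  | zero => simp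
  | succ i ih =>
    rw [pow_succ', mul_assoc, ih, h.mul_smul, map_sub, shift_X, map_natCast, Nat.cast_succ,
      sub_sub, add_comm]

theorem exists_add_shift_eq [CharZero k] {m : ℕ}
    (hindep : LinearIndependent K fun i : ℤˣ × Exponents m =>
      (wordSpan k P η m).mkQ (wordVal (k := k) η m i.1 i.2))
    {δ : ℤˣ} {F : Exponents m →₀ K}
    (hF : η δ * Finsupp.linearCombination K (wordVal (k := k) η m (-δ)) F ∈
      wordSpan k P η (m + 1))
    (a : Exponents m) : ∃ g, g + shift k g = F a := by
  set Y := Finsupp.linearCombination K (wordVal (k := k) η m (-δ)) F with hY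
  set e : ℤˣ × Exponents m → E ⧸ wordSpan k P η m :=
    fun i => (wordSpan k P η m).mkQ (wordVal (k := k) η m i.1 i.2)
  have hmap : (wordSpan k P η (m + 1)).map (wordSpan k P η m).mkQ =
      Submodule.span K (Set.range e) := by
    rw [wordSpan, Submodule.map_sup, Submodule.mkQ_map_self, bot_sup_eq, Submodule.map_span,
      ← Set.range_comp]
    rfl
  have hYmem : Y ∈ wordSpan k P η (m + 1) :=
    Submodule.sum_mem _ fun v _ => Submodule.smul_mem _ _ (wordVal_mem_wordSpan _ v)
  have hspan : (wordSpan k P η m).mkQ (η δ * Y + Y) ∈ Submodule.span K (Set.range e) :=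
    hmap ▸ Submodule.mem_map_of_mem (add_mem hF hYmem)
  have hYe : (wordSpan k P η m).mkQ Y =
      Finsupp.linearCombination K e (F.mapDomain (Prod.mk (-δ))) := by
    rw [Finsupp.linearCombination_mapDomain, hY, Finsupp.apply_linearCombination]
    rfl
  have hsub : (wordSpan k P η m).mkQ (η δ * Y + Y) -
      δ • h.quotientMul m ((wordSpan k P η m).mkQ (η δ * Y + Y)) =
        Finsupp.linearCombination K e ((2 : K) • F.mapDomain (Prod.mk (-δ))) := by
    rw [LinearMap.map_smul, ← hYe, ← LinearMap.map_smul, ← h.add_sub_smul_mul δ Y, map_sub,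
      Units.smul_def δ, Units.smul_def δ, map_zsmul]
    rfl
  obtain ⟨g, hg⟩ := exists_add_map_eq (T := h.quotientMul m)
    (fun i => h.quotientMul_wordVal i.1 i.2) hindep hspan hsub (i := (-δ, a)) rfl
  rw [Finsupp.smul_apply, Finsupp.mapDomain_apply (Prod.mk_right_injective _)] at hg
  have : CharZero K := charZero_of_injective_algebraMap (algebraMap k K).injective
  refine ⟨g / 2, ?_⟩
  rw [map_div₀, map_ofNat, ← add_div, div_eq_iff two_ne_zero, mul_comm]
  exact hg

theorem linearIndependent_mkQ_wordVal_of_forall [CharZero k] [Algebra k E]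
    [IsScalarTower k K E] {m : ℕ}
    (hindep : ∀ δ, LinearIndependent k fun v : Exponents m =>
      (wordSpan k P η m).mkQ (wordVal (k := k) η m δ v)) :
    LinearIndependent K fun i : ℤˣ × Exponents m =>
      (wordSpan k P η m).mkQ (wordVal (k := k) η m i.1 i.2) := by
  refine linearIndependent_of_eigenvectors (σ := (shift k).toRingHom) (T := h.quotientMul m)
    (fun f => mem_range_algebraMap_of_shift_eq) (fun f => eq_zero_of_shift_eq_neg)
    (fun i => h.quotientMul_wordVal i.1 i.2) fun δ => ?_
  have hrange : {i : ℤˣ × Exponents m | i.1 = δ} = Set.range (Prod.mk δ) := by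
    ext ⟨δ', v⟩
    simp [eq_comm]
  rw [hrange, linearIndepOn_range_iff (Prod.mk_right_injective δ)]
  exact hindep δ

theorem linearIndependent_mkQ_wordVal_succ [CharZero k] [Algebra k E]
    [IsScalarTower k K E] {m : ℕ}
    (hindep : LinearIndependent K fun i : ℤˣ × Exponents m =>
      (wordSpan k P η m).mkQ (wordVal (k := k) η m i.1 i.2)) (δ : ℤˣ) :
    LinearIndependent k fun v : Exponents (m + 1) =>
      (wordSpan k P η (m + 1)).mkQ (wordVal (k := k) η (m + 1) δ v) := by
  refine linearIndependent_iff.2 fun (c : Exponents m × {n : ℤ // n ≠ 0} →₀ k) hc => ?_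
  have hmem : Finsupp.linearCombination k
      (fun v => η δ * (ratio k ^ v.2.1 • wordVal (k := k) η m (-δ) v.1)) c ∈
        wordSpan k P η (m + 1) := by
    rw [← Submodule.Quotient.mk_eq_zero, ← hc]
    exact Finsupp.apply_linearCombination k ((wordSpan k P η (m + 1)).mkQ.restrictScalars k) _ c
  rw [linearCombination_mul_smul_wordVal] at hmem
  refine Finsupp.ext fun v => ?_
  obtain ⟨g, hg⟩ := h.exists_add_shift_eq hindep hmem v.1
  have hsum : g + shift k g = Finsupp.linearCombination k (fun n : ℤ => ratio k ^ n)
      ((c.curry v.1).mapDomain Subtype.val) := by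
    rw [Finsupp.linearCombination_mapDomain]
    exact hg
  have hcoeff := coeff_eq_zero_of_add_shift_eq hsum v.2.2
  rwa [Finsupp.mapDomain_apply Subtype.val_injective] at hcoeff

variable [IsScalarTower (FractionRing k[X]) E E] [CharZero k] [Nontrivial E]

/-- The powers of `P` are eigenvectors of the right multiplication by `X`. -/
theorem linearIndependent_pow (hP : IsUnit P) : LinearIndependent K (P ^ · : ℕ → E) := by
  have : CharZero K := charZero_of_injective_algebraMap (algebraMap k K).injective
  let f : Module.End K E :=
    { toFun := fun x => x * (algebraMap k[X] K X • 1)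
      map_add' := fun x y => add_mul x y _
      map_smul' := fun c x => smul_mul_assoc c x _ }
  refine Module.End.eigenvectors_linearIndependent' f (fun i : ℕ => algebraMap k[X] K X - i)
    (fun i j hij => Nat.cast_injective (sub_right_injective hij)) _ fun i => ?_
  exact ⟨Module.End.mem_eigenspace_iff.2 (h.pow_mul_smul_one i), (hP.pow i).ne_zero⟩

theorem eq_zero_of_mul_smul_one_mem (hP : IsUnit P) {δ : ℤˣ} {F : K}
    (hF : η δ * F • 1 ∈ wordSpan k P η 0) : F = 0 := by
  have : CharZero K := charZero_of_injective_algebraMap (algebraMap k K).injective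
  have hmem : η δ * F • 1 + F • 1 ∈ wordSpan k P η 0 :=
    add_mem hF (Submodule.smul_mem _ _ (one_mem_wordSpan P η 0))
  have hsub : η δ * F • 1 + F • 1 - δ • h.mulLeft (η δ * F • 1 + F • 1) = (2 * F) • P ^ 0 := by
    rw [pow_zero]
    exact (h.add_sub_smul_mul δ (F • 1)).trans (smul_smul _ _ _)
  have h2F := eq_zero_of_sub_smul_map_eq (h.linearIndependent_pow hP)
    (fun i => (pow_succ' P i).symm) hmem hsub
  exact (mul_eq_zero.1 h2F).resolve_left two_ne_zero

variable [Algebra k E] [IsScalarTower k (FractionRing k[X]) E]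

theorem linearIndependent_mkQ_wordVal_zero (hP : IsUnit P) (δ : ℤˣ) :
    LinearIndependent k fun n : Exponents 0 =>
      (wordSpan k P η 0).mkQ (wordVal (k := k) η 0 δ n) := by
  let φ : K →ₗ[k] E ⧸ wordSpan k P η 0 := (wordSpan k P η 0).mkQ.restrictScalars k ∘ₗ
    LinearMap.mulLeft k (η δ) ∘ₗ (LinearMap.toSpanSingleton K E 1).restrictScalars k
  refine linearIndependent_ratio_zpow.map' φ (LinearMap.ker_eq_bot'.2 fun F hF => ?_)
  exact h.eq_zero_of_mul_smul_one_mem hP ((Submodule.Quotient.mk_eq_zero _).1 hF)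

theorem linearIndependent_mkQ_wordVal (hP : IsUnit P) (m : ℕ) :
    LinearIndependent K fun i : ℤˣ × Exponents m =>
      (wordSpan k P η m).mkQ (wordVal (k := k) η m i.1 i.2) := by
  induction m with
  | zero =>
    exact h.linearIndependent_mkQ_wordVal_of_forall (h.linearIndependent_mkQ_wordVal_zero hP)
  | succ m ih =>
    exact h.linearIndependent_mkQ_wordVal_of_forall (h.linearIndependent_mkQ_wordVal_succ ih)

theorem linearIndependent_option_wordVal (hP : IsUnit P) (δ : ℤˣ) :
    LinearIndependent K fun o : Option (Σ m, Exponents m) =>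
      Option.casesOn' o (1 : E) fun s => wordVal (k := k) η s.1 δ s.2 := by
  have hquot := linearIndependent_mkQ_sigma (wordSpan_mono P η)
    (v := fun s : Σ m, Exponents m => wordVal (k := k) η s.1 δ s.2)
    (fun s => wordVal_mem_wordSpan δ s.2)
    fun m => (h.linearIndependent_mkQ_wordVal hP m).comp _ (Prod.mk_right_injective δ)
  refine linearIndependent_option'.2 ⟨hquot.of_comp _, fun hone => one_ne_zero (α := E) ?_⟩
  refine Submodule.disjoint_def.1 (Submodule.range_ker_disjoint hquot) 1 hone ?_
  rw [Submodule.ker_mkQ]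
  exact one_mem_wordSpan P η 0

end IsCayley

end Words

section FreeGroup

/-- The sign that tells which generator the words with `m + 1` exponents begin with. -/
def wordSign (m : ℕ) : ℤˣ := (-1) ^ (m + 1)

theorem wordSign_zero : wordSign 0 = -1 := pow_one _

theorem wordSign_succ (m : ℕ) : wordSign (m + 1) = -wordSign m := by
  rw [wordSign, pow_succ, mul_neg_one, wordSign]

/-- The generators of the free group of rank two, indexed by the two signs. -/
def letter (δ : ℤˣ) : FreeGroup (Fin 2) := .of (if δ = 1 then 1 else 0)

/-- The word with the given exponents, in which the letters alternate and the last one is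
`letter (-1)`. -/
def word : ∀ m, Exponents m → FreeGroup (Fin 2)
  | 0, n => letter (-1) ^ (show ℤ from n)
  | m + 1, v => letter (wordSign (m + 1)) ^ v.2.1 * word m v.1

theorem exists_word_eq_letter_zpow_mul (δ : ℤˣ) (j : ℤ) (m : ℕ) (v : Exponents m) :
    ∃ m' v', word m' v' = letter δ ^ j * word m v := by
  obtain rfl | hj := eq_or_ne j 0
  · exact ⟨m, v, by rw [zpow_zero, one_mul]⟩
  obtain rfl | hδ := eq_or_ne δ (wordSign m)
  · cases m with
    | zero => exact ⟨0, j + (show ℤ from v), zpow_add _ _ _⟩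
    | succ m =>
      obtain ⟨v, n, hn⟩ := v
      obtain hsum | hsum := eq_or_ne (j + n) 0
      · refine ⟨m, v, ?_⟩
        change _ = _ * (letter _ ^ n * _)
        rw [← mul_assoc, ← zpow_add, hsum, zpow_zero, one_mul]
      · refine ⟨m + 1, (v, ⟨j + n, hsum⟩), ?_⟩
        change letter _ ^ (j + n) * _ = _ * (letter _ ^ n * _)
        rw [← mul_assoc, ← zpow_add]
  · have hsign : wordSign (m + 1) = δ := by
      rw [wordSign_succ, Int.units_ne_iff_eq_neg.1 hδ]
    exact ⟨m + 1, (v, ⟨j, hj⟩), congrArg (letter · ^ j * word m v) hsign⟩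

theorem exists_word_eq (g : FreeGroup (Fin 2)) : ∃ m v, word m v = g := by
  have hletter (i : Fin 2) : ∃ δ, letter δ = .of i := by
    fin_cases i
    exacts [⟨-1, rfl⟩, ⟨1, rfl⟩]
  have hg : g ∈ Subgroup.closure (Set.range FreeGroup.of) :=
    FreeGroup.closure_range_of (Fin 2) ▸ Subgroup.mem_top g
  induction hg using Subgroup.closure_induction_left with
  | one => exact ⟨0, (0 : ℤ), zpow_zero _⟩
  | mul_left x hx y hy ih =>
    obtain ⟨⟨i, rfl⟩, m, v, rfl⟩ := hx, ih
    obtain ⟨δ, hδ⟩ := hletter i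
    simpa only [hδ, zpow_one] using exists_word_eq_letter_zpow_mul δ 1 m v
  | inv_mul_cancel x hx y hy ih =>
    obtain ⟨⟨i, rfl⟩, m, v, rfl⟩ := hx, ih
    obtain ⟨δ, hδ⟩ := hletter i
    simpa only [hδ, zpow_neg_one] using exists_word_eq_letter_zpow_mul δ (-1) m v

/-- The empty word or a word with given exponents: the part of a normal form that follows the
initial power of `letter (-1)`. -/
def tail (o : Option (Σ m, Exponents m)) : FreeGroup (Fin 2) :=
  Option.casesOn' o 1 fun s => word s.1 s.2

theorem exists_normal_form (g : FreeGroup (Fin 2)) :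
    ∃ (n : ℤ) (o : Option (Σ m, Exponents m)),
      g = letter (-1) ^ n * tail o ∧ ∀ s ∈ o, wordSign s.1 = 1 := by
  obtain ⟨m, v, rfl⟩ := exists_word_eq g
  obtain hm | hm := Int.units_eq_one_or (wordSign m)
  · exact ⟨0, some ⟨m, v⟩, by rw [zpow_zero, one_mul, tail, Option.casesOn'_some],
      by rintro _ ⟨⟩; exact hm⟩
  cases m with
  | zero => exact ⟨v, none, (mul_one _).symm, by rintro _ ⟨⟩⟩
  | succ m =>
    refine ⟨v.2.1, some ⟨m, v.1⟩, by rw [word, hm, tail, Option.casesOn'_some], ?_⟩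
    rintro _ ⟨⟩
    rwa [wordSign_succ, neg_inj] at hm

end FreeGroup

section Evaluation

variable {G : Type*} [Group G]

/-- The evaluation of the free group of rank two at `u` and its conjugate by `κ`. -/
def evalHom (u κ : G) : FreeGroup (Fin 2) →* G :=
  FreeGroup.lift ![u, κ * u * κ⁻¹]

/-- The element that conjugates `u` to the value of `letter δ` under `evalHom u κ`. -/
def conjugator (κ : G) (δ : ℤˣ) : G := if δ = 1 then κ else 1

theorem conjugator_neg_one (κ : G) : conjugator κ (-1) = 1 := rfl

theorem evalHom_letter (u κ : G) (δ : ℤˣ) :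
    evalHom u κ (letter δ) = conjugator κ δ * u * (conjugator κ δ)⁻¹ := by
  obtain rfl | rfl := Int.units_eq_one_or δ <;> simp [evalHom, letter, conjugator]

theorem map_comp_evalHom {H : Type*} [Group H] (f : G →* H) (u κ : G) :
    f.comp (evalHom u κ) = evalHom (f u) (f κ) := by
  refine FreeGroup.ext_hom _ _ fun i => ?_
  fin_cases i <;> simp [evalHom]

end Evaluation

theorem zpow_mul_eq_smul {K E : Type*} [Field K] [Ring E] [Module K E] [IsScalarTower K E E]
    {f : K} (hf : f ≠ 0) {u : Eˣ} (hu : (u : E) = f • (1 : E)) (n : ℤ) (x : E) :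
    (u ^ n : Eˣ) * x = f ^ n • x := by
  have hmap : u = Units.map MonoidHom.smulOneHom (Units.mk0 f hf) := Units.ext hu
  rw [hmap, ← map_zpow, Units.coe_map, MonoidHom.smulOneHom_apply, smul_one_mul,
    Units.val_zpow_eq_zpow_val, Units.val_mk0]

section Independence

variable {k E : Type*} [Field k] [Ring E] [Module (FractionRing k[X]) E]
  [IsScalarTower (FractionRing k[X]) E E]

local notation "K" => FractionRing k[X]

variable (u κ : Eˣ)

/-- The element of `E` that occurs between a power of the generator other than `letter δ` and a
power of `letter δ` in the value of a word under `evalHom u κ`. -/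
def transition (δ : ℤˣ) : E := ↑((conjugator κ (-δ))⁻¹ * conjugator κ δ)

variable {u}

theorem evalHom_word (hu : (u : E) = ratio k • (1 : E)) (m : ℕ) (v : Exponents m) :
    (evalHom u κ (word m v) : E) =
      conjugator κ (-wordSign m) * wordVal (k := k) (transition κ) m (wordSign m) v := by
  have hpow (n : ℤ) (x : E) : (u ^ n : Eˣ) * x = ratio k ^ n • x :=
    zpow_mul_eq_smul ratio_ne_zero hu n x
  induction m with
  | zero =>
    rw [word, wordVal, map_zpow, evalHom_letter, wordSign_zero, transition, ← hpow, mul_one,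
      conjugator_neg_one, one_mul, inv_one, mul_one, ← Units.val_mul, ← Units.val_mul,
      mul_one, mul_inv_cancel_left]
  | succ m ih =>
    rw [word, wordVal, map_mul, map_zpow, Units.val_mul, ih, evalHom_letter, conj_zpow, transition,
      ← hpow, wordSign_succ, neg_neg]
    simp only [Units.val_mul, mul_assoc, Units.inv_mul_cancel_left, Units.mul_inv_cancel_left]

theorem evalHom_tail (hu : (u : E) = ratio k • (1 : E)) {o : Option (Σ m, Exponents m)}
    (ho : ∀ s ∈ o, wordSign s.1 = 1) :
    (evalHom u κ (tail o) : E) = Option.casesOn' o (1 : E) fun s =>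
      wordVal (k := k) (transition κ) s.1 1 s.2 := by
  cases o with
  | none => rw [tail, Option.casesOn'_none, map_one, Units.val_one, Option.casesOn'_none]
  | some s =>
    rw [tail, Option.casesOn'_some, Option.casesOn'_some, evalHom_word κ hu, ho s rfl,
      conjugator_neg_one, Units.val_one, one_mul]

variable {κ} [CharZero k] [Nontrivial E] [Algebra k E]
  [IsScalarTower k (FractionRing k[X]) E] {P : E}

theorem linearIndependent_evalHom (h : IsCayley (k := k) P (transition κ)) (hP : IsUnit P)
    (hu : (u : E) = ratio k • (1 : E)) :
    LinearIndependent k fun g => (evalHom u κ g : E) := by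
  choose n o hg ho using exists_normal_form
  have hinj : Function.Injective fun g => (n g, o g) := fun g g' hgg' => by
    rw [hg g, hg g', show n g = n g' from congrArg Prod.fst hgg',
      show o g = o g' from congrArg Prod.snd hgg']
  convert (linearIndependent_smul linearIndependent_ratio_zpow
    (h.linearIndependent_option_wordVal hP 1)).comp _ hinj using 2 with g
  rw [Function.comp_apply, ← evalHom_tail κ hu (ho g), ← zpow_mul_eq_smul ratio_ne_zero hu,
    ← Units.val_mul]
  conv_lhs => rw [hg g, map_mul, map_zpow, evalHom_letter, conjugator_neg_one, one_mul, inv_one,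
    mul_one]

theorem lift_evalHom_injective (h : IsCayley (k := k) P (transition κ)) (hP : IsUnit P)
    (hu : (u : E) = ratio k • (1 : E)) : Function.Injective
      (MonoidAlgebra.lift k E (FreeGroup (Fin 2)) ((Units.coeHom E).comp (evalHom u κ))) := by
  refine (injective_iff_map_eq_zero _).2 fun r hr => ?_
  rw [MonoidAlgebra.lift_apply] at hr
  have hindep := linearIndependent_evalHom (k := k) h hP hu
  have hcoeff := linearIndependent_iff.1 hindep r.coeff <|
    (Finsupp.linearCombination_apply k r.coeff).trans hr
  exact MonoidAlgebra.ext hcoeff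

end Independence

section Commutator

variable {k E : Type*} [Field k] [Ring E]

local notation "K" => FractionRing k[X]

theorem isCayley_transition [Module (FractionRing k[X]) E] {P : E}
    (hsmul : ∀ (f : K) (x : E), P * f • x = shift k f • (P * x)) {κ : Eˣ}
    (hκ : (1 - P) * κ = 1 + P) : IsCayley (k := k) P (transition κ) := by
  refine ⟨hsmul, fun δ => ?_⟩
  obtain rfl | rfl := Int.units_eq_one_or δ
  · rw [show transition κ 1 = κ by simp [transition, conjugator], one_smul, mul_add, hκ, mul_one,
      add_add_sub_cancel, one_add_one_eq_two]
  · have hinv : (1 + P) * (κ⁻¹ : Eˣ) = 1 - P := by rw [← hκ, Units.mul_inv_cancel_right]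
    rw [show transition κ (-1) = (κ⁻¹ : Eˣ) by simp [transition, conjugator], Units.neg_smul,
      one_smul, sub_neg_eq_add, mul_add, hinv, mul_one, sub_add_add_cancel, one_add_one_eq_two]

variable [Algebra k E] {s : E} (hs : ∀ p : k[X], p ≠ 0 → IsUnit (aeval s p))

/-- The evaluation of rational functions at an element of a not necessarily commutative ring, at
which the nonzero polynomials take invertible values. -/
def fractionEval : K →+* E :=
  OreLocalization.universalHom (S := nonZeroDivisors k[X]) (aeval s : k[X] →ₐ[k] E).toRingHom
    (IsUnit.liftRight (((aeval s : k[X] →ₐ[k] E) : k[X] →* E).comp (nonZeroDivisors k[X]).subtype)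
      fun p => hs p.1 (nonZeroDivisors.ne_zero p.2))
    fun _ => rfl

theorem fractionEval_algebraMap (p : k[X]) :
    fractionEval hs (algebraMap k[X] K p) = aeval s p :=
  OreLocalization.universalHom_commutes _ _ _

theorem fractionEval_ratio_mul :
    fractionEval hs (ratio k) * (s - algebraMap k E (1 / 2)) = s := by
  have hne : algebraMap k[X] K (X - C (1 / 2)) ≠ 0 := by
    rw [Ne, IsFractionRing.to_map_eq_zero_iff]
    exact X_sub_C_ne_zero _
  have heval : fractionEval hs (algebraMap k[X] K (X - C (1 / 2))) =
      s - algebraMap k E (1 / 2) := by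
    rw [fractionEval_algebraMap, map_sub, aeval_X, aeval_C]
  rw [← heval, ← map_mul, ratio, div_mul_cancel₀ _ hne, fractionEval_algebraMap, aeval_X]

theorem mul_aeval {P : E} (hP : s * P - P * s = P) (p : k[X]) :
    P * aeval s p = aeval s (taylor (-1) p) * P := by
  have hX : SemiconjBy P s (s - 1) := by
    rw [SemiconjBy, sub_mul, one_mul, eq_sub_iff_add_eq, ← eq_sub_iff_add_eq', hP]
  induction p using Polynomial.induction_on' with
  | add p q hp hq => rw [map_add, map_add, map_add, mul_add, add_mul, hp, hq]
  | monomial n c =>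
    rw [taylor_monomial, aeval_monomial, map_mul, aeval_C, map_pow, map_add, aeval_X, aeval_C,
      map_neg, map_one, ← sub_eq_add_neg, ← mul_assoc, ← Algebra.commutes, mul_assoc,
      (hX.pow_right n).eq, mul_assoc]

theorem mul_fractionEval {P : E} (hP : s * P - P * s = P) (f : K) :
    P * fractionEval hs f = fractionEval hs (shift k f) * P := by
  obtain ⟨p, q, hq, hf⟩ := exists_mul_algebraMap_eq f
  have hunit : IsUnit (fractionEval hs (algebraMap k[X] K q)) := by
    rw [fractionEval_algebraMap]
    exact hs q hq
  refine hunit.mul_right_cancel ?_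
  calc P * fractionEval hs f * fractionEval hs (algebraMap k[X] K q)
      = fractionEval hs (shift k (algebraMap k[X] K p)) * P := by
        rw [mul_assoc, ← map_mul, hf, fractionEval_algebraMap, mul_aeval hP, shift_algebraMap,
          fractionEval_algebraMap]
    _ = fractionEval hs (shift k f) * (fractionEval hs (shift k (algebraMap k[X] K q)) * P) := by
        rw [← hf, map_mul, map_mul, mul_assoc]
    _ = fractionEval hs (shift k f) * P * fractionEval hs (algebraMap k[X] K q) := by
        rw [shift_algebraMap, fractionEval_algebraMap, ← mul_aeval hP, fractionEval_algebraMap,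
          mul_assoc]

include hs

theorem lift_evalHom_injective_of_units [CharZero k] [Nontrivial E] {P : E}
    (hsP : s * P - P * s = P) (hP : IsUnit P) {u κ : Eˣ}
    (hu : u * (s - algebraMap k E (1 / 2)) = s) (hκ : (1 - P) * κ = 1 + P) : Function.Injective
      (MonoidAlgebra.lift k E (FreeGroup (Fin 2)) ((Units.coeHom E).comp (evalHom u κ))) := by
  let _ : Module K E := Module.compHom E (fractionEval hs)
  have smul_eq (f : K) (x : E) : f • x = fractionEval hs f * x := rfl
  have : IsScalarTower K E E := ⟨fun f x y => mul_assoc (fractionEval hs f) x y⟩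
  have : IsScalarTower k K E := IsScalarTower.of_algebraMap_smul fun c x => by
    rw [smul_eq, IsScalarTower.algebraMap_apply k k[X] K, fractionEval_algebraMap,
      Polynomial.algebraMap_eq, aeval_C, Algebra.smul_def]
  refine lift_evalHom_injective (isCayley_transition (fun f x => ?_) hκ) hP ?_
  · rw [smul_eq, smul_eq, ← mul_assoc, ← mul_assoc, mul_fractionEval hs hsP]
  · have hunit := hs (X - C (1 / 2)) (X_sub_C_ne_zero _)
    rw [map_sub, aeval_X, aeval_C] at hunit
    rw [smul_eq, mul_one]
    exact hunit.mul_right_cancel (hu.trans (fractionEval_ratio_mul hs).symm)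

theorem lift_evalHom_injective_of_commutator [CharZero k] [Nontrivial E] {A : Type*} [Ring A]
    [Algebra k A] (ψ : A →ₐ[k] E) {P : E} (hsP : s * P - P * s = P) (hP : IsUnit P) {u κ : Aˣ}
    (hu : ψ u * (s - algebraMap k E (1 / 2)) = s) (hκ : (1 - P) * ψ κ = 1 + P) :
    Function.Injective
      (MonoidAlgebra.lift k A (FreeGroup (Fin 2)) ((Units.coeHom A).comp (evalHom u κ))) := by
  have hcomp : ψ.comp (MonoidAlgebra.lift k A (FreeGroup (Fin 2))
      ((Units.coeHom A).comp (evalHom u κ))) = MonoidAlgebra.lift k E (FreeGroup (Fin 2))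
      ((Units.coeHom E).comp (evalHom (Units.map (ψ : A →* E) u) (Units.map (ψ : A →* E) κ))) := by
    rw [← map_comp_evalHom (Units.map (ψ : A →* E)) u κ]
    refine MonoidAlgebra.algHom_ext (fun g => ?_) (Subsingleton.elim _ _)
    rw [AlgHom.comp_apply, MonoidAlgebra.lift_single, MonoidAlgebra.lift_single, one_smul, one_smul]
    rfl
  have hinj := lift_evalHom_injective_of_units hs hsP hP (u := Units.map (ψ : A →* E) u)
    (κ := Units.map (ψ : A →* E) κ) hu hκ
  rw [← hcomp] at hinj
  exact Function.Injective.of_comp hinj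

end Commutator

end SkewFree

namespace RingFiltration

open Polynomial

theorem mul_mem_of_add_eq {k A : Type*} [CommRing k] [Ring A] [Algebra k A] {F : ℤ → Submodule k A}
    [SetLike.GradedMonoid F] {i j l : ℤ} {a c : A} (ha : a ∈ F i) (hc : c ∈ F j) (h : i + j = l) :
    a * c ∈ F l :=
  h ▸ SetLike.mul_mem_graded ha hc

theorem commutator_mul_mem {k A : Type*} [CommRing k] [Ring A] [Algebra k A]
    {F : ℤ → Submodule k A} [SetLike.GradedMonoid F] {i j : ℤ} {x c c' : A} (hc : c ∈ F i)
    (hc' : c' ∈ F i) (h : x * c - c * x ∈ F j) (h' : x * c' - c' * x ∈ F j) :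
    x * (c * c') - c * c' * x ∈ F (i + j) := by
  have hsum : x * (c * c') - c * c' * x = (x * c - c * x) * c' + c * (x * c' - c' * x) := by
    noncomm_ring
  rw [hsum]
  exact add_mem (mul_mem_of_add_eq h hc' (add_comm j i)) (SetLike.mul_mem_graded hc h')

section Quotient

variable {k A : Type*} [CommRing k] [Ring A] [Algebra k A] (F : ℤ → Submodule k A)
  [SetLike.GradedMonoid F]

/-- The ideal of the elements of negative degree in the subring of the elements of degree at most
zero, for an increasing filtration `F` of a ring by the integers. -/
def negativeIdeal : Ideal (SetLike.GradeZero.subalgebra F) where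
  carrier := {x | (x : A) ∈ F (-1)}
  add_mem' hx hy := (F (-1)).add_mem hx hy
  zero_mem' := (F (-1)).zero_mem
  smul_mem' c _ hx := mul_mem_of_add_eq c.2 hx (zero_add (-1))

instance : (negativeIdeal F).IsTwoSided where
  mul_mem_of_left c hx := mul_mem_of_add_eq hx c.2 (add_zero (-1))

/-- The homogeneous component of degree zero of the associated graded ring of a filtration. -/
abbrev GradeZeroQuotient : Type _ := SetLike.GradeZero.subalgebra F ⧸ negativeIdeal F

variable {F}

theorem gradeZeroQuotient_nontrivial (h : (1 : A) ∉ F (-1)) : Nontrivial (GradeZeroQuotient F) :=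
  Ideal.Quotient.nontrivial_iff.2 ((Ideal.ne_top_iff_one _).2 h)

/-- The projection to the homogeneous component of degree zero of the associated graded ring, on a
subalgebra of elements of degree at most zero. -/
def toGradeZeroQuotient {T : Subalgebra k A} (hT : T ≤ SetLike.GradeZero.subalgebra F) :
    T →ₐ[k] GradeZeroQuotient F :=
  (Ideal.Quotient.mkₐ k (negativeIdeal F)).comp (Subalgebra.inclusion hT)

theorem toGradeZeroQuotient_eq {T : Subalgebra k A} (hT : T ≤ SetLike.GradeZero.subalgebra F)
    {x y : T} (h : (x - y : A) ∈ F (-1)) : toGradeZeroQuotient hT x = toGradeZeroQuotient hT y :=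
  Ideal.Quotient.eq.2 h

end Quotient

section Homogenization

variable {k A : Type*} [CommRing k] [Ring A] [Algebra k A]

/-- The evaluation at two elements of the homogenization of a polynomial in one variable, with the
powers of the first element on the left. -/
def homogEval (f : k[X]) (a z : A) : A :=
  ∑ i ∈ Finset.range (f.natDegree + 1), f.coeff i • (a ^ i * z ^ (f.natDegree - i))

theorem map_homogEval {B : Type*} [Ring B] [Algebra k B] (φ : A →ₐ[k] B) (f : k[X]) (a z : A) :
    φ (homogEval f a z) = homogEval f (φ a) (φ z) := by
  simp only [homogEval, map_sum, map_smul, map_mul, map_pow]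

theorem homogEval_mul_pow {z y : A} (hzy : z * y = 1) (f : k[X]) (a : A) :
    homogEval f a z * y ^ f.natDegree =
      ∑ i ∈ Finset.range (f.natDegree + 1), f.coeff i • (a ^ i * y ^ i) := by
  rw [homogEval, Finset.sum_mul]
  refine Finset.sum_congr rfl fun i hi => ?_
  obtain ⟨j, hj⟩ := Nat.exists_eq_add_of_le' (Finset.mem_range_succ_iff.1 hi)
  rw [smul_mul_assoc, mul_assoc, hj, Nat.add_sub_cancel, pow_add, ← mul_assoc (z ^ j),
    pow_mul_pow_eq_one j hzy, one_mul]

theorem homogEval_X_sub_C_mul [Nontrivial k] {z y : A} (hzy : z * y = 1) (c : k) (a : A) :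
    homogEval (X - C c) a z * y ^ (X - C c).natDegree = a * y - algebraMap k A c := by
  rw [homogEval_mul_pow hzy, natDegree_X_sub_C, Finset.sum_range_succ, Finset.sum_range_one]
  simp [Algebra.algebraMap_eq_smul_one, sub_eq_neg_add]

end Homogenization

section Commutators

variable {k A : Type*} [CommRing k] [Ring A] [Algebra k A] {F : ℤ → Submodule k A}
  [SetLike.GradedMonoid F] {e : ℤ} {a p z y : A}

theorem pow_mem_mul {i : ℤ} (ha : a ∈ F i) (n : ℕ) : a ^ n ∈ F (n * i) :=
  nsmul_eq_mul n i ▸ SetLike.pow_mem_graded n ha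

theorem inv_commutator_mem (hy : y ∈ F (-e)) (hzy : z * y = 1) (hyz : y * z = 1)
    (h : z * a - a * z ∈ F (2 * e - 1)) : y * a - a * y ∈ F (-1) := by
  have hconj : y * a - a * y = -(y * (z * a - a * z) * y) := by
    rw [mul_sub, sub_mul, ← mul_assoc, hyz, one_mul, mul_assoc, mul_assoc a, hzy, mul_one, neg_sub]
  rw [hconj]
  exact neg_mem (mul_mem_of_add_eq (SetLike.mul_mem_graded hy h) hy (by ring))

theorem pow_commutator_mem (hy : y ∈ F (-e)) (h : y * a - a * y ∈ F (-1)) (i : ℕ) :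
    y ^ i * a - a * y ^ i ∈ F (-(i * e) + e - 1) := by
  induction i with
  | zero => simp
  | succ i ih =>
    have hsplit : y ^ (i + 1) * a - a * y ^ (i + 1) =
        y ^ i * (y * a - a * y) + (y ^ i * a - a * y ^ i) * y := by
      rw [pow_succ]
      noncomm_ring
    rw [hsplit]
    exact add_mem (mul_mem_of_add_eq (pow_mem_mul hy i) h (by push_cast; ring))
      (mul_mem_of_add_eq ih hy (by push_cast; ring))

theorem mul_pow_sub_mem (ha : a ∈ F e) (hy : y ∈ F (-e)) (h : y * a - a * y ∈ F (-1)) (i : ℕ) :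
    (a * y) ^ i - a ^ i * y ^ i ∈ F (-1) := by
  induction i with
  | zero => simp
  | succ i ih =>
    have hsplit : (a * y) ^ (i + 1) - a ^ (i + 1) * y ^ (i + 1) =
        ((a * y) ^ i - a ^ i * y ^ i) * (a * y) + a ^ i * (y ^ i * a - a * y ^ i) * y := by
      rw [pow_succ, pow_succ, pow_succ]
      noncomm_ring
    rw [hsplit]
    exact add_mem (mul_mem_of_add_eq ih (SetLike.mul_mem_graded ha hy) (by ring))
      (mul_mem_of_add_eq (SetLike.mul_mem_graded (pow_mem_mul ha i) (pow_commutator_mem hy h i))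
        hy (by ring))

theorem aeval_mul_sub_homogEval_mem (ha : a ∈ F e) (hy : y ∈ F (-e)) (hzy : z * y = 1)
    (h : y * a - a * y ∈ F (-1)) (f : k[X]) :
    aeval (a * y) f - homogEval f a z * y ^ f.natDegree ∈ F (-1) := by
  rw [homogEval_mul_pow hzy, aeval_eq_sum_range, ← Finset.sum_sub_distrib]
  refine sum_mem fun i _ => ?_
  rw [← smul_sub]
  exact Submodule.smul_mem _ _ (mul_pow_sub_mem ha hy h i)

theorem mul_commutator_sub_mem (ha : a ∈ F e) (hp : p ∈ F e) (hy : y ∈ F (-e)) (hzy : z * y = 1)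
    (hya : y * a - a * y ∈ F (-1)) (hyp : y * p - p * y ∈ F (-1))
    (h : a * p - p * a - p * z ∈ F (2 * e - 1)) :
    a * y * (p * y) - p * y * (a * y) - p * y ∈ F (-1) := by
  have hpzy : p * z * y = p := by rw [mul_assoc, hzy, mul_one]
  have hsplit : a * y * (p * y) - p * y * (a * y) - p * y =
      (a * p - p * a - p * z) * y * y + a * (y * p - p * y) * y - p * (y * a - a * y) * y := by
    rw [sub_mul _ (p * z) y, hpzy]
    noncomm_ring
  rw [hsplit]
  refine sub_mem (add_mem ?_ ?_) ?_
  · exact mul_mem_of_add_eq (SetLike.mul_mem_graded h hy) hy (by ring)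
  · exact mul_mem_of_add_eq (SetLike.mul_mem_graded ha hyp) hy (by ring)
  · exact mul_mem_of_add_eq (SetLike.mul_mem_graded hp hya) hy (by ring)

end Commutators

section FreeGroupAlgebra

variable {k A : Type*} [Field k] [Ring A] [Algebra k A] {F : ℤ → Submodule k A}
  [SetLike.GradedMonoid F] {T : Subalgebra k A} {e : ℤ} {a p z y : A}

theorem exists_unit_mul_sub_algebraMap (hzy : z * y = 1)
    (h : ∀ f : k[X], f ≠ 0 → ∃ v : Tˣ, (v : A) = homogEval f a z * y ^ f.natDegree) (c : k) :
    ∃ v : Tˣ, (v : A) = a * y - algebraMap k A c :=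
  (h (X - C c) (X_sub_C_ne_zero c)).imp fun _ hv => hv.trans (homogEval_X_sub_C_mul hzy c a)

theorem isUnit_aeval_toGradeZeroQuotient (hT : T ≤ SetLike.GradeZero.subalgebra F) (ha : a ∈ F e)
    (hy : y ∈ F (-e)) (hzy : z * y = 1) (hya : y * a - a * y ∈ F (-1)) {s : T}
    (hs : (s : A) = a * y) {f : k[X]}
    (h : ∃ v : Tˣ, (v : A) = homogEval f a z * y ^ f.natDegree) :
    IsUnit (aeval (toGradeZeroQuotient hT s) f) := by
  obtain ⟨v, hv⟩ := h
  have heq : toGradeZeroQuotient hT (aeval s f) = toGradeZeroQuotient hT v := by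
    refine toGradeZeroQuotient_eq hT ?_
    rw [show (aeval (s : T) f : A) = aeval (s : A) f from (aeval_algHom_apply T.val s f).symm, hs,
      hv]
    exact aeval_mul_sub_homogEval_mem ha hy hzy hya f
  rw [aeval_algHom_apply, heq]
  exact v.isUnit.map _

/-- With `y = z⁻¹`, the images of `s = a z⁻¹` and `P = p z⁻¹` in the component of degree zero of
the associated graded ring satisfy `s P - P s = P`. -/
theorem exists_freeGroupAlgebra_embedding [CharZero k] (hF : (1 : A) ∉ F (-1))
    (hT : T ≤ SetLike.GradeZero.subalgebra F) (ha : a ∈ F e) (hp : p ∈ F e) (hy : y ∈ F (-e))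
    (hzy : z * y = 1) (hyz : y * z = 1) (hza : z * a - a * z ∈ F (2 * e - 1))
    (hzp : z * p - p * z ∈ F (2 * e - 1)) (hap : a * p - p * a - p * z ∈ F (2 * e - 1))
    (hua : ∀ f : k[X], f ≠ 0 → ∃ v : Tˣ, (v : A) = homogEval f a z * y ^ f.natDegree)
    (hup : ∀ f : k[X], f ≠ 0 → ∃ v : Tˣ, (v : A) = homogEval f p z * y ^ f.natDegree) :
    ∃ f : MonoidAlgebra k (FreeGroup (Fin 2)) →ₐ[k] T, Function.Injective f := by
  have := gradeZeroQuotient_nontrivial hF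
  have hya := inv_commutator_mem hy hzy hyz hza
  have hyp := inv_commutator_mem hy hzy hyz hzp
  obtain ⟨s, hs⟩ := exists_unit_mul_sub_algebraMap hzy hua 0
  obtain ⟨s', hs'⟩ := exists_unit_mul_sub_algebraMap hzy hua (1 / 2)
  obtain ⟨P, hP⟩ := exists_unit_mul_sub_algebraMap hzy hup 0
  obtain ⟨P₁, hP₁⟩ := exists_unit_mul_sub_algebraMap hzy hup (-1)
  obtain ⟨P₂, hP₂⟩ := exists_unit_mul_sub_algebraMap hzy hup 1
  rw [map_zero, sub_zero] at hs hP
  rw [← hs] at hs'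
  rw [← hP, map_neg, map_one, sub_neg_eq_add] at hP₁
  rw [← hP, map_one] at hP₂
  have es' : (s' : T) = s - algebraMap k T (1 / 2) := Subtype.ext hs'
  have eP₁ : (P₁ : T) = P + 1 := Subtype.ext hP₁
  have eP₂ : (P₂ : T) = P - 1 := Subtype.ext hP₂
  set ψ := toGradeZeroQuotient hT
  have hsP : ψ s * ψ P - ψ P * ψ s = ψ P := by
    rw [← map_mul, ← map_mul, ← map_sub]
    refine toGradeZeroQuotient_eq hT ?_
    push_cast
    rw [hs, hP]
    exact mul_commutator_sub_mem ha hp hy hzy hya hyp hap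
  refine ⟨_, SkewFree.lift_evalHom_injective_of_commutator (s := ψ s) (u := s * s'⁻¹)
    (κ := -(P₂⁻¹ * P₁)) (fun f hf => ?_) ψ hsP (P.isUnit.map ψ) ?_ ?_⟩
  · exact isUnit_aeval_toGradeZeroQuotient hT ha hy hzy hya hs (hua f hf)
  · rw [← AlgHom.commutes ψ, ← map_sub, ← es', ← map_mul, Units.val_mul,
      Units.inv_mul_cancel_right]
  · rw [← map_one ψ, ← map_sub, ← map_add, ← map_mul, add_comm, ← eP₁, ← neg_sub, ← eP₂,
      Units.val_neg, neg_mul_neg, Units.val_mul, Units.mul_inv_cancel_left]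

end FreeGroupAlgebra

end RingFiltration

namespace Cohn

open MvPolynomial PBW RingFiltration

section ExactWeights

attribute [local instance] LieRing.ofAssociativeRing LieAlgebra.ofAssociativeAlgebra

variable {ι k L : Type*} [LinearOrder ι] [Field k] [LieRing L] [LieAlgebra k L]

variable {b : Module.Basis ι k L} {w : ι → ℤ} {m n : ℕ} {e j : ℤ}
  {a c z : UniversalEnvelopingAlgebra k L}

namespace HasExactWeight

theorem one : HasExactWeight b w 0 0 1 where
  mem_filtration := one_mem_filtration k L 0
  mem_weightU := SetLike.one_mem_graded _
  principalSymbol_notMem := by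
    rw [principalSymbol_one]
    exact one_notMem_weightLE w

theorem mul (ha : HasExactWeight b w m e a) (hc : HasExactWeight b w n j c) :
    HasExactWeight b w (m + n) (e + j) (a * c) where
  mem_filtration := mul_mem_filtration k L ha.mem_filtration hc.mem_filtration
  mem_weightU := SetLike.mul_mem_graded ha.mem_weightU hc.mem_weightU
  principalSymbol_notMem := by
    have h := (ha.isExact.mul hc.isExact).2
    rwa [← reesMonomial_mul, reesSymbol_reesMonomial] at h

theorem pow (ha : HasExactWeight b w n e a) (d : ℕ) :
    HasExactWeight b w (d * n) (d • e) (a ^ d) := by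
  induction d with
  | zero => simpa using one
  | succ d ih => simpa only [Nat.succ_mul, succ_nsmul, pow_succ] using ih.mul ha

theorem smul (ha : HasExactWeight b w n e a) {r : k} (hr : r ≠ 0) :
    HasExactWeight b w n e (r • a) where
  mem_filtration := Submodule.smul_mem _ r ha.mem_filtration
  mem_weightU := Submodule.smul_mem _ r ha.mem_weightU
  principalSymbol_notMem := by
    rw [map_smul, Submodule.smul_mem_iff _ hr]
    exact ha.principalSymbol_notMem

theorem add_of_mem (ha : HasExactWeight b w (n + 1) e a) (hc : c ∈ filtration k L n)
    (hcw : c ∈ weightU b w e) : HasExactWeight b w (n + 1) e (c + a) where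
  mem_filtration := add_mem (filtration_mono k L n.le_succ hc) ha.mem_filtration
  mem_weightU := add_mem hcw ha.mem_weightU
  principalSymbol_notMem := by
    rw [map_add, principalSymbol_succ b hc, zero_add]
    exact ha.principalSymbol_notMem

theorem pow_mul_pow_mem_filtration (ha : HasExactWeight b w (m + 1) e a)
    (hz : HasExactWeight b w m e z) {i d : ℕ} (h : i ≤ d) :
    a ^ i * z ^ (d - i) ∈ filtration k L (d * m + i) := by
  obtain ⟨j, rfl⟩ := Nat.exists_eq_add_of_le h
  rw [Nat.add_sub_cancel_left, show (i + j) * m + i = i * (m + 1) + j * m by ring]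
  exact mul_mem_filtration k L (ha.pow i).mem_filtration (hz.pow j).mem_filtration

theorem pow_mul_pow_mem_weightU (ha : HasExactWeight b w (m + 1) e a)
    (hz : HasExactWeight b w m e z) {i d : ℕ} (h : i ≤ d) :
    a ^ i * z ^ (d - i) ∈ weightU b w (d • e) := by
  obtain ⟨j, rfl⟩ := Nat.exists_eq_add_of_le h
  rw [Nat.add_sub_cancel_left, add_nsmul]
  exact SetLike.mul_mem_graded (ha.pow i).mem_weightU (hz.pow j).mem_weightU

theorem homogEval (ha : HasExactWeight b w (m + 1) e a) (hz : HasExactWeight b w m e z)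
    {f : Polynomial k} (hf : f ≠ 0) :
    HasExactWeight b w (f.natDegree * (m + 1)) (f.natDegree • e) (homogEval f a z) := by
  have hlead : HasExactWeight b w (f.natDegree * (m + 1)) (f.natDegree • e)
      (f.coeff f.natDegree • a ^ f.natDegree) :=
    (ha.pow f.natDegree).smul (Polynomial.leadingCoeff_ne_zero.2 hf)
  rw [RingFiltration.homogEval, Finset.sum_range_succ, Nat.sub_self, pow_zero, mul_one]
  rcases hd : f.natDegree with _ | d
  · simpa [hd] using hlead
  · rw [hd] at hlead
    have hfil : (d + 1) * (m + 1) = (d + 1) * m + d + 1 := by ring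
    rw [hfil] at hlead ⊢
    refine hlead.add_of_mem (sum_mem fun i hi => Submodule.smul_mem _ _ ?_)
      (sum_mem fun i hi => Submodule.smul_mem _ _ ?_)
    · have hi' := Finset.mem_range.1 hi
      exact filtration_mono k L (by omega) (ha.pow_mul_pow_mem_filtration hz hi'.le)
    · exact ha.pow_mul_pow_mem_weightU hz (Finset.mem_range.1 hi).le

theorem embedding_mem_weightDiv (ha : HasExactWeight b w n e a) :
    embedding k L a ∈ weightDiv b w e :=
  Cohn.embedding_mem_weightDiv ha.mem_filtration ha.mem_weightU

theorem isUnit_embedding (ha : HasExactWeight b w n e a) : IsUnit (embedding k L a) :=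
  Cohn.isUnit_embedding b ha.mem_filtration fun h =>
    ha.principalSymbol_notMem (h ▸ zero_mem _)

end HasExactWeight

variable (b w) in
/-- The elements of weight at most zero of the division subring generated by `U(L)`. -/
abbrev weightZeroSubalgebra : Subalgebra k (DivRing k L) :=
  divSubring k L ⊓ SetLike.GradeZero.subalgebra (weightDiv b w)

theorem HasExactWeight.exists_unit_weightZeroSubalgebra {d : ℕ}
    (hc : HasExactWeight b w n (d • e) c) (hz : HasExactWeight b w m e z) (Z : (DivRing k L)ˣ)
    (hZ : (Z : DivRing k L) = embedding k L z) :
    ∃ v : (weightZeroSubalgebra b w)ˣ,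
      (v : DivRing k L) = embedding k L c * (↑Z⁻¹ : DivRing k L) ^ d := by
  obtain ⟨C, hC⟩ := hc.isUnit_embedding
  have hZ' : (↑Z⁻¹ : DivRing k L) ∈ weightDiv b w (-e) :=
    hz.inv_mem_weightDiv (hZ ▸ Z.mul_inv)
  have hC' : (↑C⁻¹ : DivRing k L) ∈ weightDiv b w (-(d • e)) :=
    hc.inv_mem_weightDiv (hC ▸ C.mul_inv)
  set V := C * Z⁻¹ ^ d with hV
  have hv : (V : DivRing k L) ∈ weightZeroSubalgebra b w := by
    rw [hV, Units.val_mul, Units.val_pow_eq_pow_val, hC]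
    refine ⟨mul_mem (embedding_mem_divSubring c) (pow_mem (inv_mem_divSubring Z ?_) d),
      mul_mem_of_add_eq hc.embedding_mem_weightDiv (SetLike.pow_mem_graded d hZ') (by simp)⟩
    exact hZ ▸ embedding_mem_divSubring z
  have hv' : (↑V⁻¹ : DivRing k L) ∈ weightZeroSubalgebra b w := by
    rw [hV, mul_inv_rev, inv_pow, inv_inv, Units.val_mul, Units.val_pow_eq_pow_val, hZ]
    refine ⟨mul_mem (pow_mem (embedding_mem_divSubring z) d) (inv_mem_divSubring C ?_),
      mul_mem_of_add_eq (SetLike.pow_mem_graded d hz.embedding_mem_weightDiv) hC' (by simp)⟩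
    exact hC ▸ embedding_mem_divSubring c
  refine ⟨⟨⟨_, hv⟩, ⟨_, hv'⟩, Subtype.ext V.mul_inv, Subtype.ext V.inv_mul⟩, ?_⟩
  rw [← hC, ← Units.val_pow_eq_pow_val, ← Units.val_mul]

theorem exists_freeGroupAlgebra_embedding_of_commutator [CharZero k]
    {p : UniversalEnvelopingAlgebra k L}
    (ha : HasExactWeight b w (m + 1) e a) (hp : HasExactWeight b w (m + 1) e p)
    (hz : HasExactWeight b w m e z) (hza : z * a - a * z ∈ weightU b w (2 * e - 1))
    (hzp : z * p - p * z ∈ weightU b w (2 * e - 1))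
    (hap : a * p - p * a - p * z ∈ weightU b w (2 * e - 1)) :
    ∃ f : MonoidAlgebra k (FreeGroup (Fin 2)) →ₐ[k] divSubring k L, Function.Injective f := by
  obtain ⟨Z, hZ⟩ := hz.isUnit_embedding
  have hap_filtration : a * p - p * a - p * z ∈ filtration k L (m + 1 + m) :=
    sub_mem (commutator_mem_filtration k L _ _ hp.mem_filtration a ha.mem_filtration)
      (mul_mem_filtration k L hp.mem_filtration hz.mem_filtration)
  have hz_commutator {x : UniversalEnvelopingAlgebra k L} (hx : HasExactWeight b w (m + 1) e x)
      (h : z * x - x * z ∈ weightU b w (2 * e - 1)) :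
      embedding k L z * embedding k L x - embedding k L x * embedding k L z ∈
        weightDiv b w (2 * e - 1) := by
    simpa only [map_sub, map_mul] using embedding_mem_weightDiv
      (commutator_mem_filtration k L _ _ hx.mem_filtration z hz.mem_filtration) h
  have hunit {x : UniversalEnvelopingAlgebra k L} (hx : HasExactWeight b w (m + 1) e x)
      (f : Polynomial k) (hf : f ≠ 0) : ∃ v : (weightZeroSubalgebra b w)ˣ, (v : DivRing k L) =
        homogEval f (embedding k L x) (embedding k L z) * (↑Z⁻¹ : DivRing k L) ^ f.natDegree := by
    rw [← map_homogEval]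
    exact (hx.homogEval hz hf).exists_unit_weightZeroSubalgebra hz Z hZ
  obtain ⟨f, hf⟩ := exists_freeGroupAlgebra_embedding (F := weightDiv b w)
    (T := weightZeroSubalgebra b w) (a := embedding k L a) (p := embedding k L p)
    (z := embedding k L z) (y := ↑Z⁻¹) (e := e) one_notMem_weightDiv inf_le_right
    ha.embedding_mem_weightDiv hp.embedding_mem_weightDiv
    (hz.inv_mem_weightDiv (hZ ▸ Z.mul_inv)) (hZ ▸ Z.mul_inv) (hZ ▸ Z.inv_mul)
    (hz_commutator ha hza) (hz_commutator hp hzp)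
    (by simpa only [map_sub, map_mul] using embedding_mem_weightDiv hap_filtration hap)
    (hunit ha) (hunit hp)
  exact ⟨(Subalgebra.inclusion inf_le_left).comp f,
    (Subalgebra.inclusion_injective inf_le_left).comp hf⟩

end ExactWeights

section LieCases

attribute [local instance] LieRing.ofAssociativeRing LieAlgebra.ofAssociativeAlgebra

open UniversalEnvelopingAlgebra (ι)

section Weights

variable {I k L : Type*} [LinearOrder I] [Field k] [LieRing L] [LieAlgebra k L]
  {b : Module.Basis I k L} {w : I → ℤ}

theorem ι_mem_weightU_of_le (hw : IsLieWeight b w) {j : ℤ} (h : ∀ i, w i ≤ j) (x : L) :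
    ι k x ∈ weightU b w j := by
  induction b.mem_span x using Submodule.span_induction with
  | mem _ hx =>
    obtain ⟨i, rfl⟩ := hx
    exact weightU_mono (h i) (ι_mem_weightU hw i)
  | zero => exact (map_zero (ι k (L := L))).symm ▸ zero_mem _
  | add x y _ _ hx hy => exact (map_add (ι k) x y).symm ▸ add_mem hx hy
  | smul c x _ hx => exact (map_smul (ι k) c x).symm ▸ Submodule.smul_mem _ c hx

theorem ι_mem_filtration_one (x : L) : ι k x ∈ filtration k L 1 :=
  (pow_one (filtrationOne k L)).ge (ι_mem_filtrationOne k L x)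

theorem ι_mul_sub_mul (x y : L) : ι k x * ι k y - ι k y * ι k x = ι k ⁅x, y⁆ := by
  rw [LieHom.map_lie, LieRing.of_associative_ring_bracket]

theorem hasExactWeight_ι_basis (hw : IsLieWeight b w) (i : I) :
    HasExactWeight b w 1 (w i) (ι k (b i)) where
  mem_filtration := ι_mem_filtration_one (b i)
  mem_weightU := ι_mem_weightU hw i
  principalSymbol_notMem := principalSymbol_ι_basis b i ▸ X_notMem_weightLE w i

theorem hasExactWeight_ι_zero {x : L} (hx : x ≠ 0) : HasExactWeight b 0 1 0 (ι k x) where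
  mem_filtration := ι_mem_filtration_one x
  mem_weightU := ι_mem_weightU_of_le (fun _ _ _ _ => le_rfl) (fun _ => le_rfl) x
  principalSymbol_notMem := by
    rw [zero_sub, weightLE_zero_neg_one, Submodule.mem_bot]
    exact principalSymbol_ι_ne_zero b hx

end Weights

variable {k L : Type*} [Field k] [CharZero k] [LieRing L] [LieAlgebra k L]

theorem exists_freeGroupAlgebra_embedding_of_lie_eq_self {x y : L} (hy : y ≠ 0) (hxy : ⁅x, y⁆ = y) :
    ∃ f : MonoidAlgebra k (FreeGroup (Fin 2)) →ₐ[k] divSubring k L, Function.Injective f := by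
  let b := Module.Basis.ofVectorSpace k L
  let _ : LinearOrder (Module.Basis.ofVectorSpaceIndex k L) :=
    IsWellOrder.linearOrder WellOrderingRel
  have hx : x ≠ 0 := by
    rintro rfl
    exact hy (hxy ▸ zero_lie y)
  refine exists_freeGroupAlgebra_embedding_of_commutator (hasExactWeight_ι_zero (b := b) hx)
    (hasExactWeight_ι_zero hy) .one (by simp) (by simp) ?_
  rw [mul_one, ι_mul_sub_mul, hxy, sub_self]
  exact zero_mem _

/-- The derivation `⁅½YX, ·⁆` sends `X²` to `X²Z` when `Z = ⁅Y, X⁆` commutes with `X`. -/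
theorem half_mul_commutator {A : Type*} [Ring A] [Algebra k A] {X Y Z : A}
    (hZ : Y * X - X * Y = Z) :
    (2⁻¹ : k) • (Y * X) * (X * X) - X * X * ((2⁻¹ : k) • (Y * X)) - X * X * Z =
      X * (Z * X - X * Z) + (2⁻¹ : k) • ((Z * X - X * Z) * X) := by
  refine smul_right_injective A (two_ne_zero (α := k)) ?_
  simp only [smul_add, smul_sub, smul_smul, smul_mul_assoc, mul_smul_comm,
    mul_inv_cancel₀ (two_ne_zero : (2 : k) ≠ 0), one_smul, two_smul]
  rw [← hZ]
  noncomm_ring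

theorem exists_freeGroupAlgebra_embedding_of_basis {I : Type*} [LinearOrder I]
    (b : Module.Basis I k L) {w : I → ℤ} (hw1 : ∀ i, 1 ≤ w i) (hw2 : ∀ i, w i ≤ 2) {i j l : I}
    (hi : w i = 1) (hj : w j = 1) (hl : w l = 2) (hb : ⁅b j, b i⁆ = b l) :
    ∃ f : MonoidAlgebra k (FreeGroup (Fin 2)) →ₐ[k] divSubring k L, Function.Injective f := by
  have hw : IsLieWeight b w := fun i j l _ => by linarith [hw1 i, hw1 j, hw2 l]
  have hX : HasExactWeight b w 1 1 (ι k (b i)) := hi ▸ hasExactWeight_ι_basis hw i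
  have hY : HasExactWeight b w 1 1 (ι k (b j)) := hj ▸ hasExactWeight_ι_basis hw j
  have hZ : HasExactWeight b w 1 2 (ι k (b l)) := hl ▸ hasExactWeight_ι_basis hw l
  have hXX : HasExactWeight b w (1 + 1) 2 (ι k (b i) * ι k (b i)) := hX.mul hX
  have hYX : HasExactWeight b w (1 + 1) 2 ((2⁻¹ : k) • (ι k (b j) * ι k (b i))) :=
    (hY.mul hX).smul (inv_ne_zero two_ne_zero)
  have hcomm (x y : L) : ι k x * ι k y - ι k y * ι k x ∈ weightU b w 2 :=
    ι_mul_sub_mul (k := k) x y ▸ ι_mem_weightU_of_le hw hw2 ⁅x, y⁆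
  have hweight : (2 * 2 - 1 : ℤ) = 1 + 2 := by norm_num
  refine exists_freeGroupAlgebra_embedding_of_commutator hYX hXX hZ ?_ ?_ ?_ <;> rw [hweight]
  · rw [mul_smul_comm, smul_mul_assoc, ← smul_sub]
    exact Submodule.smul_mem _ _
      (commutator_mul_mem hY.mem_weightU hX.mem_weightU (hcomm _ _) (hcomm _ _))
  · exact commutator_mul_mem hX.mem_weightU hX.mem_weightU (hcomm _ _) (hcomm _ _)
  · rw [half_mul_commutator (k := k) ((ι_mul_sub_mul _ _).trans (congrArg (ι k) hb))]
    exact add_mem (SetLike.mul_mem_graded hX.mem_weightU (hcomm _ _))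
      (Submodule.smul_mem _ _
        (mul_mem_of_add_eq (hcomm _ _) hX.mem_weightU (add_comm (2 : ℤ) 1)))

theorem exists_freeGroupAlgebra_embedding_of_linearIndependent {x y : L}
    (h : LinearIndependent k ![x, y, ⁅y, x⁆]) :
    ∃ f : MonoidAlgebra k (FreeGroup (Fin 2)) →ₐ[k] divSubring k L, Function.Injective f := by
  classical
  let b := Module.Basis.extend h.linearIndepOn_id
  let _ : LinearOrder (h.linearIndepOn_id.extend (Set.subset_univ _)) :=
    IsWellOrder.linearOrder WellOrderingRel
  let v : Fin 3 → h.linearIndepOn_id.extend (Set.subset_univ _) := fun j =>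
    ⟨_, Module.Basis.subset_extend _ (Set.mem_range_self j)⟩
  have hv : Function.Injective v := fun i j hij => h.injective (congrArg Subtype.val hij)
  have hb (j : Fin 3) : b (v j) = ![x, y, ⁅y, x⁆] j := Module.Basis.extend_apply_self _ _
  refine exists_freeGroupAlgebra_embedding_of_basis b
    (w := fun i => if i = v 0 ∨ i = v 1 then 1 else 2) (i := v 0) (j := v 1) (l := v 2)
    (fun i => ?_) (fun i => ?_) (if_pos (.inl rfl)) (if_pos (.inr rfl))
    (if_neg (not_or.2 ⟨hv.ne (by decide), hv.ne (by decide)⟩)) ?_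
  · split_ifs <;> norm_num
  · split_ifs <;> norm_num
  · rw [hb, hb, hb]
    rfl

end LieCases

section LieAlgebra

variable {k L : Type*} [Field k] [LieRing L] [LieAlgebra k L]

theorem exists_lie_lie_eq_self {x y : L} (h : ¬LinearIndependent k ![x, y, ⁅y, x⁆])
    (hyx : ⁅y, x⁆ ≠ 0) : ∃ u : L, ⁅u, ⁅y, x⁆⁆ = ⁅y, x⁆ := by
  rw [Fintype.not_linearIndependent_iff] at h
  obtain ⟨c, hc, j, hj⟩ := h
  replace hc : c 0 • x + c 1 • y + c 2 • ⁅y, x⁆ = 0 := by rwa [Fin.sum_univ_three] at hc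
  have hlie_y : c 0 • ⁅y, x⁆ = ⁅-c 2 • y, ⁅y, x⁆⁆ := by
    have := congrArg (⁅y, ·⁆) hc
    simp only [lie_add, lie_smul, lie_self, lie_zero, smul_zero, add_zero] at this
    rw [neg_smul, neg_lie, smul_lie]
    exact eq_neg_of_add_eq_zero_left this
  have hlie_x : c 1 • ⁅y, x⁆ = ⁅c 2 • x, ⁅y, x⁆⁆ := by
    have := congrArg (⁅x, ·⁆) hc
    simp only [lie_add, lie_smul, lie_self, lie_zero, smul_zero, zero_add] at this
    rw [← lie_skew, smul_neg] at this
    rw [smul_lie]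
    exact neg_add_eq_zero.1 this
  have eigen {r : k} {u : L} (hr : r ≠ 0) (hu : r • ⁅y, x⁆ = ⁅u, ⁅y, x⁆⁆) :
      ⁅r⁻¹ • u, ⁅y, x⁆⁆ = ⁅y, x⁆ := by
    rw [smul_lie, ← hu, inv_smul_smul₀ hr]
  by_cases h0 : c 0 = 0
  · by_cases h1 : c 1 = 0
    · have h2 : c 2 = 0 := by simpa [h0, h1, hyx] using hc
      fin_cases j
      exacts [(hj h0).elim, (hj h1).elim, (hj h2).elim]
    · exact ⟨_, eigen h1 hlie_x⟩
  · exact ⟨_, eigen h0 hlie_y⟩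

end LieAlgebra

end Cohn

end

theorem theorem1p1_general {k L : Type*} [Field k] [CharZero k] [LieRing L] [LieAlgebra k L]
    (hL : ¬IsLieAbelian L) :
    ∃ f : MonoidAlgebra k (FreeGroup (Fin 2)) →ₐ[k] Cohn.divSubring k L,
      Function.Injective f := by
  obtain ⟨y, x, hyx⟩ : ∃ y x : L, ⁅y, x⁆ ≠ 0 := by
    by_contra! htrivial
    exact hL ⟨htrivial⟩
  by_cases h : LinearIndependent k ![x, y, ⁅y, x⁆]
  · exact Cohn.exists_freeGroupAlgebra_embedding_of_linearIndependent h
  · obtain ⟨u, hu⟩ := Cohn.exists_lie_lie_eq_self h hyx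
    exact Cohn.exists_freeGroupAlgebra_embedding_of_lie_eq_self hyx hu

theorem theorem1p1 (k : Type*) (L : Type*) [Field k] [CharZero k] [LieRing L] [LieAlgebra k L]
    (hL : ¬ IsLieAbelian L)
    (h : IsResiduallyNilpotent k L ∨ IsOreDomain (UniversalEnvelopingAlgebra k L)) :
    ∃ f : MonoidAlgebra k (FreeGroup (Fin 2)) →ₐ[k] Cohn.divSubring k L,
      Function.Injective f :=
  theorem1p1_general hL
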